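/- **Theorem 2.** For every constant dimension $d$ there are a randomized algorithm (one fixed program, which may depend on $d$ only) and a constant $C=C(d)$ such that the following holds for all $n\ge 2$, all $\varepsilon>0$ and all axis-aligned boxes $O_i=[a_{i,1},b_{i,1}]\times\dots\times[a_{i,d},b_{i,d}]\subset\mathbb{R}^d$, $1\le i\le n$, with $a_{i,k}\le b_{i,k}$. On input $n$, $\varepsilon$ and the coordinates $a_{i,k},b_{i,k}$, the algorithm always halts within $$C\cdot\Bigl(n+\frac1{\varepsilon^2}\Bigr)\cdot(\log n)^{2d+1}$$ steps, and with probability at least $0.9$ it outputs a $(1+\varepsilon)$-approximation of $V=\mathrm{Vol}(O_1\cup\dots\cup O_n)$, that is, a number $v$ with $V/(1+\varepsilon)\le v\le(1+\varepsilon)V$ (so that in particular $|v-V|\le\varepsilon V$). The model of computation is the randomized real RAM. Its memory consists of finitely many unbounded arrays of natural numbers and of real numbers, initially zero outside the input. The unit-time operations are: reading and writing a cell whose index is a natural number computed by the program; natural constants, addition, truncated subtraction, halving with rounding down, and comparison of natural numbers; conversion of a natural number to a real number; addition, subtraction, multiplication, division and comparison of real numbers; Boolean connectives and branching; and drawing an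 independent uniform random real number from $[0,1]$. (There is no rounding of real numbers to integers.) -/

import Mathlib

/-!
A randomized real RAM, given by a small structured programming language with an explicit step count.

The memory consists of arrays of natural numbers and arrays of real numbers, both named by natural
numbers and indexed by natural numbers; a scalar variable is a cell of an array. A program is a
finite object, so it mentions finitely many arrays by name. The only operations on reals are
`+`, `-`, `*`, `/`, comparison, and drawing a uniform random number from `[0,1]`. In particular
there is no rounding of reals to integers and there are no real constants besides natural numbers.
The only operations on naturals are `+`, truncated `-`, halving, and comparison.
-/

namespace RealRAM

/-- The memory of the machine: `nat a i` and `real a i` are the cells with index `i` of the arrays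
named `a`; `pos` is the number of random numbers that have been drawn so far. -/
structure State where
  nat : ℕ → ℕ → ℕ
  real : ℕ → ℕ → ℝ
  pos : ℕ

namespace State

/-- Write `x` into cell `i` of the natural number array `a`. -/
def setNat (s : State) (a i x : ℕ) : State :=
  { s with nat := Function.update s.nat a (Function.update (s.nat a) i x) }

/-- Write `x` into cell `i` of the real array `a`. -/
noncomputable def setReal (s : State) (a i : ℕ) (x : ℝ) : State :=
  { s with real := Function.update s.real a (Function.update (s.real a) i x) }

/-- Record that one random number has been drawn. -/
def advance (s : State) : State :=
  { s with pos := s.pos + 1 }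

end State

/-- Natural number expressions; `get a i` reads a cell of the array `a`. -/
inductive NExp where
  | const (k : ℕ)
  | get (a : ℕ) (i : NExp)
  | add (x y : NExp)
  | sub (x y : NExp)
  | half (x : NExp)

namespace NExp

/-- The value of an expression. -/
def eval (s : State) : NExp → ℕ
  | const k => k
  | get a i => s.nat a (i.eval s)
  | add x y => x.eval s + y.eval s
  | sub x y => x.eval s - y.eval s
  | half x => x.eval s / 2

/-- The number of elementary operations needed to evaluate an expression. -/
def cost : NExp → ℕ
  | const _ => 1
  | get _ i => i.cost + 1
  | add x y => x.cost + y.cost + 1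
  | sub x y => x.cost + y.cost + 1
  | half x => x.cost + 1

end NExp

/-- Real expressions; `get a i` reads a cell of the array `a`. -/
inductive RExp where
  | ofNat (x : NExp)
  | get (a : ℕ) (i : NExp)
  | add (x y : RExp)
  | sub (x y : RExp)
  | mul (x y : RExp)
  | div (x y : RExp)

namespace RExp

/-- The value of an expression (a division by zero returns zero). -/
noncomputable def eval (s : State) : RExp → ℝ
  | ofNat x => (x.eval s : ℝ)
  | get a i => s.real a (i.eval s)
  | add x y => x.eval s + y.eval s
  | sub x y => x.eval s - y.eval s
  | mul x y => x.eval s * y.eval s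
  | div x y => x.eval s / y.eval s

/-- The number of elementary operations needed to evaluate an expression. -/
def cost : RExp → ℕ
  | ofNat x => x.cost + 1
  | get _ i => i.cost + 1
  | add x y => x.cost + y.cost + 1
  | sub x y => x.cost + y.cost + 1
  | mul x y => x.cost + y.cost + 1
  | div x y => x.cost + y.cost + 1

end RExp

/-- Tests. -/
inductive BExp where
  | natLt (x y : NExp)
  | realLt (x y : RExp)
  | neg (b : BExp)
  | conj (b c : BExp)

namespace BExp

/-- The truth value of a test. -/
def Holds (s : State) : BExp → Prop
  | natLt x y => x.eval s < y.eval s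
  | realLt x y => x.eval s < y.eval s
  | neg b => ¬ b.Holds s
  | conj b c => b.Holds s ∧ c.Holds s

/-- The number of elementary operations needed to evaluate a test. -/
def cost : BExp → ℕ
  | natLt x y => x.cost + y.cost + 1
  | realLt x y => x.cost + y.cost + 1
  | neg b => b.cost + 1
  | conj b c => b.cost + c.cost + 1

end BExp

/-- Programs. `setNat a i e` and `setReal a i e` store the value of `e` in cell `i` of the array
`a`, and `sample a i` stores a fresh uniform random number from `[0,1]` in cell `i` of the real
array `a`. -/
inductive Prog where
  | skip
  | setNat (a : ℕ) (i : NExp) (e : NExp)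
  | setReal (a : ℕ) (i : NExp) (e : RExp)
  | sample (a : ℕ) (i : NExp)
  | seq (p q : Prog)
  | ite (b : BExp) (p q : Prog)
  | while (b : BExp) (p : Prog)

/-- An outcome of the random source: the sequence of random numbers that it delivers. -/
abbrev Source : Type := ℕ → unitInterval

/-- The law of the random source: the numbers are independent and uniform on `[0,1]`. -/
noncomputable def sourceLaw : MeasureTheory.Measure Source :=
  MeasureTheory.Measure.infinitePi (fun _ : ℕ => (MeasureTheory.volume : MeasureTheory.Measure unitInterval))

/-- `Exec ω p s t s'`: with the random source delivering `ω`, the program `p` started in the state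
`s` halts in the state `s'` after exactly `t` steps. -/
inductive Exec (ω : Source) : Prog → State → ℕ → State → Prop
  | skip (s : State) : Exec ω .skip s 1 s
  | setNat (a : ℕ) (i e : NExp) (s : State) :
      Exec ω (.setNat a i e) s (i.cost + e.cost + 1) (s.setNat a (i.eval s) (e.eval s))
  | setReal (a : ℕ) (i : NExp) (e : RExp) (s : State) :
      Exec ω (.setReal a i e) s (i.cost + e.cost + 1) (s.setReal a (i.eval s) (e.eval s))
  | sample (a : ℕ) (i : NExp) (s : State) :
      Exec ω (.sample a i) s (i.cost + 1) (s.setReal a (i.eval s) (ω s.pos : ℝ)).advance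
  | seq {p q : Prog} {s s' s'' : State} {t t' : ℕ}
      (hp : Exec ω p s t s') (hq : Exec ω q s' t' s'') : Exec ω (.seq p q) s (t + t') s''
  | iteTrue {b : BExp} {p q : Prog} {s s' : State} {t : ℕ}
      (hb : b.Holds s) (hp : Exec ω p s t s') : Exec ω (.ite b p q) s (b.cost + 1 + t) s'
  | iteFalse {b : BExp} {p q : Prog} {s s' : State} {t : ℕ}
      (hb : ¬ b.Holds s) (hq : Exec ω q s t s') : Exec ω (.ite b p q) s (b.cost + 1 + t) s'
  | whileTrue {b : BExp} {p : Prog} {s s' s'' : State} {t t' : ℕ}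
      (hb : b.Holds s) (hp : Exec ω p s t s') (hw : Exec ω (.while b p) s' t' s'') :
      Exec ω (.while b p) s (b.cost + 1 + t + t') s''
  | whileFalse {b : BExp} {p : Prog} {s : State}
      (hb : ¬ b.Holds s) : Exec ω (.while b p) s (b.cost + 1) s

/-- The machine is deterministic once the outcome of the random source is fixed. -/
theorem Exec.unique {ω : Source} {p : Prog} {s s₁ s₂ : State} {t₁ t₂ : ℕ}
    (h₁ : Exec ω p s t₁ s₁) (h₂ : Exec ω p s t₂ s₂) : t₁ = t₂ ∧ s₁ = s₂ := by
  induction h₁ generalizing t₂ s₂ with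
  | skip s => cases h₂; exact ⟨rfl, rfl⟩
  | setNat a i e s => cases h₂; exact ⟨rfl, rfl⟩
  | setReal a i e s => cases h₂; exact ⟨rfl, rfl⟩
  | sample a i s => cases h₂; exact ⟨rfl, rfl⟩
  | seq _ _ ihp ihq =>
    cases h₂ with
    | seq hp' hq' =>
      obtain ⟨rfl, rfl⟩ := ihp hp'
      obtain ⟨rfl, rfl⟩ := ihq hq'
      exact ⟨rfl, rfl⟩
  | iteTrue hb _ ih =>
    cases h₂ with
    | iteTrue _ h => obtain ⟨rfl, rfl⟩ := ih h; exact ⟨rfl, rfl⟩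
    | iteFalse hb' _ => exact absurd hb hb'
  | iteFalse hb _ ih =>
    cases h₂ with
    | iteTrue hb' _ => exact absurd hb' hb
    | iteFalse _ h => obtain ⟨rfl, rfl⟩ := ih h; exact ⟨rfl, rfl⟩
  | whileTrue hb _ _ ihp ihw =>
    cases h₂ with
    | whileTrue _ hp' hw' =>
      obtain ⟨rfl, rfl⟩ := ihp hp'
      obtain ⟨rfl, rfl⟩ := ihw hw'
      exact ⟨rfl, rfl⟩
    | whileFalse hb' => exact absurd hb hb'
  | whileFalse hb =>
    cases h₂ with
    | whileTrue hb' _ _ => exact absurd hb' hb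
    | whileFalse _ => exact ⟨rfl, rfl⟩

end RealRAM

namespace Klee

/-- The initial memory for `n` boxes in dimension `d`, box `i` being the product of the intervals
`[lo i k, hi i k]`: cell `0` of the natural number array `0` holds `n`, cell `0` of the real array
`0` holds `ε`, the real arrays `1, …, d` hold the lower coordinates and the real arrays
`d + 1, …, 2 d` hold the upper coordinates, cell `i` belonging to box `i`. All other cells are `0`,
and no random number has been drawn. -/
noncomputable def input {n d : ℕ} (ε : ℝ) (lo hi : Fin n → Fin d → ℝ) : RealRAM.State where
  nat a i := if a = 0 ∧ i = 0 then n else 0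
  real a i :=
    if a = 0 ∧ i = 0 then ε
    else if h : i < n ∧ 1 ≤ a ∧ a ≤ d then lo ⟨i, h.1⟩ ⟨a - 1, by omega⟩
    else if h : i < n ∧ d + 1 ≤ a ∧ a ≤ 2 * d then hi ⟨i, h.1⟩ ⟨a - (d + 1), by omega⟩
    else 0
  pos := 0

/-- The output of a run: the number in cell `0` of the real array `0` when the program halts. -/
def output (s : RealRAM.State) : ℝ := s.real 0 0

/-- The volume of the union of the boxes. -/
noncomputable def unionVolume {n d : ℕ} (lo hi : Fin n → Fin d → ℝ) : ℝ :=
  MeasureTheory.volume.real (⋃ i, Set.Icc (lo i) (hi i))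

/-- `v` approximates `V` up to a factor of `1 + ε`, that is, `V / (1 + ε) ≤ v ≤ (1 + ε) V`. Since
`1 - ε ≤ 1 / (1 + ε)`, this entails `|v - V| ≤ ε V` for `V ≥ 0`. -/
def IsApprox (ε V v : ℝ) : Prop :=
  V / (1 + ε) ≤ v ∧ v ≤ (1 + ε) * V

end Klee

/-! The algorithm is stratified importance sampling over a dyadic refinement of the boxes. In each
coordinate direction the `2 n` endpoints are sorted and made the breakpoints of a complete binary
tree with `2 ^ L` leaves, where `2 ^ L` is the least power of two that is at least `2 n + 2`. A side
of a box is a union of at most `2 (L + 2)` node intervals (`cover`), so a box is a union of at most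
`(2 (L + 2)) ^ d` products of node intervals. Let `A` be the set of distinct node tuples that arise
(the items), `a τ` the volume of the node box of `τ`, `S` the sum of all `a τ`, and `V` the volume
of the union.

The refinement is useful because a point lies in exactly one node interval on each level of a tree.
The nodes containing it form a search path of length `L + 1`, so the point lies in at most `(L + 1)
^ d` node boxes. Hence `S ≤ (L + 1) ^ d * V` (`IsNodeSet.sum_volume_le`). Moreover, the number of
items containing a given point is found by looking up the `(L + 1) ^ d` tuples on its search paths
in a table of items, instead of testing all boxes. The table is an array indexed by a number that
encodes the tuple (`keyOf`); it needs no initialization, the memory being zero.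

Give every point `y` of the union the score `1 / pathCount y`, the inverse of the number of items
containing it. The integrals of the score over the items add up to `V`
(`IsNodeSet.sum_setIntegral`). So if the mean score over item `τ` is estimated from independent
uniform points, the sum of `a τ` times the estimates has expectation `V`. Item `τ` receives `⌈K * a
τ / S⌉` samples, with `K = 10 * ((1 + ε) / ε) ^ 2 * (L + 1) ^ d`. As scores lie in `[0,1]`, the
variance is at most `(S / K) * V ≤ (ε / (1 + ε) * V) ^ 2 / 10`, and Chebyshev's inequality
(`weightedAverages_deviation`) bounds the probability of a deviation of `ε / (1 + ε) * V` or more by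
`1 / 10`. The sample numbers are deterministic, so no random item has to be chosen; the ceiling is
realized by a counter and a comparison of reals, so no rounding is needed.

The number of samples is at most `K + |A|`, that is, of order `(n + 1 / ε ^ 2) * L ^ d`, and a
sample costs of order `L ^ d + L`. This gives the exponent `2 d + 1`; preprocessing is cheaper.

Correctness of the program is proved in a Hoare logic with time bounds (`Run`). Preprocessing draws
no random numbers, hence reaches the same state for all outcomes of the source
(`Exec.of_not_draws`); for that fixed state the output is a fixed function `estimator` of the
outcome, to which the probabilistic estimate applies. -/

namespace RealRAM

/-! ### Evaluation and cost rules of the machine language -/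

instance : Add NExp := ⟨.add⟩
instance : Sub NExp := ⟨.sub⟩
instance (k : ℕ) : OfNat NExp k := ⟨.const k⟩
instance : Add RExp := ⟨.add⟩
instance : Sub RExp := ⟨.sub⟩
instance : Mul RExp := ⟨.mul⟩
instance : Div RExp := ⟨.div⟩

namespace NExp

/-- The scalar variable `a`, that is, cell `0` of the array `a`. -/
abbrev var (a : ℕ) : NExp := .get a 0

@[simp] theorem eval_add (s : State) (x y : NExp) : (x + y).eval s = x.eval s + y.eval s := rfl
@[simp] theorem eval_sub (s : State) (x y : NExp) : (x - y).eval s = x.eval s - y.eval s := rfl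
@[simp] theorem eval_two (s : State) : (2 : NExp).eval s = 2 := rfl
@[simp] theorem eval_ten (s : State) : (10 : NExp).eval s = 10 := rfl
@[simp] theorem eval_zero (s : State) : (0 : NExp).eval s = 0 := rfl
@[simp] theorem eval_one (s : State) : (1 : NExp).eval s = 1 := rfl
@[simp] theorem eval_get (s : State) (a : ℕ) (i : NExp) :
    (get a i).eval s = s.nat a (i.eval s) := rfl
@[simp] theorem eval_half (s : State) (x : NExp) : (half x).eval s = x.eval s / 2 := rfl
@[simp] theorem cost_add (x y : NExp) : (x + y).cost = x.cost + y.cost + 1 := rfl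
@[simp] theorem cost_sub (x y : NExp) : (x - y).cost = x.cost + y.cost + 1 := rfl
@[simp] theorem cost_two : (2 : NExp).cost = 1 := rfl
@[simp] theorem cost_ten : (10 : NExp).cost = 1 := rfl
@[simp] theorem cost_zero : (0 : NExp).cost = 1 := rfl
@[simp] theorem cost_one : (1 : NExp).cost = 1 := rfl
@[simp] theorem cost_get (a : ℕ) (i : NExp) : (get a i).cost = i.cost + 1 := rfl
@[simp] theorem cost_half (x : NExp) : (half x).cost = x.cost + 1 := rfl

end NExp

namespace RExp

@[simp] theorem eval_add (s : State) (x y : RExp) : (x + y).eval s = x.eval s + y.eval s := rfl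
@[simp] theorem eval_sub (s : State) (x y : RExp) : (x - y).eval s = x.eval s - y.eval s := rfl
@[simp] theorem eval_mul (s : State) (x y : RExp) : (x * y).eval s = x.eval s * y.eval s := rfl
@[simp] theorem eval_div (s : State) (x y : RExp) : (x / y).eval s = x.eval s / y.eval s := rfl
@[simp] theorem eval_ofNat (s : State) (x : NExp) : (ofNat x).eval s = (x.eval s : ℝ) := rfl
@[simp] theorem eval_get (s : State) (a : ℕ) (i : NExp) :
    (get a i).eval s = s.real a (i.eval s) := rfl
@[simp] theorem cost_add (x y : RExp) : (x + y).cost = x.cost + y.cost + 1 := rfl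
@[simp] theorem cost_sub (x y : RExp) : (x - y).cost = x.cost + y.cost + 1 := rfl
@[simp] theorem cost_mul (x y : RExp) : (x * y).cost = x.cost + y.cost + 1 := rfl
@[simp] theorem cost_div (x y : RExp) : (x / y).cost = x.cost + y.cost + 1 := rfl
@[simp] theorem cost_ofNat (x : NExp) : (ofNat x).cost = x.cost + 1 := rfl
@[simp] theorem cost_get (a : ℕ) (i : NExp) : (get a i).cost = i.cost + 1 := rfl

end RExp

namespace BExp

@[simp] theorem holds_natLt (s : State) (x y : NExp) :
    (natLt x y).Holds s ↔ x.eval s < y.eval s := Iff.rfl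
@[simp] theorem holds_realLt (s : State) (x y : RExp) :
    (realLt x y).Holds s ↔ x.eval s < y.eval s := Iff.rfl
@[simp] theorem cost_natLt (x y : NExp) : (natLt x y).cost = x.cost + y.cost + 1 := rfl
@[simp] theorem cost_realLt (x y : RExp) : (realLt x y).cost = x.cost + y.cost + 1 := rfl

end BExp

namespace State

variable (s : State) (a i x b : ℕ) (r : ℝ)

@[simp] theorem nat_setNat (j : ℕ) :
    (s.setNat a i x).nat b j = if b = a ∧ j = i then x else s.nat b j := by
  simp only [setNat, Function.update_apply]
  split_ifs <;> simp_all

@[simp] theorem real_setReal (j : ℕ) :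
    (s.setReal a i r).real b j = if b = a ∧ j = i then r else s.real b j := by
  simp only [setReal, Function.update_apply]
  split_ifs <;> simp_all

@[simp] theorem real_setNat : (s.setNat a i x).real = s.real := rfl
@[simp] theorem nat_setReal : (s.setReal a i r).nat = s.nat := rfl
@[simp] theorem pos_setNat : (s.setNat a i x).pos = s.pos := rfl
@[simp] theorem pos_setReal : (s.setReal a i r).pos = s.pos := rfl
@[simp] theorem nat_advance : s.advance.nat = s.nat := rfl
@[simp] theorem real_advance : s.advance.real = s.real := rfl
@[simp] theorem pos_advance : s.advance.pos = s.pos + 1 := rfl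

theorem nat_setNat_of_ne {a b : ℕ} (h : b ≠ a) : (s.setNat a i x).nat b = s.nat b := by
  simp [setNat, Function.update_of_ne h]

theorem real_setReal_of_ne {a b : ℕ} (h : b ≠ a) : (s.setReal a i r).real b = s.real b := by
  simp [setReal, Function.update_of_ne h]

end State

/-! ### Syntactic write sets and the frame rule -/

namespace Prog

/-- The program may write to the array `b` of natural numbers. -/
def natW : Prog → ℕ → Prop
  | skip, _ => False
  | setNat a _ _, b => b = a
  | setReal _ _ _, _ => False
  | sample _ _, _ => False
  | seq p q, b => p.natW b ∨ q.natW b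
  | ite _ p q, b => p.natW b ∨ q.natW b
  | .while _ p, b => p.natW b

/-- The program may write to the array `b` of real numbers. -/
def realW : Prog → ℕ → Prop
  | skip, _ => False
  | setNat _ _ _, _ => False
  | setReal a _ _, b => b = a
  | sample a _, b => b = a
  | seq p q, b => p.realW b ∨ q.realW b
  | ite _ p q, b => p.realW b ∨ q.realW b
  | .while _ p, b => p.realW b

/-- The program may draw random numbers. -/
def draws : Prog → Prop
  | skip => False
  | setNat _ _ _ => False
  | setReal _ _ _ => False
  | sample _ _ => True
  | seq p q => p.draws ∨ q.draws
  | ite _ p q => p.draws ∨ q.draws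
  | .while _ p => p.draws

attribute [simp] natW realW draws

/-- `loop a b p` runs `p` with the variable `a` counting from `0` up to the variable `b`. -/
def loop (a b : ℕ) (p : Prog) : Prog :=
  .seq (.setNat a 0 0)
    (.while (.natLt (.var a) (.var b)) (.seq p (.setNat a 0 (.var a + 1))))

/-- `dims d f` runs `f 0`, …, `f (d - 1)`. -/
def dims : ℕ → (ℕ → Prog) → Prog
  | 0, _ => .skip
  | d + 1, f => .seq (dims d f) (f d)

@[simp] theorem natW_loop (a b : ℕ) (p : Prog) (c : ℕ) :
    (loop a b p).natW c ↔ c = a ∨ p.natW c := by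
  simp only [loop, natW]; tauto

@[simp] theorem realW_loop (a b : ℕ) (p : Prog) (c : ℕ) :
    (loop a b p).realW c ↔ p.realW c := by
  simp [loop]

@[simp] theorem draws_loop (a b : ℕ) (p : Prog) : (loop a b p).draws ↔ p.draws := by
  simp [loop]

@[simp] theorem natW_dims (d : ℕ) (f : ℕ → Prog) (c : ℕ) :
    (dims d f).natW c ↔ ∃ k < d, (f k).natW c := by
  induction d with
  | zero => simp [dims]
  | succ d ih =>
    simp only [dims, natW, ih, Nat.lt_succ_iff_lt_or_eq]
    aesop

@[simp] theorem realW_dims (d : ℕ) (f : ℕ → Prog) (c : ℕ) :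
    (dims d f).realW c ↔ ∃ k < d, (f k).realW c := by
  induction d with
  | zero => simp [dims]
  | succ d ih =>
    simp only [dims, realW, ih, Nat.lt_succ_iff_lt_or_eq]
    aesop

@[simp] theorem draws_dims (d : ℕ) (f : ℕ → Prog) :
    (dims d f).draws ↔ ∃ k < d, (f k).draws := by
  induction d with
  | zero => simp [dims]
  | succ d ih =>
    simp only [dims, draws, ih, Nat.lt_succ_iff_lt_or_eq]
    aesop

end Prog

/-- The two states agree on everything that `p` cannot change. -/
structure Same (p : Prog) (s s' : State) : Prop where
  nat : ∀ b, ¬ p.natW b → s'.nat b = s.nat b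
  real : ∀ b, ¬ p.realW b → s'.real b = s.real b
  pos : ¬ p.draws → s'.pos = s.pos

namespace Same

theorem refl (p : Prog) (s : State) : Same p s s := ⟨fun _ _ => rfl, fun _ _ => rfl, fun _ => rfl⟩

theorem trans {p : Prog} {s s' s'' : State} (h : Same p s s') (h' : Same p s' s'') :
    Same p s s'' :=
  ⟨fun b hb => (h'.nat b hb).trans (h.nat b hb), fun b hb => (h'.real b hb).trans (h.real b hb),
    fun hd => (h'.pos hd).trans (h.pos hd)⟩

theorem mono {p q : Prog} {s s' : State} (h : Same p s s') (hn : ∀ b, p.natW b → q.natW b)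
    (hr : ∀ b, p.realW b → q.realW b) (hd : p.draws → q.draws) : Same q s s' :=
  ⟨fun b hb => h.nat b fun hp => hb (hn b hp), fun b hb => h.real b fun hp => hb (hr b hp),
    fun h' => h.pos fun hp => h' (hd hp)⟩

end Same

/-- The frame rule: what a program can change is read off its text. Later claims that some array is
untouched by a piece of code become `simp` goals about the write sets. -/
theorem Exec.same {ω : Source} {p : Prog} {s s' : State} {t : ℕ} (h : Exec ω p s t s') :
    Same p s s' := by
  induction h with
  | skip s => exact Same.refl _ _
  | setNat a i e s =>
    exact ⟨fun b hb => State.nat_setNat_of_ne _ _ _ hb, fun _ _ => rfl, fun _ => rfl⟩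
  | setReal a i e s =>
    exact ⟨fun _ _ => rfl, fun b hb => State.real_setReal_of_ne _ _ _ hb, fun _ => rfl⟩
  | sample a i s =>
    exact ⟨fun _ _ => rfl, fun b hb => State.real_setReal_of_ne _ _ _ hb, fun h => absurd trivial h⟩
  | seq _ _ ihp ihq =>
    exact (ihp.mono (fun _ => Or.inl) (fun _ => Or.inl) Or.inl).trans
      (ihq.mono (fun _ => Or.inr) (fun _ => Or.inr) Or.inr)
  | iteTrue _ _ ih => exact ih.mono (fun _ => Or.inl) (fun _ => Or.inl) Or.inl
  | iteFalse _ _ ih => exact ih.mono (fun _ => Or.inr) (fun _ => Or.inr) Or.inr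
  | whileTrue _ _ _ ihp ihw =>
    exact Same.trans (p := .while _ _) (ihp.mono (fun _ => id) (fun _ => id) id) ihw
  | whileFalse _ => exact Same.refl _ _

/-- Started in `s`, the program halts within `T` steps in a state satisfying `Q`. -/
def Run (ω : Source) (p : Prog) (s : State) (T : ℕ) (Q : State → Prop) : Prop :=
  ∃ t s', Exec ω p s t s' ∧ t ≤ T ∧ Q s'

/-! ### Hoare rules with time bounds -/

namespace Run

variable {ω : Source} {p q : Prog} {s : State} {T T₁ T₂ : ℕ} {Q R : State → Prop}

theorem mono (h : Run ω p s T₁ Q) (hT : T₁ ≤ T₂) : Run ω p s T₂ Q :=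
  let ⟨t, s', he, ht, hq⟩ := h
  ⟨t, s', he, ht.trans hT, hq⟩

theorem post (h : Run ω p s T Q) (hQ : ∀ s', Same p s s' → Q s' → R s') : Run ω p s T R :=
  let ⟨t, s', he, ht, hq⟩ := h
  ⟨t, s', he, ht, hQ s' he.same hq⟩

theorem skip (h : Q s) : Run ω .skip s 1 Q := ⟨1, s, .skip s, le_rfl, h⟩

theorem setNat {a : ℕ} {i e : NExp} (h : Q (s.setNat a (i.eval s) (e.eval s))) :
    Run ω (.setNat a i e) s (i.cost + e.cost + 1) Q := ⟨_, _, .setNat a i e s, le_rfl, h⟩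

theorem setReal {a : ℕ} {i : NExp} {e : RExp} (h : Q (s.setReal a (i.eval s) (e.eval s))) :
    Run ω (.setReal a i e) s (i.cost + e.cost + 1) Q := ⟨_, _, .setReal a i e s, le_rfl, h⟩

theorem sample {a : ℕ} {i : NExp} (h : Q (s.setReal a (i.eval s) (ω s.pos : ℝ)).advance) :
    Run ω (.sample a i) s (i.cost + 1) Q := ⟨_, _, .sample a i s, le_rfl, h⟩

/-- The frame information `Same p s s'` is passed on to the second program, so intermediate
assertions need to mention only what the first program computes. -/
theorem seq (hp : Run ω p s T₁ R) (hq : ∀ s', Same p s s' → R s' → Run ω q s' T₂ Q) :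
    Run ω (.seq p q) s (T₁ + T₂) Q := by
  obtain ⟨t, s', he, ht, hr⟩ := hp
  obtain ⟨t', s'', he', ht', hq'⟩ := hq s' he.same hr
  exact ⟨_, s'', .seq he he', add_le_add ht ht', hq'⟩

theorem seq_setNat {a : ℕ} {i e : NExp}
    (h : Run ω q (s.setNat a (i.eval s) (e.eval s)) T Q) :
    Run ω (.seq (.setNat a i e) q) s (i.cost + e.cost + 1 + T) Q :=
  seq (R := fun s' => s' = s.setNat a (i.eval s) (e.eval s)) (setNat rfl) fun _ _ h' => h' ▸ h

theorem seq_setReal {a : ℕ} {i : NExp} {e : RExp}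
    (h : Run ω q (s.setReal a (i.eval s) (e.eval s)) T Q) :
    Run ω (.seq (.setReal a i e) q) s (i.cost + e.cost + 1 + T) Q :=
  seq (R := fun s' => s' = s.setReal a (i.eval s) (e.eval s)) (setReal rfl) fun _ _ h' => h' ▸ h

theorem seq_sample {a : ℕ} {i : NExp}
    (h : Run ω q (s.setReal a (i.eval s) (ω s.pos : ℝ)).advance T Q) :
    Run ω (.seq (.sample a i) q) s (i.cost + 1 + T) Q :=
  seq (R := fun s' => s' = (s.setReal a (i.eval s) (ω s.pos : ℝ)).advance) (sample rfl)
    fun _ _ h' => h' ▸ h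

theorem ite {b : BExp} (hp : b.Holds s → Run ω p s T Q) (hq : ¬ b.Holds s → Run ω q s T Q) :
    Run ω (.ite b p q) s (b.cost + 1 + T) Q := by
  by_cases hb : b.Holds s
  · obtain ⟨t, s', he, ht, h⟩ := hp hb
    exact ⟨_, s', .iteTrue hb he, by omega, h⟩
  · obtain ⟨t, s', he, ht, h⟩ := hq hb
    exact ⟨_, s', .iteFalse hb he, by omega, h⟩

/-- A loop whose number of remaining iterations is bounded by the index of the invariant. -/
theorem whileDown {b : BExp} {I : ℕ → State → Prop} {N : ℕ} (hI : I N s)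
    (hzero : ∀ s', I 0 s' → ¬ b.Holds s')
    (hstep : ∀ j s', Same p s s' → I (j + 1) s' → b.Holds s' → Run ω p s' T (I j))
    (hQ : ∀ j s', Same p s s' → I j s' → ¬ b.Holds s' → Q s') :
    Run ω (.while b p) s (N * (b.cost + 1 + T) + (b.cost + 1)) Q := by
  suffices H : ∀ N s', Same p s s' → I N s' →
      Run ω (.while b p) s' (N * (b.cost + 1 + T) + (b.cost + 1)) Q from H N s (Same.refl _ _) hI
  intro N
  induction N with
  | zero =>
    intro s' hs hi
    exact ⟨_, s', .whileFalse (hzero s' hi), by omega, hQ 0 s' hs hi (hzero s' hi)⟩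
  | succ N ih =>
    intro s' hs hi
    by_cases hb : b.Holds s'
    · obtain ⟨t, s₁, he, ht, h⟩ := hstep N s' hs hi hb
      obtain ⟨t', s₂, he', ht', h'⟩ := ih s₁ (hs.trans he.same) h
      refine ⟨_, s₂, .whileTrue hb he he', ?_, h'⟩
      rw [Nat.succ_mul]
      omega
    · exact ⟨_, s', .whileFalse hb, by omega, hQ _ s' hs hi hb⟩

/-- A loop with exactly `N` iterations. -/
theorem whileUp {b : BExp} {I : ℕ → State → Prop} {N : ℕ} {T : ℕ → ℕ} (hI : I 0 s)
    (hb : ∀ j s', Same p s s' → j ≤ N → I j s' → (b.Holds s' ↔ j < N))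
    (hstep : ∀ j s', Same p s s' → j < N → I j s' → Run ω p s' (T j) (I (j + 1))) :
    Run ω (.while b p) s (∑ j ∈ Finset.range N, (b.cost + 1 + T j) + (b.cost + 1)) (I N) := by
  suffices H : ∀ r m s', m + r = N → Same p s s' → I m s' →
      Run ω (.while b p) s'
        (∑ j ∈ Finset.range r, (b.cost + 1 + T (m + j)) + (b.cost + 1)) (I N) by
    have := H N 0 s (by simp) (Same.refl _ _) hI
    simpa using this
  intro r
  induction r with
  | zero =>
    intro m s' hm hs hi
    obtain rfl : m = N := by omega
    exact ⟨_, s', .whileFalse (by simp [hb m s' hs le_rfl hi]), by simp, hi⟩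
  | succ r ih =>
    intro m s' hm hs hi
    obtain ⟨t, s₁, he, ht, h⟩ := hstep m s' hs (by omega) hi
    obtain ⟨t', s₂, he', ht', h'⟩ := ih (m + 1) s₁ (by omega) (hs.trans he.same) h
    refine ⟨_, s₂, .whileTrue ((hb m s' hs (by omega) hi).2 (by omega)) he he', ?_, h'⟩
    rw [Finset.sum_range_succ']
    have : ∀ j, m + 1 + j = m + (j + 1) := fun j => by omega
    simp only [this] at ht'
    simp only [Nat.add_zero]
    omega

/-- The invariant is indexed by the number of completed passes and must survive writes to the
counter `a`, which happen outside the body. The overhead per pass is 12: a guard of cost 5, one step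
for branching, and 6 for the increment. The 9 is the initialization plus the final failing guard. -/
theorem loop {a b : ℕ} {I : ℕ → State → Prop} {N : ℕ} {T : ℕ → ℕ} (hab : b ≠ a)
    (hN : s.nat b 0 = N) (ha : ¬ p.natW a) (hb : ¬ p.natW b)
    (hI : I 0 s)
    (hins : ∀ j s' x, I j s' → I j (s'.setNat a 0 x))
    (hstep : ∀ j s', Same (Prog.loop a b p) s s' → j < N → s'.nat a 0 = j → I j s' →
      Run ω p s' (T j) (I (j + 1))) :
    Run ω (Prog.loop a b p) s (∑ j ∈ Finset.range N, (T j + 12) + 9) (I N) := by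
  have h0 : Same (.setNat a 0 0) s (s.setNat a 0 0) :=
    ⟨fun c hc => State.nat_setNat_of_ne _ _ _ hc, fun _ _ => rfl, fun _ => rfl⟩
  refine (seq_setNat (T := ∑ j ∈ Finset.range N, (5 + 1 + (T j + 6)) + (5 + 1))
    (?_ : Run _ _ _ _ _)).mono ?_
  · refine (whileUp (I := fun j s' => s'.nat a 0 = j ∧ I j s') (N := N) (T := fun j => T j + 6)
      ⟨by simp, hins _ _ _ hI⟩ ?_ ?_).post fun s' _ h => h.2
    · rintro j s' hs hj ⟨h1, h2⟩
      have := congrFun (hs.nat b (by simp [hab, hb])) 0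
      simp only [BExp.holds_natLt, NExp.eval_get, NExp.eval_zero, this, h1]
      simp [hab, hN]
    · rintro j s' hs hj ⟨h1, h2⟩
      have hs' : Same (Prog.loop a b p) s s' :=
        (h0.mono (by simp) (by simp) (by simp)).trans (hs.mono (by simp; tauto) (by simp) (by simp))
      refine (hstep j s' hs' hj h1 h2).seq fun s₁ hs₁ h3 => ?_
      have h4 : s₁.nat a 0 = j := by rw [hs₁.nat a ha, h1]
      refine setNat ?_
      simp only [NExp.eval_get, NExp.eval_zero, NExp.eval_add, h4, NExp.eval_one]
      exact ⟨by simp, hins _ _ _ h3⟩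
  · have : ∀ j, 5 + 1 + (T j + 6) = T j + 12 := fun j => by omega
    simp only [this, NExp.cost_zero]
    omega

theorem dims {d : ℕ} {f : ℕ → Prog} {I : ℕ → State → Prop} {T : ℕ} (hI : I 0 s)
    (hstep : ∀ k s', Same (Prog.dims d f) s s' → k < d → I k s' → Run ω (f k) s' T (I (k + 1))) :
    Run ω (Prog.dims d f) s (d * T + 1) (I d) := by
  suffices H : ∀ r, r ≤ d → Run ω (Prog.dims r f) s (r * T + 1) (I r) from H d le_rfl
  intro r
  induction r with
  | zero => intro _; simpa [Prog.dims] using skip hI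
  | succ r ih =>
    intro hr
    refine ((ih (by omega)).seq (T₂ := T) fun s' hs h => ?_).mono (by rw [Nat.succ_mul]; omega)
    exact hstep r s' (hs.mono (by simp; grind) (by simp; grind) (by simp; grind)) (by omega) h

end Run

/-! ### Nested loops over a product of lists -/

/-- The tuples that agree with `τ` from index `k` on and whose entries at the indices below `k` are
taken from the lists `ℓ`. -/
def prodList (ℓ : ℕ → List ℕ) : ℕ → (ℕ → ℕ) → List (ℕ → ℕ)
  | 0, τ => [τ]
  | k + 1, τ => (ℓ k).flatMap fun c => prodList ℓ k (Function.update τ k c)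

theorem mem_prodList {ℓ : ℕ → List ℕ} {k : ℕ} {τ σ : ℕ → ℕ} :
    σ ∈ prodList ℓ k τ ↔ (∀ j < k, σ j ∈ ℓ j) ∧ ∀ j, k ≤ j → σ j = τ j := by
  induction k generalizing τ with
  | zero => simp [prodList, funext_iff]
  | succ k ih =>
    simp only [prodList, List.mem_flatMap, ih]
    constructor
    · rintro ⟨c, hc, h1, h2⟩
      refine ⟨fun j hj => ?_, fun j hj => ?_⟩
      · rcases Nat.lt_succ_iff_lt_or_eq.1 hj with h | rfl
        · exact h1 j h
        · simpa [h2 j le_rfl] using hc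
      · rw [h2 j (by omega), Function.update_of_ne (by omega)]
    · rintro ⟨h1, h2⟩
      refine ⟨σ k, h1 k (by omega), fun j hj => h1 j (by omega), fun j hj => ?_⟩
      rcases eq_or_lt_of_le hj with rfl | h
      · simp
      · rw [Function.update_of_ne (by omega), h2 j (by omega)]

theorem nodup_prodList {ℓ : ℕ → List ℕ} (hℓ : ∀ k, (ℓ k).Nodup) (k : ℕ) (τ : ℕ → ℕ) :
    (prodList ℓ k τ).Nodup := by
  induction k generalizing τ with
  | zero => simp [prodList]
  | succ k ih =>
    refine List.nodup_flatMap.2 ⟨fun c _ => ih _, (hℓ k).imp fun {a b} hab σ h1 h2 => hab ?_⟩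
    have h1' := (mem_prodList.1 h1).2 k le_rfl
    have h2' := (mem_prodList.1 h2).2 k le_rfl
    simpa using h1'.symm.trans h2'

theorem length_prodList_le {ℓ : ℕ → List ℕ} {C : ℕ} (k : ℕ) (hC : ∀ j < k, (ℓ j).length ≤ C)
    (τ : ℕ → ℕ) : (prodList ℓ k τ).length ≤ C ^ k := by
  induction k generalizing τ with
  | zero => simp [prodList]
  | succ k ih =>
    have h : ((ℓ k).map fun c => (prodList ℓ k (Function.update τ k c)).length).sum
        ≤ (ℓ k).length * C ^ k := by
      rw [← List.length_map (f := fun c => (prodList ℓ k (Function.update τ k c)).length),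
        ← smul_eq_mul]
      refine List.sum_le_card_nsmul _ _ fun x hx => ?_
      obtain ⟨c, _, rfl⟩ := List.mem_map.1 hx
      exact ih (fun j hj => hC j (by omega)) _
    simp only [prodList, List.length_flatMap]
    calc _ ≤ _ := h
      _ ≤ C * C ^ k := Nat.mul_le_mul_right _ (hC k (by omega))
      _ = C ^ (k + 1) := by ring

/-- Nested loops: run `p` for all ways of choosing, for every `k < d`, an entry of the list stored in
the array `cand k` (its length being the variable `len k`), the chosen entry being the variable
`node k`; the variable `ctr k` is the loop counter. -/
def Prog.nest (ctr len cand node : ℕ → ℕ) : ℕ → Prog → Prog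
  | 0, p => p
  | k + 1, p => .loop (ctr k) (len k)
      (.seq (.setNat (node k) 0 (.get (cand k) (.var (ctr k)))) (nest ctr len cand node k p))

/-- The list `l` is stored in the array `a`, and its length is the variable `b`. -/
def Stores (s : State) (b a : ℕ) (l : List ℕ) : Prop :=
  s.nat b 0 = l.length ∧ ∀ (j : ℕ) (h : j < l.length), s.nat a j = l[j]

section Nest

variable {ctr len cand node : ℕ → ℕ}

@[simp] theorem Prog.natW_nest (d : ℕ) (p : Prog) (c : ℕ) :
    (Prog.nest ctr len cand node d p).natW c ↔
      (∃ k < d, c = ctr k ∨ c = node k) ∨ p.natW c := by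
  induction d with
  | zero => simp [Prog.nest]
  | succ d ih =>
    simp only [Prog.nest, natW_loop, Prog.natW, ih, Nat.lt_succ_iff_lt_or_eq]
    aesop

@[simp] theorem Prog.realW_nest (d : ℕ) (p : Prog) (c : ℕ) :
    (Prog.nest ctr len cand node d p).realW c ↔ p.realW c := by
  induction d with
  | zero => simp [Prog.nest]
  | succ d ih => simp [Prog.nest, ih]

@[simp] theorem Prog.draws_nest (d : ℕ) (p : Prog) :
    (Prog.nest ctr len cand node d p).draws ↔ p.draws := by
  induction d with
  | zero => simp [Prog.nest]
  | succ d ih => simp [Prog.nest, ih]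

/-- The invariant is indexed by the list of tuples visited so far, in order and with repetitions, so
it can describe accumulating data structures as well as sums. The induction is on the number of
inner loops still to be entered, with the outer choices recorded in `τ`. -/
theorem Run.nest {ω : Source} {p : Prog} {s : State} {d Tb C : ℕ}
    {I : List (ℕ → ℕ) → State → Prop} {ℓ : ℕ → List ℕ}
    (hctr : Function.Injective ctr) (hnode : Function.Injective node)
    (hcn : ∀ j k, ctr j ≠ node k)
    (hlen : ∀ j k, len j ≠ ctr k ∧ len j ≠ node k) (hcand : ∀ j k, cand j ≠ ctr k ∧ cand j ≠ node k)
    (hp : ∀ k < d, ¬ p.natW (ctr k) ∧ ¬ p.natW (node k) ∧ ¬ p.natW (len k) ∧ ¬ p.natW (cand k))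
    (hst : ∀ k < d, Stores s (len k) (cand k) (ℓ k)) (hC : ∀ k < d, (ℓ k).length ≤ C)
    (hI : I [] s)
    (hins : ∀ l s' k x, I l s' → I l (s'.setNat (ctr k) 0 x) ∧ I l (s'.setNat (node k) 0 x))
    (hstep : ∀ l τ s', Same (Prog.nest ctr len cand node d p) s s' →
      (∀ k < d, s'.nat (node k) 0 = τ k) → (∀ k < d, τ k ∈ ℓ k) → (∀ k, d ≤ k → τ k = 0) →
      I l s' → Run ω p s' Tb (I (l ++ [τ]))) :
    Run ω (Prog.nest ctr len cand node d p) s ((C + 1) ^ d * (Tb + 30 * d))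
      (I (prodList ℓ d 0)) := by
  suffices H : ∀ r, r ≤ d → ∀ l τ s', Same (Prog.nest ctr len cand node d p) s s' →
      (∀ k, r ≤ k → k < d → s'.nat (node k) 0 = τ k) → (∀ k, r ≤ k → k < d → τ k ∈ ℓ k) →
      (∀ k, d ≤ k → τ k = 0) → I l s' →
      Run ω (Prog.nest ctr len cand node r p) s' ((C + 1) ^ r * (Tb + 30 * r))
        (I (l ++ prodList ℓ r τ)) by
    refine (H d le_rfl [] 0 s (Same.refl _ _) (by omega) (by omega) (by simp) hI)
  intro r
  induction r with
  | zero =>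
    intro _ l τ s' hs h1 h2 h3 hi
    simpa [Prog.nest, prodList] using hstep l τ s' hs (fun k => h1 k (by omega))
      (fun k => h2 k (by omega)) h3 hi
  | succ r ih =>
    intro hr l τ s' hs h1 h2 h3 hi
    have hpr := hp r (by omega)
    have hst' : Stores s' (len r) (cand r) (ℓ r) := by
      have h4 := hs.nat (len r) (by simp [hpr, hlen])
      have h5 := hs.nat (cand r) (by simp [hpr, hcand])
      simpa only [Stores, h4, h5] using hst r (by omega)
    refine ((Run.loop (N := (ℓ r).length) (T := fun _ => 5 + (C + 1) ^ r * (Tb + 30 * r))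
      (I := fun j => I (l ++ ((ℓ r).take j).flatMap fun c => prodList ℓ r (Function.update τ r c)))
      (hlen r r).1 hst'.1 ?_ ?_ ?_ ?_ ?_).mono ?_).post ?_
    · simp [hcn, hpr, hctr.eq_iff]
    · simp [hlen, hpr]
    · simpa using hi
    · exact fun j s₁ x h => (hins _ _ _ _ h).1
    · intro j s₁ hs₁ hj hc hi₁
      have hs₁' : Same (Prog.nest ctr len cand node d p) s s₁ :=
        hs.trans (hs₁.mono (by simp; grind) (by simp) (by simp))
      have h5 : s₁.nat (cand r) j = (ℓ r)[j] := by
        rw [hs₁.nat (cand r) (by simp [hpr, hcand]), hst'.2 j hj]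
      refine (Run.seq_setNat (T := (C + 1) ^ r * (Tb + 30 * r)) ?_).mono (by simp)
      simp only [NExp.eval_get, NExp.eval_zero, hc, h5]
      have hset : Same (Prog.nest ctr len cand node (r + 1) p) s₁ (s₁.setNat (node r) 0 (ℓ r)[j]) :=
        ⟨fun b hb => State.nat_setNat_of_ne _ _ _ (by rintro rfl; simp at hb; grind),
          fun _ _ => rfl, fun _ => rfl⟩
      have := ih (by omega) _ (Function.update τ r (ℓ r)[j]) _
        (hs₁'.trans (hset.mono (by simp; grind) (by simp) (by simp))) (fun k hk hkd => ?_)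
        (fun k hk hkd => ?_) (fun k hk => ?_) (hins _ _ r (ℓ r)[j] hi₁).2
      · simpa only [List.take_succ_eq_append_getElem hj, List.flatMap_append, List.flatMap_cons, List.flatMap_nil, List.append_nil, List.append_assoc] using this
      · rcases eq_or_lt_of_le hk with rfl | hk
        · simp
        · have h6 : node k ≠ node r := fun h => by have := hnode h; omega
          rw [State.nat_setNat_of_ne _ _ _ h6, Function.update_of_ne (by omega)]
          have h7 := hs₁.nat (node k) (by
            have := hp k hkd
            simp [hnode.eq_iff, this, (hcn _ _).symm]; omega)
          rw [h7, h1 k hk hkd]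
      · rcases eq_or_lt_of_le hk with rfl | hk
        · simp
        · rw [Function.update_of_ne (by omega)]; exact h2 k hk hkd
      · rw [Function.update_of_ne (by omega)]; exact h3 k hk
    · have h6 := hC r (by omega)
      have h7 : 1 ≤ (C + 1) ^ r := Nat.one_le_pow _ _ (by omega)
      simp only [Finset.sum_const, Finset.card_range, smul_eq_mul]
      calc _ ≤ C * (5 + (C + 1) ^ r * (Tb + 30 * r) + 12) + 9 := by gcongr
        -- The overhead `17 C + 9` of this level is absorbed by `30 (C + 1) ^ (r + 1)`, which raises
        -- `30 r` to `30 (r + 1)`.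
        _ ≤ (C + 1) * ((C + 1) ^ r * (Tb + 30 * r) + 30 * (C + 1) ^ r) := by nlinarith
        _ = _ := by ring
    · simp [prodList]

end Nest
end RealRAM

/-! ### Tournament trees -/

namespace Klee

/-- The winner of `a` and `b` in a tournament for the least key; `0` stands for no competitor. -/
noncomputable def pick (x : ℕ → ℝ) (a b : ℕ) : ℕ :=
  if a = 0 then b else if b = 0 then a else if x b < x a then b else a

/-- In the tree with the leaves `M, …, 2 M - 1` every inner node holds the winner of its children. -/
def IsTournament (M : ℕ) (x : ℕ → ℝ) (w : ℕ → ℕ) : Prop :=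
  ∀ i, 1 ≤ i → i < M → w i = pick x (w (i + i)) (w (i + i + 1))

theorem pick_eq_or (x : ℕ → ℝ) (a b : ℕ) : pick x a b = a ∨ pick x a b = b := by
  unfold pick; split_ifs <;> simp

theorem pick_spec (x : ℕ → ℝ) {a b c : ℕ} (hc : c ≠ 0) (h : c = a ∨ c = b) :
    pick x a b ≠ 0 ∧ x (pick x a b) ≤ x c := by
  unfold pick
  rcases h with rfl | rfl <;> split_ifs <;> simp_all [le_of_lt]

/-- The winner at an inner node is the winner at one of its children, so it can be followed down to
a leaf. -/
theorem IsTournament.exists_leaf {M : ℕ} {x : ℕ → ℝ} {w : ℕ → ℕ} (hw : IsTournament M x w)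
    (hM : 1 ≤ M) : ∃ j, M ≤ j ∧ j < 2 * M ∧ w j = w 1 := by
  suffices H : ∀ r i, 1 ≤ i → i < 2 * M → 2 * M - i ≤ r → ∃ j, M ≤ j ∧ j < 2 * M ∧ w j = w i from
    H _ 1 le_rfl (by omega) le_rfl
  intro r
  induction r with
  | zero => intro i _ h1 h2; omega
  | succ r ih =>
    intro i h1 h2 h3
    by_cases hi : i < M
    · rw [hw i h1 hi]
      rcases pick_eq_or x (w (i + i)) (w (i + i + 1)) with h | h <;> rw [h] <;>
        exact ih _ (by omega) (by omega) (by omega)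
    · exact ⟨i, by omega, h2, rfl⟩

/-- Climb from the leaf `j` through its ancestors `j / 2 ^ h`: at each of them there is a winner,
and its key can only decrease. -/
theorem IsTournament.root_le {L : ℕ} {x : ℕ → ℝ} {w : ℕ → ℕ} (hw : IsTournament (2 ^ L) x w)
    {j : ℕ} (h1 : 2 ^ L ≤ j) (h2 : j < 2 ^ (L + 1)) (hj : w j ≠ 0) :
    w 1 ≠ 0 ∧ x (w 1) ≤ x (w j) := by
  have H : ∀ h ≤ L, w (j / 2 ^ h) ≠ 0 ∧ x (w (j / 2 ^ h)) ≤ x (w j) := by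
    intro h
    induction h with
    | zero => simpa using hj
    | succ h ih =>
      intro hh
      obtain ⟨h3, h4⟩ := ih (by omega)
      set i := j / 2 ^ h with hi
      have hi2 : j / 2 ^ (h + 1) = i / 2 := by rw [pow_succ, Nat.div_div_eq_div_mul]
      have hpos : 2 ≤ i := by
        rw [hi, Nat.le_div_iff_mul_le (by positivity)]
        refine le_trans ?_ h1
        rw [mul_comm, ← pow_succ]
        exact Nat.pow_le_pow_right (by norm_num) hh
      have hlt : i / 2 < 2 ^ L := by
        have : i ≤ j := Nat.div_le_self _ _
        rw [pow_succ] at h2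
        omega
      rw [hi2, hw (i / 2) (by omega) hlt]
      have hc : i = i / 2 + i / 2 ∨ i = i / 2 + i / 2 + 1 := by omega
      have := pick_spec x (a := w (i / 2 + i / 2)) (b := w (i / 2 + i / 2 + 1)) h3
        (by rcases hc with h | h
            · left; rw [← h]
            · right; rw [← h])
      exact ⟨this.1, this.2.trans h4⟩
  have := H L le_rfl
  have h1' : j / 2 ^ L = 1 := by
    refine Nat.div_eq_of_lt_le (by simpa using h1) (by rw [pow_succ] at h2; omega)
  rwa [h1'] at this

/-! ### Covering a range of leaves by nodes -/

/-- Nodes of a complete binary tree, whose leaf descendants are the leaves `a, …, b - 1`. -/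
def cover (a b : ℕ) : List ℕ :=
  if a < b then a :: (b - 1) :: cover ((a + 1) / 2) (b / 2) else []
termination_by b
decreasing_by omega

/-- Each round contributes two nodes and halves `b`. Both border nodes are taken without a test
whether their parents are contained in the range too, so nodes of a cover may overlap or be
repeated. This does no harm: only the union matters, repeated tuples are discarded, and the bound
for the number of nodes over a point counts all nodes of the tree. -/
theorem length_cover_le {b h : ℕ} (hb : b < 2 ^ h) (a : ℕ) : (cover a b).length ≤ 2 * h := by
  induction h generalizing a b with
  | zero => rw [cover, if_neg (by simp at hb; omega)]; simp
  | succ h ih =>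
    rw [cover]
    split_ifs with hab
    · have := ih (b := b / 2) (by rw [pow_succ] at hb; omega) ((a + 1) / 2)
      simp only [List.length_cons]
      omega
    · simp

/-- Soundness of the cover: a listed node taken in round `h` has the leaf descendants `i * 2 ^ h, …,
(i + 1) * 2 ^ h - 1`, and rounding `a` up and `b` down keeps these inside the range. -/
theorem exists_height_of_mem_cover {a b i : ℕ} (hi : i ∈ cover a b) :
    ∃ h, a ≤ i * 2 ^ h ∧ (i + 1) * 2 ^ h ≤ b := by
  induction b using Nat.strong_induction_on generalizing a with
  | _ b ih =>
    rw [cover] at hi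
    split_ifs at hi with hab
    · simp only [List.mem_cons] at hi
      rcases hi with rfl | rfl | hi
      · exact ⟨0, by simp, by simpa using hab⟩
      · exact ⟨0, by simp; omega, by simp; omega⟩
      · obtain ⟨h, h1, h2⟩ := ih (b / 2) (by omega) hi
        refine ⟨h + 1, ?_, ?_⟩
        · rw [pow_succ, ← mul_assoc]; omega
        · rw [pow_succ, ← mul_assoc]; omega
    · simp at hi

/-- Completeness of the cover: a leaf that is not at the border of the range has its parent in the
range of the next round. -/
theorem exists_mem_cover {a b j : ℕ} (h1 : a ≤ j) (h2 : j < b) : ∃ h, j / 2 ^ h ∈ cover a b := by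
  induction b using Nat.strong_induction_on generalizing a j with
  | _ b ih =>
    rw [cover, if_pos (by omega)]
    by_cases ha : j = a
    · exact ⟨0, by simp [ha]⟩
    by_cases hb : j = b - 1
    · exact ⟨0, by simp [hb]⟩
    · obtain ⟨h, hh⟩ := ih (b / 2) (by omega) (a := (a + 1) / 2) (j := j / 2) (by omega) (by omega)
      refine ⟨h + 1, ?_⟩
      rw [pow_succ', ← Nat.div_div_eq_div_mul]
      simp [hh]

/-! ### Dyadic trees and search paths -/

/-- The intervals `[left i, right i)` attached to the nodes `i` of the complete binary tree with
`2 ^ L` leaves, the leaf intervals being `[v t, v (t + 1))`. -/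
structure DyadicTree (L : ℕ) (v left right : ℕ → ℝ) : Prop where
  mono : ∀ t < 2 ^ L, v t ≤ v (t + 1)
  left_eq : ∀ h i, 2 ^ L ≤ i * 2 ^ h → (i + 1) * 2 ^ h ≤ 2 ^ (L + 1) →
    left i = v (i * 2 ^ h - 2 ^ L)
  right_eq : ∀ h i, 2 ^ L ≤ i * 2 ^ h → (i + 1) * 2 ^ h ≤ 2 ^ (L + 1) →
    right i = v ((i + 1) * 2 ^ h - 2 ^ L)

/-- The node at depth `j` on the search path for `y`. -/
noncomputable def pathNode (right : ℕ → ℝ) (y : ℝ) : ℕ → ℕ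
  | 0 => 1
  | j + 1 => if y < right (pathNode right y j + pathNode right y j)
      then pathNode right y j + pathNode right y j
      else pathNode right y j + pathNode right y j + 1

/-- The search path for `y`. -/
noncomputable def path (L : ℕ) (right : ℕ → ℝ) (y : ℝ) : List ℕ :=
  (List.range (L + 1)).map (pathNode right y)

theorem pathNode_bounds (right : ℕ → ℝ) (y : ℝ) (j : ℕ) :
    2 ^ j ≤ pathNode right y j ∧ pathNode right y j < 2 ^ (j + 1) := by
  induction j with
  | zero => simp [pathNode]
  | succ j ih =>
    rw [pathNode, pow_succ, pow_succ _ (j + 1)]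
    split_ifs <;> omega

/-- The node at depth `j` lies between `2 ^ j` and `2 ^ (j + 1)`, so the path is increasing. No
repetitions means that lookups along the paths count every item once. -/
theorem nodup_path (L : ℕ) (right : ℕ → ℝ) (y : ℝ) : (path L right y).Nodup := by
  refine List.nodup_range.map (strictMono_nat_of_lt_succ fun j => ?_).injective
  have := pathNode_bounds right y j
  have := pathNode_bounds right y (j + 1)
  omega

@[simp] theorem length_path (L : ℕ) (right : ℕ → ℝ) (y : ℝ) : (path L right y).length = L + 1 := by
  simp [path]

theorem measurableSet_pathNode (right : ℕ → ℝ) (j i : ℕ) :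
    MeasurableSet {y | pathNode right y j = i} := by
  induction j generalizing i with
  | zero => simp [pathNode]
  | succ j ih =>
    have : {y | pathNode right y (j + 1) = i} = ⋃ p : ℕ, {y | pathNode right y j = p} ∩
        ({y | y < right (p + p)} ∩ {_y | p + p = i} ∪
          {y | y < right (p + p)}ᶜ ∩ {_y | p + p + 1 = i}) := by
      ext y
      simp only [pathNode, Set.mem_ofPred_eq, Set.mem_iUnion, Set.mem_inter_iff, Set.mem_union,
        Set.mem_compl_iff, exists_eq_left']
      split_ifs with h <;> simp [h]
    rw [this]
    refine .iUnion fun p => (ih p).inter (.union (.inter measurableSet_Iio ?_)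
      (.inter measurableSet_Iio.compl ?_)) <;> simp

theorem measurableSet_mem_path (L : ℕ) (right : ℕ → ℝ) (i : ℕ) :
    MeasurableSet {y | i ∈ path L right y} := by
  have : {y | i ∈ path L right y} = ⋃ j ∈ Finset.range (L + 1), {y | pathNode right y j = i} := by
    ext y; simp [path]
  rw [this]
  exact Finset.measurableSet_biUnion _ fun j _ => measurableSet_pathNode right j i

namespace DyadicTree

variable {L : ℕ} {v left right : ℕ → ℝ}

theorem mono_le (T : DyadicTree L v left right) {s t : ℕ} (hst : s ≤ t) (ht : t ≤ 2 ^ L) :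
    v s ≤ v t := by
  induction t, hst using Nat.le_induction with
  | base => exact le_rfl
  | succ t _ ih => exact (ih (by omega)).trans (T.mono t (by omega))

theorem exists_leaf (T : DyadicTree L v left right) {r₁ r₂ : ℕ} (h1 : r₁ ≤ 2 ^ L)
    (h2 : r₂ ≤ 2 ^ L) {y : ℝ} (hy₁ : v r₁ ≤ y) (hy₂ : y < v r₂) :
    ∃ t, r₁ ≤ t ∧ t < r₂ ∧ v t ≤ y ∧ y < v (t + 1) := by
  induction r₂ with
  | zero => exact absurd (hy₁.trans_lt hy₂) (not_lt.2 (T.mono_le (Nat.zero_le _) h1))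
  | succ r ih =>
    by_cases h : y < v r
    · obtain ⟨t, h3, h4, h5⟩ := ih (by omega) h
      exact ⟨t, h3, by omega, h5⟩
    -- Here `r` is the last breakpoint that is at most `y`. Coinciding breakpoints make some leaf
    -- intervals empty, and this choice avoids those.
    · refine ⟨r, ?_, by omega, not_lt.1 h, hy₂⟩
      by_contra hr
      exact absurd (hy₁.trans_lt hy₂) (not_lt.2 (T.mono_le (by omega) h1))

/-- The height of a node. -/
theorem exists_height {L i : ℕ} (h1 : 1 ≤ i) (h2 : i < 2 ^ (L + 1)) :
    ∃ j ≤ L, 2 ^ j ≤ i ∧ i < 2 ^ (j + 1) := by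
  refine ⟨Nat.log 2 i, ?_, Nat.pow_log_le_self 2 (by omega), Nat.lt_pow_succ_log_self (by norm_num) i⟩
  have := Nat.log_lt_of_lt_pow (by omega) h2
  omega

theorem level_bounds {L j i : ℕ} (hj : j ≤ L) (h1 : 2 ^ j ≤ i) (h2 : i < 2 ^ (j + 1)) :
    2 ^ L ≤ i * 2 ^ (L - j) ∧ (i + 1) * 2 ^ (L - j) ≤ 2 ^ (L + 1) := by
  have h3 : 2 ^ L = 2 ^ j * 2 ^ (L - j) := by rw [← pow_add]; congr 1; omega
  have h4 : 2 ^ (L + 1) = 2 ^ (j + 1) * 2 ^ (L - j) := by rw [← pow_add]; congr 1; omega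
  rw [h3, h4]
  exact ⟨Nat.mul_le_mul_right _ h1, Nat.mul_le_mul_right _ h2⟩

theorem left_le_right (T : DyadicTree L v left right) {i : ℕ} (h1 : 1 ≤ i) (h2 : i < 2 ^ (L + 1)) :
    left i ≤ right i := by
  obtain ⟨j, hj, h3, h4⟩ := exists_height h1 h2
  obtain ⟨h5, h6⟩ := level_bounds hj h3 h4
  rw [T.left_eq _ _ h5 h6, T.right_eq _ _ h5 h6]
  refine T.mono_le (Nat.sub_le_sub_right (Nat.mul_le_mul_right _ (by omega)) _) ?_
  rw [pow_succ] at h6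
  omega

theorem bounds_of_mem_cover {r₁ r₂ i : ℕ} (h2 : r₂ ≤ 2 ^ L)
    (hi : i ∈ cover (2 ^ L + r₁) (2 ^ L + r₂)) : 1 ≤ i ∧ i < 2 ^ (L + 1) := by
  obtain ⟨h, h3, h4⟩ := exists_height_of_mem_cover hi
  have h5 : 1 ≤ 2 ^ h := Nat.one_le_two_pow
  have h6 : 1 ≤ 2 ^ L := Nat.one_le_two_pow
  constructor
  · by_contra h0
    obtain rfl : i = 0 := by omega
    omega
  · rw [pow_succ]
    nlinarith

/-- The nodes of a cover partition the half-open interval between the endpoints. -/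
theorem exists_mem_cover_iff (T : DyadicTree L v left right) {r₁ r₂ : ℕ} (h1 : r₁ ≤ 2 ^ L)
    (h2 : r₂ ≤ 2 ^ L) (y : ℝ) :
    (∃ i ∈ cover (2 ^ L + r₁) (2 ^ L + r₂), left i ≤ y ∧ y < right i) ↔ v r₁ ≤ y ∧ y < v r₂ := by
  constructor
  · rintro ⟨i, hi, h3, h4⟩
    obtain ⟨h, h5, h6⟩ := exists_height_of_mem_cover hi
    have h7 : 2 ^ L ≤ i * 2 ^ h := by omega
    have h8 : (i + 1) * 2 ^ h ≤ 2 ^ (L + 1) := by rw [pow_succ]; omega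
    have h9 : i * 2 ^ h ≤ (i + 1) * 2 ^ h := Nat.mul_le_mul_right _ (by omega)
    rw [T.left_eq h i h7 h8] at h3
    rw [T.right_eq h i h7 h8] at h4
    exact ⟨(T.mono_le (by omega) (by omega)).trans h3, h4.trans_le (T.mono_le (by omega) h2)⟩
  · rintro ⟨h3, h4⟩
    obtain ⟨t, ht1, ht2, ht3, ht4⟩ := T.exists_leaf h1 h2 h3 h4
    obtain ⟨h, hh⟩ := exists_mem_cover (a := 2 ^ L + r₁) (b := 2 ^ L + r₂) (j := 2 ^ L + t)
      (by omega) (by omega)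
    refine ⟨_, hh, ?_⟩
    set i := (2 ^ L + t) / 2 ^ h with hi
    obtain ⟨hi1, hi2⟩ := bounds_of_mem_cover h2 hh
    have h5 : i * 2 ^ h ≤ 2 ^ L + t := Nat.div_mul_le_self _ _
    have h6 : 2 ^ L + t < (i + 1) * 2 ^ h := Nat.lt_mul_of_div_lt (by omega) (by positivity)
    -- `exists_mem_cover` does not bound the height. A height above `L` would give the node at least
    -- `2 ^ (L + 1)` for its first leaf, since `1 ≤ i`.
    have hhL : h ≤ L := by
      by_contra hcon
      have h10 : 2 ^ (L + 1) ≤ 2 ^ h := Nat.pow_le_pow_right (by norm_num) (by omega)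
      rw [pow_succ] at h10
      nlinarith
    have h7 : 2 ^ L = 2 ^ (L - h) * 2 ^ h := by rw [← pow_add]; congr 1; omega
    have h8 : 2 ^ (L + 1) = 2 ^ (L + 1 - h) * 2 ^ h := by rw [← pow_add]; congr 1; omega
    have hp : 0 < 2 ^ h := by positivity
    have h9 : 2 ^ L ≤ i * 2 ^ h := by
      rw [h7] at h6 ⊢
      refine Nat.mul_le_mul_right _ ?_
      have : 2 ^ (L - h) * 2 ^ h < (i + 1) * 2 ^ h := by omega
      have := Nat.lt_of_mul_lt_mul_right this
      omega
    have h10 : (i + 1) * 2 ^ h ≤ 2 ^ (L + 1) := by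
      have h11 : i * 2 ^ h < 2 ^ (L + 1) := by rw [pow_succ]; omega
      rw [h8] at h11 ⊢
      exact Nat.mul_le_mul_right _ (Nat.lt_of_mul_lt_mul_right h11)
    rw [T.left_eq h i h9 h10, T.right_eq h i h9 h10]
    refine ⟨(T.mono_le (by omega) (by omega)).trans ht3, ht4.trans_le (T.mono_le (by omega) ?_)⟩
    rw [pow_succ] at h10
    omega

/-- The invariant of binary search: the right end of the left child is the left end of the right
child, so one comparison decides which half contains `y`. -/
theorem pathNode_mem (T : DyadicTree L v left right) {y : ℝ} (h1 : v 0 ≤ y) (h2 : y < v (2 ^ L))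
    {j : ℕ} (hj : j ≤ L) : left (pathNode right y j) ≤ y ∧ y < right (pathNode right y j) := by
  induction j with
  | zero =>
    have h3 := T.left_eq L 1 (by simp) (by rw [pow_succ]; omega)
    have h4 := T.right_eq L 1 (by simp) (by rw [pow_succ]; omega)
    simp only [one_mul, Nat.sub_self] at h3
    have h5 : (1 + 1) * 2 ^ L - 2 ^ L = 2 ^ L := by omega
    rw [h5] at h4
    simpa only [pathNode, h3, h4] using ⟨h1, h2⟩
  | succ j ih =>
    obtain ⟨h3, h4⟩ := ih (by omega)
    obtain ⟨hb1, hb2⟩ := pathNode_bounds right y j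
    have hb3 := pathNode_bounds right y (j + 1)
    set p := pathNode right y j with hp
    obtain ⟨h5, h6⟩ := level_bounds (L := L) (by omega) hb1 hb2
    have h7 : 2 ^ (L - j) = 2 * 2 ^ (L - (j + 1)) := by
      rw [← pow_succ']; congr 1; omega
    rw [h7] at h5 h6
    rw [T.left_eq _ _ (h7 ▸ h5) (h7 ▸ h6), h7] at h3
    rw [T.right_eq _ _ (h7 ▸ h5) (h7 ▸ h6), h7] at h4
    have hl := T.left_eq (L - (j + 1))
    have hr := T.right_eq (L - (j + 1))
    set z := 2 ^ (L - (j + 1)) with hz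
    have e1 : p * (2 * z) = (p + p) * z := by ring
    have e2 : (p + 1) * (2 * z) = (p + p + 1 + 1) * z := by ring
    rw [e1] at h5 h3
    rw [e2] at h6 h4
    have e3 : (p + p) * z ≤ (p + p + 1) * z := Nat.mul_le_mul_right _ (by omega)
    have e4 : (p + p + 1) * z ≤ (p + p + 1 + 1) * z := Nat.mul_le_mul_right _ (by omega)
    rw [pathNode, ← hp]
    have hr' := hr (p + p) h5 (by omega)
    split_ifs with hlt
    · exact ⟨by rw [hl (p + p) h5 (by omega)]; exact h3, hlt⟩
    · refine ⟨?_, by rw [hr (p + p + 1) (by omega) h6]; exact h4⟩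
      rw [hl (p + p + 1) (by omega) h6, ← hr']
      exact not_lt.1 hlt

/-- The search path for a point consists of the nodes whose interval contains the point. -/
theorem mem_path_iff (T : DyadicTree L v left right) {y : ℝ} (h1 : v 0 ≤ y) (h2 : y < v (2 ^ L))
    {i : ℕ} (hi1 : 1 ≤ i) (hi2 : i < 2 ^ (L + 1)) :
    i ∈ path L right y ↔ left i ≤ y ∧ y < right i := by
  simp only [path, List.mem_map, List.mem_range]
  constructor
  · rintro ⟨j, hj, rfl⟩
    exact T.pathNode_mem h1 h2 (by omega)
  · rintro ⟨h3, h4⟩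
    obtain ⟨j, hj, h5, h6⟩ := exists_height hi1 hi2
    refine ⟨j, by omega, ?_⟩
    obtain ⟨h7, h8⟩ := T.pathNode_mem h1 h2 hj
    obtain ⟨hb1, hb2⟩ := pathNode_bounds right y j
    obtain ⟨a1, a2⟩ := level_bounds hj h5 h6
    obtain ⟨b1, b2⟩ := level_bounds hj hb1 hb2
    set p := pathNode right y j
    rw [T.left_eq _ _ a1 a2] at h3
    rw [T.right_eq _ _ a1 a2] at h4
    rw [T.left_eq _ _ b1 b2] at h7
    rw [T.right_eq _ _ b1 b2] at h8
    rw [pow_succ 2 L] at a2 b2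
    have c1 := Nat.mul_le_mul_right (2 ^ (L - j)) (Nat.le_succ i)
    have c2 := Nat.mul_le_mul_right (2 ^ (L - j)) (Nat.le_succ p)
    simp only [Nat.succ_eq_add_one] at c1 c2
    -- Two distinct nodes of the same level have disjoint intervals, so `y` lies in the interval of
    -- only one of them.
    rcases lt_trichotomy p i with h | h | h
    · have := Nat.mul_le_mul_right (2 ^ (L - j)) (show p + 1 ≤ i from h)
      exact absurd (h8.trans_le (T.mono_le (by omega) (by omega))) (not_lt.2 h3)
    · exact h
    · have := Nat.mul_le_mul_right (2 ^ (L - j)) (show i + 1 ≤ p from h)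
      exact absurd (h4.trans_le (T.mono_le (by omega) (by omega))) (not_lt.2 h7)

/-- The intervals of a tree are determined by the leaf intervals and the splitting rule. -/
theorem of_split (hv : ∀ t < 2 ^ L, v t ≤ v (t + 1))
    (hl : ∀ t < 2 ^ L, left (2 ^ L + t) = v t) (hr : ∀ t < 2 ^ L, right (2 ^ L + t) = v (t + 1))
    (hl' : ∀ i, 1 ≤ i → i < 2 ^ L → left i = left (i + i))
    (hr' : ∀ i, 1 ≤ i → i < 2 ^ L → right i = right (i + i + 1)) :
    DyadicTree L v left right := by
  have H : ∀ h i, 2 ^ L ≤ i * 2 ^ h → (i + 1) * 2 ^ h ≤ 2 ^ (L + 1) →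
      left i = v (i * 2 ^ h - 2 ^ L) ∧ right i = v ((i + 1) * 2 ^ h - 2 ^ L) := by
    intro h
    induction h with
    | zero =>
      intro i h1 h2
      simp only [pow_zero, mul_one] at h1 h2 ⊢
      rw [pow_succ] at h2
      have e1 := hl (i - 2 ^ L) (by omega)
      have e2 := hr (i - 2 ^ L) (by omega)
      rw [show 2 ^ L + (i - 2 ^ L) = i by omega] at e1 e2
      exact ⟨e1, by rw [e2]; congr 1; omega⟩
    | succ h ih =>
      intro i h1 h2
      have e1 : i * 2 ^ (h + 1) = (i + i) * 2 ^ h := by rw [pow_succ]; ring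
      have e2 : (i + 1) * 2 ^ (h + 1) = (i + i + 1 + 1) * 2 ^ h := by rw [pow_succ]; ring
      rw [e1] at h1 ⊢
      rw [e2] at h2 ⊢
      have e3 : (i + i) * 2 ^ h ≤ (i + i + 1) * 2 ^ h := Nat.mul_le_mul_right _ (by omega)
      have e4 : (i + i + 1) * 2 ^ h ≤ (i + i + 1 + 1) * 2 ^ h := Nat.mul_le_mul_right _ (by omega)
      have h3 : 1 ≤ i := by
        by_contra h0
        obtain rfl : i = 0 := by omega
        have : 1 ≤ 2 ^ L := Nat.one_le_two_pow
        omega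
      have h4 : i < 2 ^ L := by
        have : 1 ≤ 2 ^ h := Nat.one_le_two_pow
        rw [pow_succ] at h2
        nlinarith
      rw [hl' i h3 h4, hr' i h3 h4]
      exact ⟨(ih (i + i) h1 (by omega)).1, (ih (i + i + 1) (by omega) h2).2⟩
  exact ⟨hv, fun h i h1 h2 => (H h i h1 h2).1, fun h i h1 h2 => (H h i h1 h2).2⟩

end DyadicTree
end Klee

/-! ### The program -/

namespace Klee
open RealRAM

/-- The names of the arrays of natural numbers used by the program. -/
inductive NVar where
  | size | leaves | width | depth | ends | leaves' | i | e | ii | ra | rb | m | key | mark | cnt | tot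
  | base
  | w (k : ℕ) | rank (k : ℕ) | shift (k : ℕ) | cand (k : ℕ) | len (k : ℕ) | ctr (k : ℕ)
  | node (k : ℕ) | item (k : ℕ)

/-- The names of the arrays of real numbers used by the program, apart from the input. -/
inductive RVar where
  | cur | vol | sum | acc | fac | out
  | x (k : ℕ) | left (k : ℕ) | right (k : ℕ) | y (k : ℕ)

/-- The numbering of the arrays of natural numbers. -/
def nv : NVar → ℕ
  | .size => 0 | .leaves => 1 | .width => 2 | .depth => 3 | .ends => 4 | .leaves' => 5 | .i => 6
  | .e => 7 | .ii => 8 | .ra => 9 | .rb => 10 | .m => 11 | .key => 12 | .mark => 13 | .cnt => 14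
  | .tot => 15 | .base => 16
  | .w k => 32 * k + 17 | .rank k => 32 * k + 18 | .shift k => 32 * k + 19
  | .cand k => 32 * k + 20 | .len k => 32 * k + 21 | .ctr k => 32 * k + 22
  | .node k => 32 * k + 23 | .item k => 32 * k + 24

/-- The numbering of the arrays of real numbers; the input occupies the arrays `0, …, 2 d`. -/
def rv (d : ℕ) : RVar → ℕ
  | .cur => 2 * d + 1 | .vol => 2 * d + 2 | .sum => 2 * d + 3 | .acc => 2 * d + 4
  | .fac => 2 * d + 5 | .out => 2 * d + 6
  | .x k => 2 * d + 1 + 16 * k + 6 | .left k => 2 * d + 1 + 16 * k + 7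
  | .right k => 2 * d + 1 + 16 * k + 8 | .y k => 2 * d + 1 + 16 * k + 9

-- The names within a family differ by their residue modulo 32 (16 for `rv`), the plain scalars
-- being small. Injectivity lets `simp` decide whether two arrays are distinct.
@[simp] theorem nv_inj {a b : NVar} : nv a = nv b ↔ a = b := by
  refine ⟨fun h => ?_, congrArg nv⟩
  cases a <;> cases b <;> simp only [nv] at h <;> first | rfl | (congr 1; omega)

@[simp] theorem rv_inj {d : ℕ} {a b : RVar} : rv d a = rv d b ↔ a = b := by
  refine ⟨fun h => ?_, congrArg _⟩
  cases a <;> cases b <;> simp only [rv] at h <;> first | rfl | (congr 1; omega)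

theorem lt_rv (d : ℕ) (a : RVar) : 2 * d < rv d a := by
  cases a <;> simp only [rv] <;> omega

/-- A scalar variable as an expression. -/
abbrev nx (a : NVar) : NExp := .get (nv a) 0

/-- A cell of an array of natural numbers as an expression. -/
abbrev nc (a : NVar) (i : NExp) : NExp := .get (nv a) i

variable (d k : ℕ)

/-- A real scalar variable as an expression. -/
abbrev rx (a : RVar) : RExp := .get (rv d a) 0

/-- A cell of an array of real numbers as an expression. -/
abbrev rc (a : RVar) (i : NExp) : RExp := .get (rv d a) i

namespace Code

/-- Compute the least power of two that is at least `2 n + 2`, and some other sizes. -/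
def setup : Prog :=
  .seq (.setNat (nv .leaves) 0 1) <| .seq (.setNat (nv .depth) 0 1) <|
  .seq (.while (.natLt (nx .leaves) (nx .size + nx .size + 2))
    (.seq (.setNat (nv .leaves) 0 (nx .leaves + nx .leaves))
      (.setNat (nv .depth) 0 (nx .depth + 1)))) <|
  .seq (.setNat (nv .ends) 0 (nx .size + nx .size)) <|
  .seq (.setNat (nv .leaves') 0 (nx .leaves + 1)) <|
  .setNat (nv .width) 0 (nx .leaves + nx .leaves)

/-- Collect the endpoints of the boxes in one coordinate direction. -/
def load : Prog :=
  .loop (nv .i) (nv .size) <|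
    -- Endpoints are numbered from `1`, since the tournament uses `0` for the absence of a
    -- competitor.
    .seq (.setReal (rv d (.x k)) (nx .i + nx .i + 1) (.get (k + 1) (nx .i)))
      (.setReal (rv d (.x k)) (nx .i + nx .i + 2) (.get (d + 1 + k) (nx .i)))

/-- Let the winners at the children of the node `ii` play. -/
def play : Prog :=
  .ite (.natLt 0 (nc (.w k) (nx .ii + nx .ii)))
    (.ite (.natLt 0 (nc (.w k) (nx .ii + nx .ii + 1)))
      (.ite (.realLt (rc d (.x k) (nc (.w k) (nx .ii + nx .ii + 1)))
          (rc d (.x k) (nc (.w k) (nx .ii + nx .ii))))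
        (.setNat (nv (.w k)) (nx .ii) (nc (.w k) (nx .ii + nx .ii + 1)))
        (.setNat (nv (.w k)) (nx .ii) (nc (.w k) (nx .ii + nx .ii))))
      (.setNat (nv (.w k)) (nx .ii) (nc (.w k) (nx .ii + nx .ii))))
    (.setNat (nv (.w k)) (nx .ii) (nc (.w k) (nx .ii + nx .ii + 1)))

/-- Set the leaf of the competitor `e` to `x`, and repair the tournament. -/
def update (x : NExp) : Prog :=
  .seq (.setNat (nv (.w k)) (nx .leaves + nx .e) x) <|
  .seq (.setNat (nv .ii) 0 (.half (nx .leaves + nx .e))) <|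
  .while (.natLt 0 (nx .ii)) (.seq (play d k) (.setNat (nv .ii) 0 (.half (nx .ii))))

/-- Enter all endpoints into the tournament. -/
def enter : Prog :=
  .loop (nv .i) (nv .ends) <|
    .seq (.setNat (nv .e) 0 (nx .i + 1)) (update d k (nx .e))

/-- Extract the endpoints in ascending order and create the leaf intervals. -/
def extract : Prog :=
  .loop (nv .i) (nv .leaves') <|
    .seq (.ite (.natLt 0 (nc (.w k) 1))
      (.seq (.setNat (nv .e) 0 (nc (.w k) 1)) <|
        .seq (.setReal (rv d .cur) 0 (rc d (.x k) (nx .e))) <|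
        .seq (.setNat (nv (.rank k)) (nx .e) (nx .i)) <|
        update d k 0)
      -- Once the tournament is empty, `cur` keeps the greatest endpoint, and the remaining leaves
      -- get empty intervals there.
      .skip) <|
    .seq (.setReal (rv d (.left k)) (nx .leaves + nx .i) (rx d .cur)) <|
    -- An endpoint is the right end of the preceding leaf. The first pass thereby writes to the
    -- inner node `leaves - 1`, which `inner` overwrites later; the last pass provides the right end
    -- of the last leaf.
    .setReal (rv d (.right k)) (nx .leaves + nx .i - 1) (rx d .cur)

/-- Create the intervals of the inner nodes. -/
def inner : Prog :=
  .loop (nv .i) (nv .leaves) <|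
    -- Inner nodes are processed in descending order, so the children are finished first. The last
    -- pass writes to the unused cell `0`.
    .seq (.setNat (nv .ii) 0 (nx .leaves - 1 - nx .i)) <|
    .seq (.setReal (rv d (.left k)) (nx .ii) (rc d (.left k) (nx .ii + nx .ii)))
      (.setReal (rv d (.right k)) (nx .ii) (rc d (.right k) (nx .ii + nx .ii + 1)))

/-- Tabulate the multiples of a power of the width. -/
def tabulate : Prog :=
  .seq (.loop (nv .i) (nv .width)
    -- Natural numbers cannot be multiplied by the machine; the tables make the key of a tuple a sum
    -- of `d` table entries.
    (.setNat (nv (.shift k)) (nx .i + 1) (nc (.shift k) (nx .i) + nx .base))) <|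
  .setNat (nv .base) 0 (nc (.shift k) (nx .width))

/-- Sort the endpoints and build the dyadic tree in one coordinate direction. -/
def prepare : Prog :=
  .seq (load d k) <| .seq (enter d k) <| .seq (extract d k) <| inner d k

/-- List the nodes that cover a side of the box `i`. -/
def cover : Prog :=
  .seq (.setNat (nv .ra) 0 (nx .leaves + nc (.rank k) (nx .i + nx .i + 1))) <|
  .seq (.setNat (nv .rb) 0 (nx .leaves + nc (.rank k) (nx .i + nx .i + 2))) <|
  .seq (.setNat (nv (.len k)) 0 0) <|
  .while (.natLt (nx .ra) (nx .rb)) <|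
    .seq (.setNat (nv (.cand k)) (nx (.len k)) (nx .ra)) <|
    .seq (.setNat (nv (.cand k)) (nx (.len k) + 1) (nx .rb - 1)) <|
    .seq (.setNat (nv (.len k)) 0 (nx (.len k) + 2)) <|
    .seq (.setNat (nv .ra) 0 (.half (nx .ra + 1))) (.setNat (nv .rb) 0 (.half (nx .rb)))

/-- Nested loops over all tuples of candidates. -/
def nest (p : Prog) : Prog :=
  .nest (fun k => nv (.ctr k)) (fun k => nv (.len k)) (fun k => nv (.cand k))
    (fun k => nv (.node k)) d p

/-- Compute the key of the current tuple of nodes. -/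
def key : Prog :=
  .seq (.setNat (nv .key) 0 0) <|
  .dims d fun k => .setNat (nv .key) 0 (nx .key + nc (.shift k) (nx (.node k)))

/-- Append the current tuple of nodes to the list of items. -/
def append : Prog :=
  .seq (.setNat (nv .mark) (nx .key) 1) <|
  .seq (.setReal (rv d .vol) (nx .m) (.ofNat 1)) <|
  .seq (.dims d fun k =>
    .seq (.setNat (nv (.item k)) (nx .m) (nx (.node k)))
      (.setReal (rv d .vol) (nx .m) (rc d .vol (nx .m) *
        (rc d (.right k) (nx (.node k)) - rc d (.left k) (nx (.node k)))))) <|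
  .seq (.setReal (rv d .sum) 0 (rx d .sum + rc d .vol (nx .m)))
    (.setNat (nv .m) 0 (nx .m + 1))

/-- Collect the items of all boxes. -/
def collect : Prog :=
  .loop (nv .i) (nv .size) <|
    .seq (.dims d cover) <|
    nest d (.seq (key d) (.ite (.natLt (nc .mark (nx .key)) 1) (append d) .skip))

/-- Compute the factor that determines the number of samples. -/
def factor : Prog :=
  .seq (.setReal (rv d .fac) 0 (.ofNat 10 * ((.ofNat 1 + .get 0 0) / .get 0 0) *
    ((.ofNat 1 + .get 0 0) / .get 0 0))) <|
  .dims d fun _ => .setReal (rv d .fac) 0 (rx d .fac * .ofNat (nx .depth))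

/-- Choose a coordinate of a random point of the item `i`, and list the nodes on its search path. -/
def descend : Prog :=
  .seq (.sample (rv d (.y k)) 0) <|
  .seq (.setReal (rv d (.y k)) 0 (rc d (.left k) (nc (.item k) (nx .i)) + rx d (.y k) *
    (rc d (.right k) (nc (.item k) (nx .i)) - rc d (.left k) (nc (.item k) (nx .i))))) <|
  .seq (.setNat (nv .ii) 0 1) <|
  .seq (.setNat (nv (.len k)) 0 0) <|
  .while (.natLt (nx .ii) (nx .width)) <|
    .seq (.setNat (nv (.cand k)) (nx (.len k)) (nx .ii)) <|
    .seq (.setNat (nv (.len k)) 0 (nx (.len k) + 1)) <|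
    -- At a leaf this reads a cell beyond the tree; either branch then makes `ii` at least `width`
    -- and ends the loop.
    .ite (.realLt (rx d (.y k)) (rc d (.right k) (nx .ii + nx .ii)))
      (.setNat (nv .ii) 0 (nx .ii + nx .ii))
      (.setNat (nv .ii) 0 (nx .ii + nx .ii + 1))

/-- Take one sample from the item `i`. -/
def trial : Prog :=
  .seq (.dims d (descend d)) <|
  .seq (.setNat (nv .tot) 0 0) <|
  .seq (nest d (.seq (key d) (.setNat (nv .tot) 0 (nx .tot + nc .mark (nx .key))))) <|
  .setReal (rv d .acc) 0 (rx d .acc + .ofNat 1 / .ofNat (nx .tot))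

/-- Estimate the contribution of every item, and add up. -/
def estimate : Prog :=
  .loop (nv .i) (nv .m) <|
    .seq (.setNat (nv .cnt) 0 0) <|
    .seq (.setReal (rv d .acc) 0 (.ofNat 0)) <|
    -- Comparing products stops the counter at the ceiling of `fac * vol / sum` without dividing or
    -- rounding, and also works for `sum = 0`.
    .seq (.while (.realLt (.ofNat (nx .cnt) * rx d .sum) (rx d .fac * rc d .vol (nx .i)))
      (.seq (trial d) (.setNat (nv .cnt) 0 (nx .cnt + 1)))) <|
    .setReal (rv d .out) 0 (rx d .out + rc d .vol (nx .i) * rx d .acc / .ofNat (nx .cnt))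

/-- Everything before the sampling starts. -/
def preprocess : Prog :=
  .seq setup <| .seq (.dims d (prepare d)) <|
  .seq (.setNat (nv .base) 0 1) <| .seq (.dims d tabulate) <|
  .seq (collect d) (factor d)

/-- The whole program. -/
def main : Prog :=
  .seq (preprocess d) <| .seq (estimate d) <| .setReal 0 0 (rx d .out)

end Code
end Klee

/-! ### Correctness of the sorting phase -/

namespace Klee
open RealRAM

variable {ω : Source} {d k : ℕ} {s : State}

theorem run_play : Run ω (Code.play d k) s 100 fun s' =>
    s' = s.setNat (nv (.w k)) (s.nat (nv .ii) 0) (pick (s.real (rv d (.x k)))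
      (s.nat (nv (.w k)) (s.nat (nv .ii) 0 + s.nat (nv .ii) 0))
      (s.nat (nv (.w k)) (s.nat (nv .ii) 0 + s.nat (nv .ii) 0 + 1))) := by
  refine (Run.ite (T := 80) (fun h1 => (Run.ite (T := 50) (fun h2 => (Run.ite (T := 20)
    (fun h3 => (Run.setNat ?_).mono ?_) (fun h3 => (Run.setNat ?_).mono ?_)).mono ?_)
    (fun h2 => (Run.setNat ?_).mono ?_)).mono ?_)
    (fun h1 => (Run.setNat ?_).mono ?_)).mono ?_ <;>
  first
  | (simp; done)
  | (simp at h1 h2 h3 ⊢; simp [pick, h1.ne', h2.ne', h3]; done)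
  | (simp at h1 h2 h3 ⊢; simp [pick, h1.ne', h2.ne', not_lt.2 h3])
  | (simp at h1 h2 ⊢; simp [pick, h1.ne', h2])
  | (simp at h1 ⊢; simp [pick, h1])

/-- Changing a node can violate the tournament rule only at its parent. The invariant therefore
allows one exceptional node `ii`, which moves up to its parent in every pass; when `ii = 0`, no
exception is left. The bound `ii < 2 ^ r` gives at most `L` passes. -/
theorem run_update {L : ℕ} {x : NExp} (hM : s.nat (nv .leaves) 0 = 2 ^ L)
    (he : s.nat (nv .e) 0 < 2 ^ L)
    (hw : IsTournament (2 ^ L) (s.real (rv d (.x k))) (s.nat (nv (.w k)))) :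
    Run ω (Code.update d k x) s (L * 120 + x.cost + 30) fun s' =>
      IsTournament (2 ^ L) (s.real (rv d (.x k))) (s'.nat (nv (.w k))) ∧
      ∀ j, 2 ^ L ≤ j → s'.nat (nv (.w k)) j =
        if j = 2 ^ L + s.nat (nv .e) 0 then x.eval s else s.nat (nv (.w k)) j := by
  refine (Run.seq_setNat (Run.seq_setNat (Run.whileDown (T := 105) (N := L) (I := fun r s' =>
    s'.nat (nv .ii) 0 < 2 ^ r ∧ s'.nat (nv .ii) 0 < 2 ^ L ∧
    (∀ i, 1 ≤ i → i < 2 ^ L → i ≠ s'.nat (nv .ii) 0 → s'.nat (nv (.w k)) i =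
      pick (s.real (rv d (.x k))) (s'.nat (nv (.w k)) (i + i)) (s'.nat (nv (.w k)) (i + i + 1))) ∧
    ∀ j, 2 ^ L ≤ j → s'.nat (nv (.w k)) j =
        if j = 2 ^ L + s.nat (nv .e) 0 then x.eval s else s.nat (nv (.w k)) j) ?_ ?_ ?_ ?_))).mono ?_
  · simp only [State.nat_setNat, nv_inj, NExp.eval_add, NExp.eval_get, NExp.eval_zero, hM,
      NExp.eval_half, reduceCtorEq, false_and, if_false, and_self, if_true, true_and]
    refine ⟨by omega, by omega, fun i h1 h2 h3 => ?_, fun j hj => trivial⟩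
    rw [if_neg (by omega), if_neg (by omega), if_neg (by omega)]
    exact hw i h1 h2
  · rintro s' ⟨h, -⟩
    simpa using h
  · rintro r s' hs ⟨h1, h2, h3, h4⟩ hb
    simp only [BExp.holds_natLt, NExp.eval_zero, NExp.eval_get] at hb
    have hx : s'.real (rv d (.x k)) = s.real (rv d (.x k)) := by
      rw [hs.real _ (by simp [Code.play])]; simp
    refine run_play.seq (T₂ := 5) fun s₁ _ h => (Run.setNat ?_).mono (by simp)
    subst h
    simp only [State.nat_setNat, nv_inj, NExp.eval_get, NExp.eval_zero, hx,
      NExp.eval_half, reduceCtorEq, false_and, if_false, and_self, if_true, true_and]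
    rw [pow_succ] at h1
    refine ⟨by omega, by omega, fun i hi1 hi2 hi3 => ?_, fun j hj => ?_⟩
    · rw [if_neg (show i + i ≠ _ by omega), if_neg (show i + i + 1 ≠ _ by omega)]
      split_ifs with h
      · rw [h]
      · exact h3 i hi1 hi2 h
    · rw [if_neg (show j ≠ _ by omega)]
      exact h4 j hj
  · rintro r s' hs ⟨h1, h2, h3, h4⟩ hb
    simp only [BExp.holds_natLt, NExp.eval_zero, NExp.eval_get, not_lt, Nat.le_zero] at hb
    exact ⟨fun i hi1 hi2 => h3 i hi1 hi2 (by omega), h4⟩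
  · simp; omega
theorem ne_rv {a d : ℕ} (h : a ≤ 2 * d) (b : RVar) : a ≠ rv d b := (h.trans_lt (lt_rv d b)).ne

theorem run_load {n : ℕ} (hn : s.nat (nv .size) 0 = n) (hk : k < d) :
    Run ω (Code.load d k) s (n * 40 + 10) fun s' => ∀ i < n,
      s'.real (rv d (.x k)) (i + i + 1) = s.real (k + 1) i ∧
      s'.real (rv d (.x k)) (i + i + 2) = s.real (d + 1 + k) i := by
  have e1 := ne_rv (d := d) (a := k + 1) (by omega)
  have e2 := ne_rv (d := d) (a := d + 1 + k) (by omega)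
  refine (Run.loop (N := n) (T := fun _ => 25) (I := fun j s' => ∀ i < j,
      s'.real (rv d (.x k)) (i + i + 1) = s.real (k + 1) i ∧
      s'.real (rv d (.x k)) (i + i + 2) = s.real (d + 1 + k) i)
    (by simp) hn (by simp) (by simp) (by simp) (by simp) ?_).mono (by simp; omega)
  intro j s' hs hj hi h
  have h1 : s'.real (k + 1) = s.real (k + 1) := hs.real _ (by simp [e1])
  have h2 : s'.real (d + 1 + k) = s.real (d + 1 + k) := hs.real _ (by simp [e2])
  refine Run.mono (Run.seq_setReal (Run.setReal ?_)) (by simp)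
  intro i hij
  simp only [RExp.eval_get, NExp.eval_get, NExp.eval_zero, State.nat_setReal, hi, NExp.eval_add,
    NExp.eval_one, State.real_setReal, NExp.eval_two, true_and, h1, h2, e2, false_and, if_false]
  rcases Nat.lt_succ_iff_lt_or_eq.1 hij with h3 | rfl
  · rw [if_neg (by omega), if_neg (by omega), if_neg (by omega), if_neg (by omega)]
    exact h i h3
  · simp

theorem run_enter {L n : ℕ} (hM : s.nat (nv .leaves) 0 = 2 ^ L) (hn : s.nat (nv .ends) 0 = n)
    (hnL : n < 2 ^ L) (hw : ∀ i, s.nat (nv (.w k)) i = 0) :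
    Run ω (Code.enter d k) s (n * (L * 120 + 60) + 10) fun s' =>
      IsTournament (2 ^ L) (s.real (rv d (.x k))) (s'.nat (nv (.w k))) ∧
      ∀ e < 2 ^ L, s'.nat (nv (.w k)) (2 ^ L + e) = if 1 ≤ e ∧ e ≤ n then e else 0 := by
  refine (Run.loop (N := n) (T := fun _ => L * 120 + 40) (I := fun j s' =>
      IsTournament (2 ^ L) (s.real (rv d (.x k))) (s'.nat (nv (.w k))) ∧
      ∀ e < 2 ^ L, s'.nat (nv (.w k)) (2 ^ L + e) = if 1 ≤ e ∧ e ≤ j then e else 0)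
    (by simp) hn (by simp [Code.update, Code.play]) (by simp [Code.update, Code.play])
    ?_ ?_ ?_).mono ?_
  -- The memory is zero at first, which is the tournament without competitors.
  · refine ⟨fun i h1 h2 => by simp [hw, pick], fun e he => ?_⟩
    rw [hw, if_neg (by omega)]
  · rintro j s' x ⟨h1, h2⟩
    rw [State.nat_setNat_of_ne _ _ _ (by simp)]
    exact ⟨h1, h2⟩
  · rintro j s' hs hj hi ⟨h1, h2⟩
    have hx : s'.real (rv d (.x k)) = s.real (rv d (.x k)) :=
      hs.real _ (by simp [Code.update, Code.play])
    have hM' : s'.nat (nv .leaves) 0 = 2 ^ L := by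
      rw [hs.nat _ (by simp [Code.update, Code.play]), hM]
    refine (Run.seq_setNat ((run_update (L := L) ?_ ?_ ?_).post ?_)).mono (by simp; omega)
    · simpa using hM'
    · simp [hi]; omega
    · rw [State.nat_setNat_of_ne _ _ _ (by simp)]
      simpa [hx] using h1
    · rintro s₁ - ⟨h3, h4⟩
      simp only [State.real_setNat, hx] at h3
      refine ⟨h3, fun e he => ?_⟩
      rw [h4 _ (by omega)]
      simp only [NExp.eval_get, NExp.eval_zero, NExp.eval_add, hi, NExp.eval_one, State.nat_setNat,
        and_self, if_true, nv_inj, reduceCtorEq, false_and, if_false, Nat.add_left_cancel_iff,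
        h2 e he]
      grind
  · simp; nlinarith

/-- A pass of the extraction loop: the least remaining endpoint, if there is one, is moved to
`cur`. -/
theorem run_extract_step {L n j : ℕ} (hM : s.nat (nv .leaves) 0 = 2 ^ L)
    (hj : s.nat (nv .i) 0 = j)
    (hw : IsTournament (2 ^ L) (s.real (rv d (.x k))) (s.nat (nv (.w k))))
    (hleaf : ∀ e < 2 ^ L, s.nat (nv (.w k)) (2 ^ L + e) = 0 ∨
      s.nat (nv (.w k)) (2 ^ L + e) = e ∧ 1 ≤ e ∧ e ≤ n)
    (hdead : ∀ e, 1 ≤ e → e ≤ n → s.nat (nv (.w k)) (2 ^ L + e) = 0 →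
      s.nat (nv (.rank k)) e < j ∧
        s.real (rv d (.left k)) (2 ^ L + s.nat (nv (.rank k)) e) = s.real (rv d (.x k)) e)
    (hcard : ((Finset.range (2 ^ L)).filter fun e => s.nat (nv (.w k)) (2 ^ L + e) ≠ 0).card
      ≤ n - j)
    (hcur : ∀ e < 2 ^ L, s.nat (nv (.w k)) (2 ^ L + e) ≠ 0 → 0 < j →
      s.real (rv d .cur) 0 ≤ s.real (rv d (.x k)) e) :
    Run ω (.ite (.natLt 0 (nc (.w k) 1))
      (.seq (.setNat (nv .e) 0 (nc (.w k) 1)) <|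
        .seq (.setReal (rv d .cur) 0 (rc d (.x k) (nx .e))) <|
        .seq (.setNat (nv (.rank k)) (nx .e) (nx .i)) <|
        Code.update d k 0)
      .skip) s (L * 120 + 60) fun s' =>
      IsTournament (2 ^ L) (s.real (rv d (.x k))) (s'.nat (nv (.w k))) ∧
      (∀ e < 2 ^ L, s'.nat (nv (.w k)) (2 ^ L + e) = 0 ∨
        s'.nat (nv (.w k)) (2 ^ L + e) = e ∧ 1 ≤ e ∧ e ≤ n) ∧
      (∀ e, 1 ≤ e → e ≤ n → s'.nat (nv (.w k)) (2 ^ L + e) = 0 →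
        s'.nat (nv (.rank k)) e = j ∧ s'.real (rv d .cur) 0 = s.real (rv d (.x k)) e ∨
        s'.nat (nv (.rank k)) e < j ∧
        s.real (rv d (.left k)) (2 ^ L + s'.nat (nv (.rank k)) e) = s.real (rv d (.x k)) e) ∧
      ((Finset.range (2 ^ L)).filter fun e => s'.nat (nv (.w k)) (2 ^ L + e) ≠ 0).card
        ≤ n - (j + 1) ∧
      (∀ e < 2 ^ L, s'.nat (nv (.w k)) (2 ^ L + e) ≠ 0 →
        s'.real (rv d .cur) 0 ≤ s.real (rv d (.x k)) e) ∧
      (0 < j → s.real (rv d .cur) 0 ≤ s'.real (rv d .cur) 0) := by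
  have hroot : ∀ e < 2 ^ L, s.nat (nv (.w k)) (2 ^ L + e) ≠ 0 → s.nat (nv (.w k)) 1 ≠ 0 ∧
      s.real (rv d (.x k)) (s.nat (nv (.w k)) 1) ≤ s.real (rv d (.x k)) e := by
    intro e he h
    have := hw.root_le (j := 2 ^ L + e) (by omega) (by rw [pow_succ]; omega) h
    rcases hleaf e he with h' | ⟨h', -⟩
    · exact absurd h' h
    · rwa [h'] at this
  refine (Run.ite (T := L * 120 + 50) (fun hb => ?_) (fun hb => Run.mono (Run.skip ?_)
    (by omega))).mono (by simp; omega)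
  · simp only [BExp.holds_natLt, NExp.eval_zero, NExp.eval_get, NExp.eval_one] at hb
    -- The winner at the root sits at some leaf, and a live leaf holds its own number; so the winner
    -- `e₀` identifies the leaf that has to be cleared.
    obtain ⟨e₀, he₀, h0⟩ : ∃ e₀ < 2 ^ L, s.nat (nv (.w k)) (2 ^ L + e₀) = s.nat (nv (.w k)) 1 := by
      obtain ⟨j, h1, h2, h3⟩ := hw.exists_leaf Nat.one_le_two_pow
      exact ⟨j - 2 ^ L, by omega, by rw [← h3]; congr 1; omega⟩
    have h1 : s.nat (nv (.w k)) 1 = e₀ ∧ 1 ≤ e₀ ∧ e₀ ≤ n := by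
      rcases hleaf e₀ he₀ with h | ⟨h, h'⟩
      · omega
      · exact ⟨by rw [← h0, h], h'⟩
    refine (Run.seq_setNat (Run.seq_setReal (Run.seq_setNat
      ((run_update (L := L) ?_ ?_ ?_).post ?_)))).mono (by simp; omega)
    · simpa using hM
    · simpa [h1] using he₀
    · simp only [NExp.eval_get, NExp.eval_zero, NExp.eval_one, State.nat_setReal, State.real_setNat]
      rw [State.nat_setNat_of_ne _ _ _ (by simp), State.real_setReal_of_ne _ _ _ (by simp),
        State.nat_setReal, State.nat_setNat_of_ne _ _ _ (by simp)]
      exact hw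
    · rintro s' hs ⟨h2, h3⟩
      have hcur' : s'.real (rv d .cur) 0 = s.real (rv d (.x k)) e₀ := by
        rw [hs.real _ (by simp [Code.update, Code.play])]
        simp [h1]
      have hrank' : ∀ e, s'.nat (nv (.rank k)) e = if e = e₀ then j else s.nat (nv (.rank k)) e := by
        intro e
        rw [hs.nat _ (by simp [Code.update, Code.play])]
        simp [h1, hj]
      have hw' : ∀ e, s'.nat (nv (.w k)) (2 ^ L + e) =
          if e = e₀ then 0 else s.nat (nv (.w k)) (2 ^ L + e) := by
        intro e
        rw [h3 _ (by omega)]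
        simp [h1]
      simp only [NExp.eval_get, NExp.eval_zero, NExp.eval_one, State.nat_setReal, State.real_setNat]
        at h2
      rw [State.real_setReal_of_ne _ _ _ (by simp), State.real_setNat] at h2
      refine ⟨h2, fun e he => ?_, fun e he1 he2 => ?_, ?_, fun e he => ?_, fun h => ?_⟩
      · rw [hw']
        split_ifs
        · exact Or.inl rfl
        · exact hleaf e he
      · rw [hw', hrank', hcur']
        split_ifs with h
        · exact fun _ => Or.inl ⟨rfl, by rw [h]⟩
        · exact fun h' => Or.inr (hdead e he1 he2 h')
      -- Exactly one live leaf disappears, which drives the bound `n - j` for the number of live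
      -- leaves.
      · have h4 : (Finset.range (2 ^ L)).filter (fun e => s'.nat (nv (.w k)) (2 ^ L + e) ≠ 0) =
            ((Finset.range (2 ^ L)).filter fun e => s.nat (nv (.w k)) (2 ^ L + e) ≠ 0).erase e₀ := by
          ext e
          simp only [Finset.mem_filter, Finset.mem_erase, hw']
          by_cases h : e = e₀ <;> simp [h]
        rw [h4, Finset.card_erase_of_mem (by simp [he₀, h0, h1]; omega)]
        omega
      · rw [hw', hcur']
        split_ifs
        · simp
        · intro h
          have := (hroot e he h).2
          rwa [h1.1] at this
      · rw [hcur']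
        exact hcur e₀ he₀ (by omega) h
  · simp only [BExp.holds_natLt, NExp.eval_zero, NExp.eval_get, NExp.eval_one, not_lt,
      Nat.le_zero] at hb
    have hall : ∀ e < 2 ^ L, s.nat (nv (.w k)) (2 ^ L + e) = 0 := fun e he => by
      by_contra h
      exact (hroot e he h).1 hb
    refine ⟨hw, hleaf, fun e h1 h2 h3 => Or.inr (hdead e h1 h2 h3), ?_,
      fun e he h => absurd (hall e he) h, fun _ => le_rfl⟩
    rw [Finset.filter_false_of_mem (by simpa using hall)]
    simp

end Klee

/-! ### Building the dyadic trees and the tables of multiples -/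

namespace Klee
open RealRAM

variable {ω : Source} {d k : ℕ} {s : State}

/-- The invariant before pass `j`: a cleared endpoint has a rank below `j` at which `left` holds its
value; at most `n - j` leaves are live; `cur` is a lower bound for the live keys, so the breakpoints
come out in ascending order. For `j = 0` nothing is claimed about `cur`, which may hold a value left
over from another coordinate direction. -/
theorem run_extract {L n : ℕ} (hM : s.nat (nv .leaves) 0 = 2 ^ L)
    (hM' : s.nat (nv .leaves') 0 = 2 ^ L + 1) (hnL : n < 2 ^ L)
    (hw : IsTournament (2 ^ L) (s.real (rv d (.x k))) (s.nat (nv (.w k))))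
    (hleaf : ∀ e < 2 ^ L, s.nat (nv (.w k)) (2 ^ L + e) = if 1 ≤ e ∧ e ≤ n then e else 0) :
    Run ω (Code.extract d k) s ((2 ^ L + 1) * (L * 120 + 100) + 10) fun s' =>
      (∀ t < 2 ^ L, s'.real (rv d (.left k)) (2 ^ L + t) ≤ s'.real (rv d (.left k)) (2 ^ L + t + 1) ∧
        s'.real (rv d (.right k)) (2 ^ L + t) = s'.real (rv d (.left k)) (2 ^ L + t + 1)) ∧
      ∀ e, 1 ≤ e → e ≤ n → s'.nat (nv (.rank k)) e ≤ 2 ^ L ∧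
        s'.real (rv d (.left k)) (2 ^ L + s'.nat (nv (.rank k)) e) = s.real (rv d (.x k)) e := by
  refine ((Run.loop (N := 2 ^ L + 1) (T := fun _ => L * 120 + 85) (I := fun j s' =>
      IsTournament (2 ^ L) (s.real (rv d (.x k))) (s'.nat (nv (.w k))) ∧
      (∀ e < 2 ^ L, s'.nat (nv (.w k)) (2 ^ L + e) = 0 ∨
        s'.nat (nv (.w k)) (2 ^ L + e) = e ∧ 1 ≤ e ∧ e ≤ n) ∧
      (∀ e, 1 ≤ e → e ≤ n → s'.nat (nv (.w k)) (2 ^ L + e) = 0 →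
        s'.nat (nv (.rank k)) e < j ∧
        s'.real (rv d (.left k)) (2 ^ L + s'.nat (nv (.rank k)) e) = s.real (rv d (.x k)) e) ∧
      ((Finset.range (2 ^ L)).filter fun e => s'.nat (nv (.w k)) (2 ^ L + e) ≠ 0).card ≤ n - j ∧
      (∀ e < 2 ^ L, s'.nat (nv (.w k)) (2 ^ L + e) ≠ 0 → 0 < j →
        s'.real (rv d .cur) 0 ≤ s.real (rv d (.x k)) e) ∧
      (∀ t, t + 1 < j →
        s'.real (rv d (.left k)) (2 ^ L + t) ≤ s'.real (rv d (.left k)) (2 ^ L + t + 1) ∧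
        s'.real (rv d (.right k)) (2 ^ L + t) = s'.real (rv d (.left k)) (2 ^ L + t + 1)) ∧
      (∀ t, t + 1 = j → s'.real (rv d (.left k)) (2 ^ L + t) = s'.real (rv d .cur) 0))
    (by simp) hM' (by simp [Code.update, Code.play]) (by simp [Code.update, Code.play])
    ?_ ?_ ?_).mono ?_).post ?_
  · refine ⟨hw, fun e he => ?_, fun e h1 h2 h3 => ?_, ?_, by simp, by simp, by simp⟩
    · rw [hleaf e he]
      split_ifs with h
      · exact Or.inr ⟨rfl, h⟩
      · exact Or.inl rfl
    · rw [hleaf e (by omega), if_pos ⟨h1, h2⟩] at h3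
      omega
    · have : (Finset.range (2 ^ L)).filter (fun e => s.nat (nv (.w k)) (2 ^ L + e) ≠ 0) ⊆
          Finset.Icc 1 n := by
        intro e he
        simp only [Finset.mem_filter, Finset.mem_range] at he
        rw [hleaf e he.1] at he
        rw [Finset.mem_Icc]
        by_contra h
        simp [h] at he
      simpa using Finset.card_le_card this
  · rintro j s' x h
    rw [State.real_setNat, State.nat_setNat_of_ne _ _ _ (by simp),
      State.nat_setNat_of_ne _ _ _ (by simp)]
    exact h
  · rintro j s' hs hj hi ⟨h1, h2, h3, h4, h5, h6, h7⟩
    have hx : s'.real (rv d (.x k)) = s.real (rv d (.x k)) :=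
      hs.real _ (by simp [Code.update, Code.play])
    have hMs : s'.nat (nv .leaves) 0 = 2 ^ L := by
      rw [hs.nat _ (by simp [Code.update, Code.play]), hM]
    refine ((run_extract_step (n := n) hMs hi (hx ▸ h1) h2 (hx ▸ h3) h4 (hx ▸ h5)).seq
      (T₂ := 25) fun s₁ hs₁ h => Run.mono (Run.seq_setReal (Run.setReal ?_)) (by simp))
    rw [hx] at h
    obtain ⟨g1, g2, g3, g4, g5, g6⟩ := h
    have hi₁ : s₁.nat (nv .i) 0 = j := by rw [hs₁.nat _ (by simp [Code.update, Code.play]), hi]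
    have hM₁ : s₁.nat (nv .leaves) 0 = 2 ^ L := by
      rw [hs₁.nat _ (by simp [Code.update, Code.play]), hMs]
    have hl₁ : s₁.real (rv d (.left k)) = s'.real (rv d (.left k)) :=
      hs₁.real _ (by simp [Code.update, Code.play])
    have hr₁ : s₁.real (rv d (.right k)) = s'.real (rv d (.right k)) :=
      hs₁.real _ (by simp [Code.update, Code.play])
    simp only [RExp.eval_get, NExp.eval_get, NExp.eval_zero, NExp.eval_add, NExp.eval_sub,
      NExp.eval_one, State.nat_setReal, State.real_setReal, rv_inj, reduceCtorEq, false_and,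
      if_false, hi₁, hM₁, hl₁, hr₁, true_and]
    refine ⟨g1, g2, fun e he1 he2 he3 => ?_, g4, fun e he1 he2 _ => g5 e he1 he2,
      fun t ht => ?_, fun t ht => ?_⟩
    · rcases g3 e he1 he2 he3 with ⟨e1, e2⟩ | ⟨e1, e2⟩
      · simp [e1, e2]
      · refine ⟨by omega, ?_⟩
        rw [if_neg (by omega)]
        exact e2
    · rw [if_neg (by omega)]
      by_cases h : t + 1 = j
      · rw [if_pos (by omega), if_pos (by omega)]
        exact ⟨by rw [h7 t h]; exact g6 (by omega), rfl⟩
      · rw [if_neg (by omega), if_neg (by omega)]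
        exact h6 t (by omega)
    · rw [if_pos (by omega)]
  · simp; nlinarith
  · rintro s' - ⟨-, -, h3, h4, -, h6, -⟩
    refine ⟨fun t ht => h6 t (by omega), fun e he1 he2 => ?_⟩
    -- There are more passes than endpoints, so no leaf is live at the end and every endpoint has
    -- its rank.
    have : (Finset.range (2 ^ L)).filter (fun e => s'.nat (nv (.w k)) (2 ^ L + e) ≠ 0) = ∅ := by
      rw [← Finset.card_eq_zero]; omega
    have h := Finset.filter_eq_empty_iff.1 this (x := e) (by simp; omega)
    obtain ⟨h7, h8⟩ := h3 e he1 he2 (by simpa using h)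
    exact ⟨by omega, h8⟩

theorem run_inner {L : ℕ} (hM : s.nat (nv .leaves) 0 = 2 ^ L)
    (hleaf : ∀ t < 2 ^ L,
      s.real (rv d (.left k)) (2 ^ L + t) ≤ s.real (rv d (.left k)) (2 ^ L + t + 1) ∧
        s.real (rv d (.right k)) (2 ^ L + t) = s.real (rv d (.left k)) (2 ^ L + t + 1)) :
    Run ω (Code.inner d k) s (2 ^ L * 60 + 10) fun s' =>
      DyadicTree L (fun t => s.real (rv d (.left k)) (2 ^ L + t)) (s'.real (rv d (.left k)))
        (s'.real (rv d (.right k))) := by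
  refine ((Run.loop (N := 2 ^ L) (T := fun _ => 45) (I := fun j s' => (∀ i, 2 ^ L ≤ i →
      s'.real (rv d (.left k)) i = s.real (rv d (.left k)) i ∧
      s'.real (rv d (.right k)) i = s.real (rv d (.right k)) i) ∧
      ∀ i, 2 ^ L - j ≤ i → i < 2 ^ L →
        s'.real (rv d (.left k)) i = s'.real (rv d (.left k)) (i + i) ∧
        s'.real (rv d (.right k)) i = s'.real (rv d (.right k)) (i + i + 1))
    (by simp) hM (by simp) (by simp) ?_ ?_ ?_).mono ?_).post ?_
  · exact ⟨fun _ _ => ⟨rfl, rfl⟩, by omega⟩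
  · intro j s' x h
    simpa using h
  · rintro j s' hs hj hi ⟨h1, h2⟩
    have hMs : s'.nat (nv .leaves) 0 = 2 ^ L := by rw [hs.nat _ (by simp), hM]
    refine Run.mono (Run.seq_setNat (Run.seq_setReal (Run.setReal ?_))) (by simp)
    simp only [RExp.eval_get, NExp.eval_get, NExp.eval_zero, NExp.eval_add, NExp.eval_sub,
      NExp.eval_one, State.nat_setReal, State.real_setReal, rv_inj, reduceCtorEq, false_and,
      if_false, hi, hMs, true_and, State.real_setNat, State.nat_setNat, and_self, if_true]
    refine ⟨fun i hi => ?_, fun i hi1 hi2 => ?_⟩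
    · rw [if_neg (by omega), if_neg (by omega)]
      exact h1 i hi
    · rw [if_neg (show i + i + 1 ≠ _ by omega)]
      by_cases h : i = 2 ^ L - 1 - j
      · rw [if_pos h, if_pos h, h]
        refine ⟨?_, rfl⟩
        split_ifs with h'
        · rfl
        · rfl
      · rw [if_neg h, if_neg h, if_neg (by omega)]
        exact h2 i (by omega) hi2
  · simp; omega
  · rintro s' - ⟨h1, h2⟩
    refine DyadicTree.of_split (fun t ht => (hleaf t ht).1) (fun t ht => (h1 _ (by omega)).1)
      (fun t ht => ?_) (fun i hi1 hi2 => (h2 i (by omega) hi2).1)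
      (fun i hi1 hi2 => (h2 i (by omega) hi2).2)
    rw [(h1 _ (by omega)).2, (hleaf t ht).2]
    rfl

/-- The dyadic tree of one coordinate direction has been built. -/
def IsPrepared (L n d k : ℕ) (lo hi : ℕ → ℝ) (s : State) : Prop :=
  ∃ v, DyadicTree L v (s.real (rv d (.left k))) (s.real (rv d (.right k))) ∧
    ∀ i < n, s.nat (nv (.rank k)) (i + i + 1) ≤ 2 ^ L ∧
      v (s.nat (nv (.rank k)) (i + i + 1)) = lo i ∧
      s.nat (nv (.rank k)) (i + i + 2) ≤ 2 ^ L ∧ v (s.nat (nv (.rank k)) (i + i + 2)) = hi i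

theorem run_prepare {L n : ℕ} (hk : k < d) (hn : s.nat (nv .size) 0 = n)
    (hn2 : s.nat (nv .ends) 0 = n + n) (hM : s.nat (nv .leaves) 0 = 2 ^ L)
    (hM' : s.nat (nv .leaves') 0 = 2 ^ L + 1) (hnL : n + n < 2 ^ L)
    (hw : ∀ i, s.nat (nv (.w k)) i = 0) :
    Run ω (Code.prepare d k) s (2 ^ L * (L * 360 + 360)) fun s' =>
      IsPrepared L n d k (s.real (k + 1)) (s.real (d + 1 + k)) s' := by
  refine ((run_load hn hk).seq fun s₁ hs₁ h₁ => (run_enter (n := n + n) (L := L) ?_ ?_ hnL ?_).seq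
    fun s₂ hs₂ h₂ => (run_extract (n := n + n) (L := L) ?_ ?_ hnL ?_ h₂.2).seq
    fun s₃ hs₃ h₃ => (run_inner (L := L) ?_ h₃.1).post fun s₄ hs₄ h₄ => ?_).mono ?_
  · rw [hs₁.nat _ (by simp [Code.load]), hM]
  · rw [hs₁.nat _ (by simp [Code.load]), hn2]
  · rwa [hs₁.nat _ (by simp [Code.load])]
  · rw [hs₂.nat _ (by simp [Code.enter, Code.update, Code.play]),
      hs₁.nat _ (by simp [Code.load]), hM]
  · rw [hs₂.nat _ (by simp [Code.enter, Code.update, Code.play]),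
      hs₁.nat _ (by simp [Code.load]), hM']
  · rw [hs₂.real _ (by simp [Code.enter, Code.update, Code.play])]
    exact h₂.1
  · rw [hs₃.nat _ (by simp [Code.extract, Code.update, Code.play]),
      hs₂.nat _ (by simp [Code.enter, Code.update, Code.play]), hs₁.nat _ (by simp [Code.load]), hM]
  · refine ⟨_, h₄, fun i hi => ?_⟩
    rw [hs₄.nat _ (by simp [Code.inner])]
    have e1 := h₃.2 (i + i + 1) (by omega) (by omega)
    have e2 := h₃.2 (i + i + 2) (by omega) (by omega)
    rw [hs₂.real _ (by simp [Code.enter, Code.update, Code.play])] at e1 e2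
    exact ⟨e1.1, e1.2.trans (h₁ i hi).1, e2.1, e2.2.trans (h₁ i hi).2⟩
  · have : 1 ≤ 2 ^ L := Nat.one_le_two_pow
    nlinarith

theorem run_tabulate {L : ℕ} (hW : s.nat (nv .width) 0 = 2 ^ (L + 1))
    (hS : s.nat (nv (.shift k)) 0 = 0) (hB : s.nat (nv .base) 0 = (2 ^ (L + 1)) ^ k) :
    Run ω (Code.tabulate k) s (2 ^ (L + 1) * 30 + 20) fun s' =>
      s'.nat (nv .base) 0 = (2 ^ (L + 1)) ^ (k + 1) ∧
      ∀ i ≤ 2 ^ (L + 1), s'.nat (nv (.shift k)) i = i * (2 ^ (L + 1)) ^ k := by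
  refine Run.mono (Run.seq (Run.loop (N := 2 ^ (L + 1)) (T := fun _ => 15) (I := fun j s' =>
    ∀ i ≤ j, s'.nat (nv (.shift k)) i = i * (2 ^ (L + 1)) ^ k) (by simp) hW (by simp) (by simp)
    ?_ ?_ ?_) fun s₁ hs₁ h₁ => Run.setNat ?_) ?_
  · intro i hi
    obtain rfl : i = 0 := by omega
    simpa using hS
  · intro j s' x h
    rwa [State.nat_setNat_of_ne _ _ _ (by simp)]
  · intro j s' hs hj hi h
    have hB' : s'.nat (nv .base) 0 = (2 ^ (L + 1)) ^ k := by rw [hs.nat _ (by simp), hB]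
    refine Run.mono (Run.setNat ?_) (by simp)
    intro i hi'
    simp only [NExp.eval_get, NExp.eval_zero, NExp.eval_add, NExp.eval_one, hi, State.nat_setNat,
      true_and, hB', h j le_rfl]
    split_ifs with h1
    · rw [h1]; ring
    · exact h i (by omega)
  · have hW' : s₁.nat (nv .width) 0 = 2 ^ (L + 1) := by rw [hs₁.nat _ (by simp), hW]
    simp only [NExp.eval_get, NExp.eval_zero, hW', h₁ _ le_rfl, State.nat_setNat, nv_inj,
      reduceCtorEq, false_and, if_false, and_self, if_true]
    exact ⟨by ring, h₁⟩
  · simp; omega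

end Klee

/-! ### Sizes, covers, keys, and the collection of distinct items -/

namespace Klee
open RealRAM

variable {ω : Source} {d k : ℕ} {s : State}

theorem run_setup {n : ℕ} (hn : s.nat (nv .size) 0 = n) :
    Run ω Code.setup s (Nat.clog 2 (n + n + 2) * 30 + 50) fun s' =>
      s'.nat (nv .leaves) 0 = 2 ^ Nat.clog 2 (n + n + 2) ∧
      s'.nat (nv .depth) 0 = Nat.clog 2 (n + n + 2) + 1 ∧
      s'.nat (nv .ends) 0 = n + n ∧
      s'.nat (nv .leaves') 0 = 2 ^ Nat.clog 2 (n + n + 2) + 1 ∧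
      s'.nat (nv .width) 0 = 2 ^ (Nat.clog 2 (n + n + 2) + 1) := by
  refine Run.mono (Run.seq_setNat (Run.seq_setNat (Run.seq (Run.whileUp
    (N := Nat.clog 2 (n + n + 2)) (T := fun _ => 15) (I := fun j s' =>
      s'.nat (nv .leaves) 0 = 2 ^ j ∧ s'.nat (nv .depth) 0 = j + 1) ?_ ?_ ?_)
    fun s₁ hs₁ h₁ => Run.seq_setNat (Run.seq_setNat (Run.setNat ?_))))) ?_
  · simp
  · rintro j s' hs - ⟨h1, -⟩
    have hn' : s'.nat (nv .size) 0 = n := by rw [hs.nat _ (by simp)]; simpa using hn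
    simp only [BExp.holds_natLt, NExp.eval_get, NExp.eval_zero, NExp.eval_add, NExp.eval_two, h1, hn']
    rw [← not_le, ← not_le, Nat.clog_le_iff_le_pow (by norm_num)]
  · rintro j s' hs - ⟨h1, h2⟩
    refine Run.mono (Run.seq_setNat (Run.setNat ?_)) (by simp)
    simp [h1, h2, pow_succ]
    omega
  · have hn' : s₁.nat (nv .size) 0 = n := by rw [hs₁.nat _ (by simp)]; simpa using hn
    simp [hn', h₁.1, h₁.2, pow_succ]
    omega
  · simp; omega

/-- Throughout the loop, the stored list followed by the cover of the remaining range is the cover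
to be computed. The upper end is at most `2 ^ (L + 1) < 2 ^ (L + 2)`, which explains `L + 2` as the
bound for the number of rounds. -/
theorem run_cover {L r₁ r₂ i : ℕ} (hM : s.nat (nv .leaves) 0 = 2 ^ L) (hi : s.nat (nv .i) 0 = i)
    (h1 : s.nat (nv (.rank k)) (i + i + 1) = r₁) (h2 : s.nat (nv (.rank k)) (i + i + 2) = r₂)
    (hr₂ : r₂ ≤ 2 ^ L) :
    Run ω (Code.cover k) s ((L + 2) * 60 + 60) fun s' =>
      Stores s' (nv (.len k)) (nv (.cand k)) (cover (2 ^ L + r₁) (2 ^ L + r₂)) := by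
  refine Run.mono (Run.seq_setNat (Run.seq_setNat (Run.seq_setNat (Run.whileDown
    (N := L + 2) (T := 46) (I := fun r s' => s'.nat (nv .rb) 0 < 2 ^ r ∧
      ∃ l, Stores s' (nv (.len k)) (nv (.cand k)) l ∧
        l ++ cover (s'.nat (nv .ra) 0) (s'.nat (nv .rb) 0) =
          cover (2 ^ L + r₁) (2 ^ L + r₂)) ?_ ?_ ?_ ?_)))) ?_
  · have : 1 ≤ 2 ^ L := Nat.one_le_two_pow
    refine ⟨?_, [], ?_, ?_⟩
    · simp [hM, hi, h2, pow_succ]; omega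
    · simp [Stores]
    · simp [hM, hi, h1, h2]
  · rintro s' ⟨h, -⟩
    simp at h ⊢
    omega
  · rintro r s' hs ⟨h3, l, h4, h5⟩ hb
    simp only [BExp.holds_natLt, NExp.eval_get, NExp.eval_zero] at hb
    refine Run.mono (Run.seq_setNat (Run.seq_setNat (Run.seq_setNat (Run.seq_setNat
      (Run.setNat ?_))))) (by simp)
    refine ⟨?_, l ++ [s'.nat (nv .ra) 0, s'.nat (nv .rb) 0 - 1], ⟨?_, fun j hj => ?_⟩, ?_⟩
    · simp [pow_succ] at h3 ⊢
      omega
    · simp [h4.1]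
    · simp [h4.1] at hj ⊢
      rcases lt_or_ge j l.length with h | h
      · rw [if_neg (by omega), if_neg (by omega), h4.2 j h, List.getElem_append_left h]
      · rw [List.getElem_append_right h]
        obtain h | h : j = l.length ∨ j = l.length + 1 := by omega
        · simp [h]
        · simp [h]
    · rw [← h5, cover.eq_def (s'.nat (nv .ra) 0), if_pos hb]
      simp
  · rintro r s' hs ⟨h3, l, h4, h5⟩ hb
    simp only [BExp.holds_natLt, NExp.eval_get, NExp.eval_zero] at hb
    rw [cover, if_neg hb, List.append_nil] at h5
    rwa [← h5]
  · simp; omega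

/-- The key of a tuple: the number with the given digits in base `W`. -/
def keyOf (W d : ℕ) (τ : ℕ → ℕ) : ℕ := ∑ k ∈ Finset.range d, τ k * W ^ k

theorem keyOf_lt {W d : ℕ} {τ : ℕ → ℕ} (hτ : ∀ k < d, τ k < W) : keyOf W d τ < W ^ d := by
  induction d with
  | zero => simp [keyOf]
  | succ d ih =>
    have h1 := ih fun k hk => hτ k (by omega)
    have h2 : (τ d + 1) * W ^ d ≤ W * W ^ d := Nat.mul_le_mul_right _ (hτ d (by omega))
    rw [keyOf, Finset.sum_range_succ, pow_succ']
    rw [keyOf] at h1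
    linarith [add_one_mul (τ d) (W ^ d)]

/-- The quotient and the remainder modulo `W ^ d` recover the top digit and the remaining number. -/
theorem keyOf_inj {W d : ℕ} {τ σ : ℕ → ℕ} (hτ : ∀ k < d, τ k < W) (hσ : ∀ k < d, σ k < W)
    (h : keyOf W d τ = keyOf W d σ) : ∀ k < d, τ k = σ k := by
  induction d with
  | zero => omega
  | succ d ih =>
    have h1 := keyOf_lt fun k hk => hτ k (Nat.lt_succ_of_lt hk)
    have h2 := keyOf_lt fun k hk => hσ k (Nat.lt_succ_of_lt hk)
    have e1 : keyOf W (d + 1) τ = keyOf W d τ + W ^ d * τ d := by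
      rw [keyOf, Finset.sum_range_succ, mul_comm]; rfl
    have e2 : keyOf W (d + 1) σ = keyOf W d σ + W ^ d * σ d := by
      rw [keyOf, Finset.sum_range_succ, mul_comm]; rfl
    rw [e1, e2] at h
    have hmod := congrArg (· % W ^ d) h
    have hdiv := congrArg (· / W ^ d) h
    simp only [Nat.add_mul_mod_self_left, Nat.mod_eq_of_lt h1, Nat.mod_eq_of_lt h2] at hmod
    simp only [Nat.add_mul_div_left _ _ (pos_of_gt h1), Nat.div_eq_of_lt h1, Nat.div_eq_of_lt h2,
      zero_add] at hdiv
    intro k hk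
    rcases Nat.lt_succ_iff_lt_or_eq.1 hk with hk' | rfl
    · exact ih (fun k hk => hτ k (by omega)) (fun k hk => hσ k (by omega)) hmod k hk'
    · exact hdiv

/-- The tables of multiples of the powers of `W` have been built. -/
def HasShifts (W d : ℕ) (s : State) : Prop :=
  ∀ k < d, ∀ i ≤ W, s.nat (nv (.shift k)) i = i * W ^ k

theorem run_key {W : ℕ} {τ : ℕ → ℕ} (hS : HasShifts W d s) (hτ : ∀ k < d, s.nat (nv (.node k)) 0 = τ k)
    (hτW : ∀ k < d, τ k < W) :
    Run ω (Code.key d) s (d * 10 + 5) fun s' => s'.nat (nv .key) 0 = keyOf W d τ := by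
  refine Run.mono (Run.seq_setNat (Run.dims (T := 10) (I := fun k s' => s'.nat (nv .key) 0 = keyOf W k τ)
    ?_ ?_)) (T₁ := _) ?_
  · simp [keyOf]
  · intro k s' hs hk h
    refine Run.mono (Run.setNat ?_) (by simp)
    have h1 : s'.nat (nv (.node k)) 0 = τ k := by rw [hs.nat _ (by simp)]; simpa using hτ k hk
    have h2 : s'.nat (nv (.shift k)) (τ k) = τ k * W ^ k := by
      rw [hs.nat _ (by simp)]; simpa using hS k hk _ (hτW k hk).le
    simp only [NExp.eval_get, NExp.eval_zero, NExp.eval_add, h, h1, h2, State.nat_setNat, and_self,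
      if_true]
    rw [keyOf, keyOf, Finset.sum_range_succ]
  · simp; omega

/-- The volume of the box attached to a tuple of nodes. -/
def boxVol (d : ℕ) (left right : ℕ → ℕ → ℝ) (τ : ℕ → ℕ) : ℝ :=
  ∏ k ∈ Finset.range d, (right k (τ k) - left k (τ k))

/-- A tuple of `d` nodes. -/
def IsTuple (W d : ℕ) (τ : ℕ → ℕ) : Prop := (∀ k < d, τ k < W) ∧ ∀ k, d ≤ k → τ k = 0

theorem IsTuple.keyOf_inj {W d : ℕ} {τ σ : ℕ → ℕ} (hτ : IsTuple W d τ) (hσ : IsTuple W d σ) :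
    keyOf W d τ = keyOf W d σ ↔ τ = σ := by
  refine ⟨fun h => funext fun k => ?_, congrArg _⟩
  by_cases hk : k < d
  · exact Klee.keyOf_inj hτ.1 hσ.1 h k hk
  · rw [hτ.2 k (by omega), hσ.2 k (by omega)]

open Classical in
/-- The items collected so far are the tuples in the list `l`. -/
structure Items (W d : ℕ) (left right : ℕ → ℕ → ℝ) (l : List (ℕ → ℕ)) (s : State) : Prop where
  tuple : ∀ τ ∈ l, IsTuple W d τ
  nodup : l.Nodup
  size : s.nat (nv .m) 0 = l.length
  item : ∀ (j : ℕ) (hj : j < l.length), ∀ k < d, s.nat (nv (.item k)) j = l[j] k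
  mark : ∀ c, s.nat (nv .mark) c = if ∃ τ ∈ l, keyOf W d τ = c then 1 else 0
  vol : ∀ (j : ℕ) (hj : j < l.length), s.real (rv d .vol) j = boxVol d left right l[j]
  sum : s.real (rv d .sum) 0 = (l.map (boxVol d left right)).sum

theorem Items.congr {W : ℕ} {left right : ℕ → ℕ → ℝ} {l : List (ℕ → ℕ)} {s s' : State}
    (h : Items W d left right l s) (h1 : s'.nat (nv .m) = s.nat (nv .m))
    (h2 : ∀ k < d, s'.nat (nv (.item k)) = s.nat (nv (.item k)))
    (h3 : s'.nat (nv .mark) = s.nat (nv .mark)) (h4 : s'.real (rv d .vol) = s.real (rv d .vol))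
    (h5 : s'.real (rv d .sum) = s.real (rv d .sum)) : Items W d left right l s' :=
  ⟨h.tuple, h.nodup, by rw [h1, h.size], fun j hj k hk => by rw [h2 k hk, h.item j hj k hk],
    fun c => by rw [h3, h.mark], fun j hj => by rw [h4, h.vol j hj], by rw [h5, h.sum]⟩

/-- The new cell of `vol` serves as the accumulator of the product of the side lengths. -/
theorem run_append {W : ℕ} {τ : ℕ → ℕ} {left right : ℕ → ℕ → ℝ} {l : List (ℕ → ℕ)}
    (h : Items W d left right l s) (hτ : ∀ k < d, s.nat (nv (.node k)) 0 = τ k)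
    (hT : IsTuple W d τ) (hl : τ ∉ l) (hkey : s.nat (nv .key) 0 = keyOf W d τ)
    (hleft : ∀ k < d, s.real (rv d (.left k)) = left k)
    (hright : ∀ k < d, s.real (rv d (.right k)) = right k) :
    Run ω (Code.append d) s (d * 50 + 60) (Items W d left right (l ++ [τ])) := by
  refine Run.mono (Run.seq_setNat (Run.seq_setReal (Run.seq (Run.dims (T := 40) (I := fun r s' =>
    (∀ k < d, ∀ j, s'.nat (nv (.item k)) j =
      if k < r ∧ j = l.length then τ k else s.nat (nv (.item k)) j) ∧
    ∀ j, s'.real (rv d .vol) j = if j = l.length then boxVol r left right τ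
      else s.real (rv d .vol) j) ?_ ?_)
    fun s₁ hs₁ h₁ => Run.seq_setReal (Run.setNat ?_)))) ?_
  · refine ⟨fun k hk j => by simp, fun j => ?_⟩
    simp [h.size, boxVol]
  · rintro r s' hs hr ⟨h1, h2⟩
    have e1 : s'.nat (nv .m) 0 = l.length := by rw [hs.nat _ (by simp)]; simpa using h.size
    have e2 : s'.nat (nv (.node r)) 0 = τ r := by rw [hs.nat _ (by simp)]; simpa using hτ r hr
    have e3 : s'.real (rv d (.left r)) = left r := by
      rw [hs.real _ (by simp), State.real_setReal_of_ne _ _ _ (by simp)]; exact hleft r hr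
    have e4 : s'.real (rv d (.right r)) = right r := by
      rw [hs.real _ (by simp), State.real_setReal_of_ne _ _ _ (by simp)]; exact hright r hr
    refine Run.mono (Run.seq_setNat (Run.setReal ?_)) (by simp)
    refine ⟨fun k hk j => ?_, fun j => ?_⟩
    · simp [e1, e2, h1 k hk]
      grind
    · simp [e1, e2, e3, e4, h2]
      split_ifs
      · rw [boxVol, boxVol, Finset.prod_range_succ]
      · rfl
  · obtain ⟨h1, h2⟩ := h₁
    have e1 : s₁.nat (nv .m) 0 = l.length := by rw [hs₁.nat _ (by simp)]; simpa using h.size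
    have e2 : ∀ c, s₁.nat (nv .mark) c = if c = keyOf W d τ then 1 else s.nat (nv .mark) c := by
      intro c
      rw [hs₁.nat _ (by simp)]
      simp [hkey]
    have e3 : s₁.real (rv d .sum) 0 = s.real (rv d .sum) 0 := by rw [hs₁.real _ (by simp)]; simp
    refine ⟨?_, ?_, ?_, fun j hj k hk => ?_, fun c => ?_, fun j hj => ?_, ?_⟩
    · simp only [List.mem_append, List.mem_singleton]
      rintro σ (hσ | rfl)
      · exact h.tuple σ hσ
      · exact hT
    · exact List.nodup_append.2 ⟨h.nodup, by simp, by simpa using fun σ hσ => ne_of_mem_of_not_mem hσ hl⟩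
    · simp [e1]
    · simp [h1 k hk, hk]
      split_ifs with h3
      · simp [h3]
      · simp at hj
        rw [List.getElem_append_left (by omega), h.item j (by omega) k hk]
    · simp only [State.nat_setNat, State.nat_setReal, nv_inj, reduceCtorEq, false_and, if_false, e2,
        h.mark, List.mem_append, List.mem_singleton, or_and_right, exists_or, exists_eq_left]
      by_cases h3 : c = keyOf W d τ
      · simp [h3]
      · simp [h3, Ne.symm h3]
    · simp [h2]
      split_ifs with h3
      · simp [h3]
      · simp at hj
        rw [List.getElem_append_left (by omega), h.vol j (by omega)]
    · simp [e1, e3, h2, h.sum]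
  · simp; omega

theorem Stores.congr {s s' : State} {a b : ℕ} {l : List ℕ} (h : Stores s b a l)
    (h1 : s'.nat b = s.nat b) (h2 : s'.nat a = s.nat a) : Stores s' b a l := by
  rwa [Stores, h1, h2]

/-- Keys are injective on tuples, so the mark at the key of a tuple tells whether the tuple is an
item already. Hence the list stays free of repetitions, although different boxes, and even the cover
of one side, may produce the same node again. -/
theorem run_collect_box {W C : ℕ} {left right : ℕ → ℕ → ℝ} {its : List (ℕ → ℕ)} {ℓ : ℕ → List ℕ}
    (h : Items W d left right its s) (hS : HasShifts W d s)
    (hst : ∀ k < d, Stores s (nv (.len k)) (nv (.cand k)) (ℓ k)) (hC : ∀ k < d, (ℓ k).length ≤ C)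
    (hW : ∀ k < d, ∀ i ∈ ℓ k, i < W)
    (hleft : ∀ k < d, s.real (rv d (.left k)) = left k)
    (hright : ∀ k < d, s.real (rv d (.right k)) = right k) :
    Run ω (Code.nest d (.seq (Code.key d) (.ite (.natLt (nc .mark (nx .key)) 1)
      (Code.append d) .skip))) s ((C + 1) ^ d * (90 * d + 80)) fun s' =>
      ∃ its', Items W d left right its' s' ∧ its'.length ≤ its.length + C ^ d ∧
        ∀ τ, τ ∈ its' ↔ τ ∈ its ∨ τ ∈ prodList ℓ d 0 := by
  classical
  refine ((Run.nest (ω := ω) (Tb := d * 10 + 5 + (6 + (d * 50 + 60))) (C := C) (ℓ := ℓ)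
    (I := fun l s' => ∃ its', Items W d left right its' s' ∧ its'.length ≤ its.length + l.length ∧
        ∀ τ, τ ∈ its' ↔ τ ∈ its ∨ τ ∈ l) (fun a b hab => by simpa using hab)
    (fun a b hab => by simpa using hab) (by simp) (by simp) (by simp)
    (by simp [Code.key, Code.append]) hst hC ?_ ?_ ?_).mono ?_).post ?_
  · exact ⟨its, h, by simp, by simp⟩
  · rintro l s' k x ⟨its', h1, h2⟩
    exact ⟨⟨its', h1.congr (State.nat_setNat_of_ne _ _ _ (by simp))
      (fun j _ => State.nat_setNat_of_ne _ _ _ (by simp))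
      (State.nat_setNat_of_ne _ _ _ (by simp)) rfl rfl, h2⟩,
      ⟨its', h1.congr (State.nat_setNat_of_ne _ _ _ (by simp))
      (fun j _ => State.nat_setNat_of_ne _ _ _ (by simp))
      (State.nat_setNat_of_ne _ _ _ (by simp)) rfl rfl, h2⟩⟩
  · rintro l τ s' hs hτ hτℓ hτ0 ⟨its', h1, h2, h3⟩
    have hT : IsTuple W d τ := ⟨fun k hk => hW k hk _ (hτℓ k hk), hτ0⟩
    have hS' : HasShifts W d s' := fun k hk i hi => by
      rw [hs.nat _ (by simp [Code.key, Code.append])]; exact hS k hk i hi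
    refine (run_key hS' hτ hT.1).seq fun s₁ hs₁ hkey => ?_
    have h1' : Items W d left right its' s₁ := h1.congr (hs₁.nat _ (by simp [Code.key]))
      (fun j _ => hs₁.nat _ (by simp [Code.key])) (hs₁.nat _ (by simp [Code.key]))
      (hs₁.real _ (by simp [Code.key])) (hs₁.real _ (by simp [Code.key]))
    have hmark : s₁.nat (nv .mark) (keyOf W d τ) = if τ ∈ its' then 1 else 0 := by
      rw [h1'.mark]
      congr 1
      rw [eq_iff_iff]
      exact ⟨fun ⟨σ, h4, h5⟩ => (((h1.tuple σ h4).keyOf_inj hT).1 h5) ▸ h4, fun h4 => ⟨τ, h4, rfl⟩⟩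
    refine Run.mono (Run.ite (T := d * 50 + 60) (fun hb => ?_) (fun hb => ?_)) (by simp)
    · simp only [BExp.holds_natLt, NExp.eval_get, NExp.eval_zero, NExp.eval_one, hkey, hmark] at hb
      have hl : τ ∉ its' := fun h4 => by simp [h4] at hb
      refine (run_append h1' (fun k hk => ?_) hT hl hkey (fun k hk => ?_) (fun k hk => ?_)).post
        fun s₂ _ h4 => ⟨_, h4, ?_, fun σ => ?_⟩
      · rw [hs₁.nat _ (by simp [Code.key])]; exact hτ k hk
      · rw [hs₁.real _ (by simp [Code.key]), hs.real _ (by simp [Code.key, Code.append]), hleft k hk]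
      · rw [hs₁.real _ (by simp [Code.key]), hs.real _ (by simp [Code.key, Code.append]),
          hright k hk]
      · simp; omega
      · simp [h3]; tauto
    · simp only [BExp.holds_natLt, NExp.eval_get, NExp.eval_zero, NExp.eval_one, hkey, hmark] at hb
      have hl : τ ∈ its' := by
        by_contra h4
        simp [h4] at hb
      refine Run.mono (Run.skip ⟨its', h1', by simp; omega, fun σ => ?_⟩) (by omega)
      simp only [List.mem_append, List.mem_singleton, h3]
      have := (h3 τ).1 hl
      constructor
      · tauto
      · rintro (h4 | h4 | rfl) <;> tauto
  · exact Nat.mul_le_mul_left _ (by omega)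
  · rintro s' - ⟨its', h1, h2, h3⟩
    exact ⟨its', h1, h2.trans (by gcongr; exact length_prodList_le d hC 0), h3⟩

theorem run_collect {L n : ℕ} {left right : ℕ → ℕ → ℝ} (hM : s.nat (nv .leaves) 0 = 2 ^ L)
    (hn : s.nat (nv .size) 0 = n) (h : Items (2 ^ (L + 1)) d left right [] s)
    (hS : HasShifts (2 ^ (L + 1)) d s)
    (hr : ∀ k < d, ∀ i < n, s.nat (nv (.rank k)) (i + i + 2) ≤ 2 ^ L)
    (hleft : ∀ k < d, s.real (rv d (.left k)) = left k)
    (hright : ∀ k < d, s.real (rv d (.right k)) = right k) :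
    Run ω (Code.collect d) s (n * (d * ((L + 2) * 60 + 60) + 15 +
        (2 * (L + 2) + 1) ^ d * (90 * d + 80)) + 10) fun s' =>
      ∃ its, Items (2 ^ (L + 1)) d left right its s' ∧ its.length ≤ n * (2 * (L + 2)) ^ d ∧
        ∀ τ, τ ∈ its ↔ ∃ i < n, (∀ k < d, τ k ∈
          cover (2 ^ L + s.nat (nv (.rank k)) (i + i + 1))
            (2 ^ L + s.nat (nv (.rank k)) (i + i + 2))) ∧ ∀ k, d ≤ k → τ k = 0 := by
  refine (Run.loop (N := n) (T := fun _ => d * ((L + 2) * 60 + 60) + 1 +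
      (2 * (L + 2) + 1) ^ d * (90 * d + 80)) (I := fun j s' =>
      ∃ its, Items (2 ^ (L + 1)) d left right its s' ∧ its.length ≤ j * (2 * (L + 2)) ^ d ∧
        ∀ τ, τ ∈ its ↔ ∃ i < j, (∀ k < d, τ k ∈
          cover (2 ^ L + s.nat (nv (.rank k)) (i + i + 1))
            (2 ^ L + s.nat (nv (.rank k)) (i + i + 2))) ∧ ∀ k, d ≤ k → τ k = 0)
    (by simp) hn (by simp [Code.cover, Code.nest, Code.key, Code.append])
    (by simp [Code.cover, Code.nest, Code.key, Code.append]) ?_ ?_ ?_).mono ?_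
  · exact ⟨[], h, by simp, by simp⟩
  · rintro j s' x ⟨its, h1, h2⟩
    exact ⟨its, h1.congr (State.nat_setNat_of_ne _ _ _ (by simp))
      (fun j _ => State.nat_setNat_of_ne _ _ _ (by simp))
      (State.nat_setNat_of_ne _ _ _ (by simp)) rfl rfl, h2⟩
  · rintro j s' hs hj hi ⟨its, h1, h2, h3⟩
    have hrank : ∀ k, s'.nat (nv (.rank k)) = s.nat (nv (.rank k)) := fun k =>
      hs.nat _ (by simp [Code.cover, Code.nest, Code.key, Code.append])
    refine Run.seq (Run.dims (T := (L + 2) * 60 + 60) (I := fun r s₁ => ∀ k < r,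
      Stores s₁ (nv (.len k)) (nv (.cand k)) (cover (2 ^ L + s.nat (nv (.rank k)) (j + j + 1))
            (2 ^ L + s.nat (nv (.rank k)) (j + j + 2)))) (by simp) ?_) fun s₁ hs₁ hst => ?_
    · intro r s₁ hs₁ hrd h4
      refine (run_cover (L := L) (i := j) (r₁ := s.nat (nv (.rank r)) (j + j + 1))
        (r₂ := s.nat (nv (.rank r)) (j + j + 2)) ?_ ?_ ?_ ?_ (hr r hrd j hj)).post fun s₂ hs₂ h5 k hk => ?_
      · rw [hs₁.nat _ (by simp [Code.cover]),
          hs.nat _ (by simp [Code.cover, Code.nest, Code.key, Code.append]), hM]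
      · rw [hs₁.nat _ (by simp [Code.cover]), hi]
      · rw [hs₁.nat _ (by simp [Code.cover]), hrank]
      · rw [hs₁.nat _ (by simp [Code.cover]), hrank]
      · rcases Nat.lt_succ_iff_lt_or_eq.1 hk with hk' | rfl
        · exact Stores.congr (h4 k hk') (hs₂.nat _ (by simp [Code.cover]; omega))
            (hs₂.nat _ (by simp [Code.cover]; omega))
        · exact h5
    · have hbound : ∀ k < d, (cover (2 ^ L + s.nat (nv (.rank k)) (j + j + 1))
          (2 ^ L + s.nat (nv (.rank k)) (j + j + 2))).length ≤ 2 * (L + 2) := fun k hk => by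
        refine length_cover_le ?_ _
        have := hr k hk j hj
        have : 1 ≤ 2 ^ L := Nat.one_le_two_pow
        rw [pow_add]
        omega
      refine (run_collect_box (h1.congr (hs₁.nat _ (by simp [Code.cover]))
        (fun k _ => hs₁.nat _ (by simp [Code.cover])) (hs₁.nat _ (by simp [Code.cover]))
        (hs₁.real _ (by simp [Code.cover])) (hs₁.real _ (by simp [Code.cover])))
        (fun k hk i hi => ?_) hst hbound
        (fun k hk i hi => (DyadicTree.bounds_of_mem_cover (hr k hk j hj) hi).2)
        (fun k hk => ?_) (fun k hk => ?_)).post ?_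
      · rw [hs₁.nat _ (by simp [Code.cover]),
          hs.nat _ (by simp [Code.cover, Code.nest, Code.key, Code.append])]
        exact hS k hk i hi
      · rw [hs₁.real _ (by simp [Code.cover]),
          hs.real _ (by simp [Code.cover, Code.nest, Code.key, Code.append]), hleft k hk]
      · rw [hs₁.real _ (by simp [Code.cover]),
          hs.real _ (by simp [Code.cover, Code.nest, Code.key, Code.append]), hright k hk]
      · rintro s₂ - ⟨its', h4, h5, h6⟩
        refine ⟨its', h4, ?_, fun τ => ?_⟩
        · rw [add_one_mul]; omega
        · rw [h6, h3, mem_prodList]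
          simp only [Nat.lt_succ_iff_lt_or_eq, or_and_right, exists_or, exists_eq_left, Pi.zero_apply]
  · simp only [Finset.sum_const, Finset.card_range, smul_eq_mul]
    exact Nat.add_le_add (Nat.mul_le_mul_left n (by omega)) (by norm_num)

end Klee

/-! ### Correctness of the sampling phase -/

namespace Klee
open RealRAM

variable {ω : Source} {d k : ℕ} {s : State}

theorem run_descend {L j c : ℕ} {left right : ℕ → ℝ} (hW : s.nat (nv .width) 0 = 2 ^ (L + 1))
    (hi : s.nat (nv .i) 0 = j) (hitem : s.nat (nv (.item k)) j = c)
    (hleft : s.real (rv d (.left k)) = left) (hright : s.real (rv d (.right k)) = right) :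
    Run ω (Code.descend d k) s (L * 50 + 120) fun s' => s'.pos = s.pos + 1 ∧
      Stores s' (nv (.len k)) (nv (.cand k))
        (path L right (left c + ω s.pos * (right c - left c))) := by
  set y : ℝ := left c + ω s.pos * (right c - left c) with hy
  refine Run.mono (Run.seq_sample (Run.seq_setReal (Run.seq_setNat (Run.seq_setNat
    ((Run.whileUp (N := L + 1) (T := fun _ => 40) (I := fun t s' => s'.pos = s.pos + 1 ∧
      s'.nat (nv .ii) 0 = pathNode right y t ∧ s'.nat (nv (.len k)) 0 = t ∧
      ∀ r < t, s'.nat (nv (.cand k)) r = pathNode right y r) ?_ ?_ ?_).post ?_))))) ?_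
  · simp [pathNode]
  · rintro t s' hs ht ⟨-, h1, -⟩
    have hW' : s'.nat (nv .width) 0 = 2 ^ (L + 1) := by rw [hs.nat _ (by simp)]; simpa using hW
    simp only [BExp.holds_natLt, NExp.eval_get, NExp.eval_zero, h1, hW']
    obtain ⟨h2, h3⟩ := pathNode_bounds right y t
    constructor
    · intro h4
      exact (Nat.pow_lt_pow_iff_right (by norm_num)).1 (h2.trans_lt h4)
    · intro h4
      exact h3.trans_le (Nat.pow_le_pow_right (by norm_num) h4)
  · rintro t s' hs ht ⟨h0, h1, h2, h3⟩
    have hr : s'.real (rv d (.right k)) = right := by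
      rw [hs.real _ (by simp), ← hright]
      simp only [State.real_setNat]
      rw [State.real_setReal_of_ne _ _ _ (by simp), State.real_advance,
        State.real_setReal_of_ne _ _ _ (by simp)]
    have hy' : s'.real (rv d (.y k)) 0 = y := by
      rw [hs.real _ (by simp), hy]
      simp [hi, hitem, hleft, hright]
    have h3' : ∀ r < t + 1, (if r = t then pathNode right y t else s'.nat (nv (.cand k)) r) =
        pathNode right y r := by
      intro r hr
      split_ifs with h
      · rw [h]
      · exact h3 r (by omega)
    refine Run.mono (Run.seq_setNat (Run.seq_setNat (Run.ite (T := 12)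
      (fun hb => Run.mono (Run.setNat ?_) ?_) (fun hb => Run.mono (Run.setNat ?_) ?_)))) ?_
    · simp [h1, h2, hr, hy'] at hb
      simpa [h0, h1, h2, pathNode, hb] using h3'
    · simp
    · simp [h1, h2, hr, hy'] at hb
      simpa [h0, h1, h2, pathNode, not_lt.2 hb] using h3'
    · simp
    · simp
  · rintro s' - ⟨h0, -, h2, h3⟩
    refine ⟨h0, by simpa using h2, fun r hr => ?_⟩
    rw [h3 r (by simpa using hr)]
    simp [path]
  · simp; omega

open Classical in
/-- The number of tuples in `A` all of whose nodes lie on the search paths for `y`. -/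
noncomputable def hits (L d : ℕ) (right : ℕ → ℕ → ℝ) (A : Finset (ℕ → ℕ)) (y : ℕ → ℝ) : ℕ :=
  (A.filter fun τ => ∀ k < d, τ k ∈ path L (right k) (y k)).card

/-- The point of the box of the tuple `τ` with the relative coordinates `u`. -/
def boxPoint (left right : ℕ → ℕ → ℝ) (τ : ℕ → ℕ) (u : ℕ → ℝ) (k : ℕ) : ℝ :=
  left k (τ k) + u k * (right k (τ k) - left k (τ k))

/-- Adding up marks over all tuples on the search paths counts the items among them; this turns the
loop's total into `hits`. -/
theorem sum_map_indicator {α : Type*} [DecidableEq α] {l P : List α} (hP : P.Nodup) :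
    (P.map fun τ => if τ ∈ l then 1 else 0).sum = (l.toFinset.filter (· ∈ P)).card := by
  rw [← List.sum_toFinset _ hP, Finset.sum_ite, Finset.sum_const_zero, add_zero, Finset.sum_const,
    smul_eq_mul, mul_one]
  congr 1
  ext τ
  simp [and_comm]

open Classical in
-- The cost depends on the number of tuples on the search paths and not on the number of items. A
-- trial draws exactly `d` random numbers, so its point is determined by its position in the source.
theorem run_trial {L j : ℕ} {left right : ℕ → ℕ → ℝ} {its : List (ℕ → ℕ)}
    (h : Items (2 ^ (L + 1)) d left right its s) (hS : HasShifts (2 ^ (L + 1)) d s)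
    (hW : s.nat (nv .width) 0 = 2 ^ (L + 1)) (hi : s.nat (nv .i) 0 = j) (hj : j < its.length)
    (hleft : ∀ k < d, s.real (rv d (.left k)) = left k)
    (hright : ∀ k < d, s.real (rv d (.right k)) = right k) :
    Run ω (Code.trial d) s (d * (L * 50 + 120) + (L + 2) ^ d * (40 * d + 20) + 20) fun s' =>
      s'.pos = s.pos + d ∧ s'.real (rv d .acc) 0 = s.real (rv d .acc) 0 +
        1 / (hits L d right its.toFinset
          (boxPoint left right its[j] fun k => ω (s.pos + k)) : ℝ) := by
  set y := boxPoint left right its[j] fun k => ω (s.pos + k) with hy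
  refine Run.mono (Run.seq (Run.dims (T := L * 50 + 120) (I := fun r s' => s'.pos = s.pos + r ∧
    ∀ k < r, Stores s' (nv (.len k)) (nv (.cand k)) (path L (right k) (y k))) (by simp) ?_)
    fun s₁ hs₁ h₁ => Run.seq_setNat (Run.seq (Run.nest (Tb := d * 10 + 5 + 10) (C := L + 1)
      (ℓ := fun k => path L (right k) (y k)) (I := fun l s' => s'.nat (nv .tot) 0 =
        (l.map fun τ => s.nat (nv .mark) (keyOf (2 ^ (L + 1)) d τ)).sum)
      (fun a b hab => by simpa using hab)
      (fun a b hab => by simpa using hab) (by simp) (by simp) (by simp)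
      (by simp [Code.key]) (fun k hk => ?_) (by simp) ?_ ?_ ?_)
      fun s₂ hs₂ h₂ => Run.setReal ?_)) ?_
  · rintro r s' hs hr ⟨h1, h2⟩
    have hlen : s'.nat (nv (.item r)) = s.nat (nv (.item r)) := hs.nat _ (by simp [Code.descend])
    refine (run_descend (j := j) (c := its[j] r) (left := left r) (right := right r) ?_ ?_ ?_ ?_
      ?_).post fun s₁ hs₁ h3 => ⟨by rw [h3.1, h1]; ring, fun k hk => ?_⟩
    · rw [hs.nat _ (by simp [Code.descend]), hW]
    · rw [hs.nat _ (by simp [Code.descend]), hi]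
    · rw [hlen, h.item j hj r hr]
    · rw [hs.real _ (by simp [Code.descend]), hleft r hr]
    · rw [hs.real _ (by simp [Code.descend]), hright r hr]
    · rcases Nat.lt_succ_iff_lt_or_eq.1 hk with hk' | rfl
      · exact Stores.congr (h2 k hk') (hs₁.nat _ (by simp [Code.descend]; omega))
          (hs₁.nat _ (by simp [Code.descend]; omega))
      · simpa [hy, boxPoint, h1] using h3.2
  · exact Stores.congr (h₁.2 k hk) (State.nat_setNat_of_ne _ _ _ (by simp))
      (State.nat_setNat_of_ne _ _ _ (by simp))
  · simp
  · intro l s' k x h1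
    simpa using h1
  · intro l τ s' hs h1 h2 h3 h4
    have hmark : s'.nat (nv .mark) = s.nat (nv .mark) := by
      rw [hs.nat _ (by simp [Code.key]), State.nat_setNat_of_ne _ _ _ (by simp),
        hs₁.nat _ (by simp [Code.descend])]
    refine Run.seq (run_key (W := 2 ^ (L + 1)) (τ := τ) (fun k hk i hi => ?_) h1 (fun k hk => ?_))
      fun s₂ hs₂ h5 => Run.mono (Run.setNat ?_) (by simp)
    · rw [hs.nat _ (by simp [Code.key]), State.nat_setNat_of_ne _ _ _ (by simp),
        hs₁.nat _ (by simp [Code.descend])]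
      exact hS k hk i hi
    · obtain ⟨t, ht, h6⟩ := List.mem_map.1 (h2 k hk)
      rw [← h6]
      exact (pathNode_bounds _ _ _).2.trans_le
        (Nat.pow_le_pow_right (by norm_num) (by simpa using ht))
    · have h6 : s₂.nat (nv .tot) 0 = s'.nat (nv .tot) 0 := by rw [hs₂.nat _ (by simp [Code.key])]
      have h7 : s₂.nat (nv .mark) = s'.nat (nv .mark) := by rw [hs₂.nat _ (by simp [Code.key])]
      simp [h5, h6, h7, h4, hmark]
  · have hpos : s₂.pos = s.pos + d := by
      rw [hs₂.pos (by simp [Code.nest, Code.key]), State.pos_setNat, h₁.1]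
    have hacc : s₂.real (rv d .acc) 0 = s.real (rv d .acc) 0 := by
      rw [hs₂.real _ (by simp [Code.nest, Code.key]), State.real_setNat,
        hs₁.real _ (by simp [Code.descend])]
    have htot : s₂.nat (nv .tot) 0 = hits L d right its.toFinset y := by
      rw [h₂]
      have h6 : (prodList (fun k => path L (right k) (y k)) d 0).map
          (fun τ => s.nat (nv .mark) (keyOf (2 ^ (L + 1)) d τ)) =
          (prodList (fun k => path L (right k) (y k)) d 0).map fun τ => if τ ∈ its then 1 else 0 := by
        refine List.map_congr_left fun τ hτ => ?_
        obtain ⟨h7, h8⟩ := mem_prodList.1 hτ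
        have hT : IsTuple (2 ^ (L + 1)) d τ := by
          refine ⟨fun k hk => ?_, fun k hk => h8 k hk⟩
          obtain ⟨t, ht, h9⟩ := List.mem_map.1 (h7 k hk)
          rw [← h9]
          exact (pathNode_bounds _ _ _).2.trans_le
            (Nat.pow_le_pow_right (by norm_num) (by simpa using ht))
        rw [h.mark]
        congr 1
        rw [eq_iff_iff]
        exact ⟨fun ⟨σ, h4, h5⟩ => (((h.tuple σ h4).keyOf_inj hT).1 h5) ▸ h4, fun h4 => ⟨τ, h4, rfl⟩⟩
      rw [h6, sum_map_indicator (nodup_prodList (fun k => nodup_path _ _ _) _ _), hits]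
      congr 1
      refine Finset.filter_congr fun τ hτ => ?_
      rw [mem_prodList]
      exact and_iff_left fun k hk => (h.tuple τ (by simpa using hτ)).2 k hk
    simp [hpos, hacc, htot]
  · have : (L + 1 + 1) ^ d * (d * 10 + 5 + 10 + 30 * d) ≤ (L + 2) ^ d * (40 * d + 20) :=
      Nat.mul_le_mul_left _ (by omega)
    simp
    omega

theorem run_factor {ε : ℝ} {r : ℕ} (hε : s.real 0 0 = ε) (hr : s.nat (nv .depth) 0 = r) :
    Run ω (Code.factor d) s (d * 10 + 40) fun s' =>
      s'.real (rv d .fac) 0 = 10 * ((1 + ε) / ε) ^ 2 * r ^ d := by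
  have e0 := ne_rv (d := d) (a := 0) (by omega)
  refine Run.mono (Run.seq_setReal (Run.dims (T := 10) (I := fun k s' =>
    s'.real (rv d .fac) 0 = 10 * ((1 + ε) / ε) ^ 2 * r ^ k) ?_ ?_)) ?_
  · simp [hε, sq]; ring
  · intro k s' hs hk h
    have hr' : s'.nat (nv .depth) 0 = r := by rw [hs.nat _ (by simp)]; simpa using hr
    refine Run.mono (Run.setReal ?_) (by simp)
    simp [h, hr', pow_succ]
    ring
  · simp; omega

open Classical in
-- The hypothesis `hN` says that the test of the sampling loop stops it after exactly `N j` trials.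
-- Every trial uses `d` random numbers, so trial `c` of item `j` starts at position `d * (∑ i ∈
-- Finset.range j, N i + c)`.
theorem run_estimate {L : ℕ} {left right : ℕ → ℕ → ℝ} {its : List (ℕ → ℕ)} {N : ℕ → ℕ}
    (h : Items (2 ^ (L + 1)) d left right its s) (hS : HasShifts (2 ^ (L + 1)) d s)
    (hW : s.nat (nv .width) 0 = 2 ^ (L + 1))
    (hleft : ∀ k < d, s.real (rv d (.left k)) = left k)
    (hright : ∀ k < d, s.real (rv d (.right k)) = right k)
    (hpos : s.pos = 0) (hout : s.real (rv d .out) 0 = 0)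
    (hN : ∀ (j : ℕ) (hj : j < its.length) (c : ℕ), (c : ℝ) * (its.map (boxVol d left right)).sum <
      s.real (rv d .fac) 0 * boxVol d left right its[j] ↔ c < N j) :
    Run ω (Code.estimate d) s (∑ j ∈ Finset.range its.length, (N j *
        (d * (L * 50 + 120) + (L + 2) ^ d * (40 * d + 20) + 50) + 70) + 10) fun s' =>
      s'.real (rv d .out) 0 = ∑ j : Fin its.length, boxVol d left right its[j] *
        (∑ c ∈ Finset.range (N j), 1 / (hits L d right its.toFinset (boxPoint left right its[j]
          fun k => ω (d * (∑ i ∈ Finset.range j, N i + c) + k)) : ℝ)) / N j := by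
  set f : ℕ → ℕ → ℝ := fun j c => if hj : j < its.length then
    1 / (hits L d right its.toFinset (boxPoint left right its[j]
          fun k => ω (d * (∑ i ∈ Finset.range j, N i + c) + k)) : ℝ) else 0 with hf
  set g : ℕ → ℝ := fun j => if hj : j < its.length then boxVol d left right its[j] *
        (∑ c ∈ Finset.range (N j), f j c) / N j else 0 with hg
  refine ((Run.loop (N := its.length) (T := fun j => N j *
        (d * (L * 50 + 120) + (L + 2) ^ d * (40 * d + 20) + 50) + 58) (I := fun j s' =>
      s'.pos = d * ∑ i ∈ Finset.range j, N i ∧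
      s'.real (rv d .out) 0 = ∑ i ∈ Finset.range j, g i) (by simp) h.size
    (by simp [Code.trial, Code.descend, Code.nest, Code.key])
    (by simp [Code.trial, Code.descend, Code.nest, Code.key]) ?_ ?_ ?_).mono ?_).post ?_
  · simp [hpos, hout]
  · intro j s' x h1
    simpa using h1
  · rintro j s' hs hj hi ⟨h1, h2⟩
    have hnat : ∀ a, (a = .width ∨ a = .m ∨ a = .mark ∨ ∃ k, a = .shift k ∨ a = .item k) →
        s'.nat (nv a) = s.nat (nv a) := by
      rintro a (rfl | rfl | rfl | ⟨k, rfl | rfl⟩) <;>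
      exact hs.nat _ (by simp [Code.trial, Code.descend, Code.nest, Code.key])
    have hreal : ∀ a, (a = .vol ∨ a = .sum ∨ a = .fac ∨ ∃ k, a = .left k ∨ a = .right k) →
        s'.real (rv d a) = s.real (rv d a) := by
      rintro a (rfl | rfl | rfl | ⟨k, rfl | rfl⟩) <;>
      exact hs.real _ (by simp [Code.trial, Code.descend, Code.nest, Code.key])
    refine Run.mono (Run.seq_setNat (Run.seq_setReal (Run.seq (Run.whileUp (N := N j)
      (T := fun _ => d * (L * 50 + 120) + (L + 2) ^ d * (40 * d + 20) + 30)
      (I := fun c s₁ => s₁.nat (nv .cnt) 0 = c ∧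
        s₁.pos = d * (∑ i ∈ Finset.range j, N i + c) ∧
        s₁.real (rv d .acc) 0 = ∑ c' ∈ Finset.range c, f j c') ?_ ?_ ?_)
        fun s₁ hs₁ h3 => Run.setReal ?_))) ?_
    · simp [h1]
    · rintro c s₁ hs₁ - ⟨h3, -⟩
      have e1 : s₁.real (rv d .sum) 0 = s'.real (rv d .sum) 0 := by
        rw [hs₁.real _ (by simp [Code.trial, Code.descend, Code.nest, Code.key])]; simp
      have e2 : s₁.real (rv d .vol) j = s'.real (rv d .vol) j := by
        rw [hs₁.real _ (by simp [Code.trial, Code.descend, Code.nest, Code.key])]; simp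
      have e3 : s₁.real (rv d .fac) 0 = s'.real (rv d .fac) 0 := by
        rw [hs₁.real _ (by simp [Code.trial, Code.descend, Code.nest, Code.key])]; simp
      have e4 : s₁.nat (nv .i) 0 = j := by
        rw [hs₁.nat _ (by simp [Code.trial, Code.descend, Code.nest, Code.key])]; simpa using hi
      rw [hreal .sum (by simp), h.sum] at e1
      rw [hreal .vol (by simp), h.vol j hj] at e2
      rw [hreal .fac (by simp)] at e3
      simp only [BExp.holds_realLt, RExp.eval_mul, RExp.eval_ofNat, RExp.eval_get, NExp.eval_get,
        NExp.eval_zero, e1, e2, e3, e4, h3]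
      exact hN j hj c
    · rintro c s₁ hs₁ hc ⟨h3, h4, h5⟩
      have hnat₁ : ∀ a, (a = .width ∨ a = .m ∨ a = .mark ∨ ∃ k, a = .shift k ∨ a = .item k) →
          s₁.nat (nv a) = s.nat (nv a) := by
        rintro a ha
        rw [← hnat a ha]
        rcases ha with rfl | rfl | rfl | ⟨k, rfl | rfl⟩ <;>
        · rw [hs₁.nat _ (by simp [Code.trial, Code.descend, Code.nest, Code.key]), State.nat_setReal,
            State.nat_setNat_of_ne _ _ _ (by simp)]
      have hreal₁ : ∀ a, (a = .vol ∨ a = .sum ∨ a = .fac ∨ ∃ k, a = .left k ∨ a = .right k) →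
          s₁.real (rv d a) = s.real (rv d a) := by
        rintro a ha
        rw [← hreal a ha]
        rcases ha with rfl | rfl | rfl | ⟨k, rfl | rfl⟩ <;>
        · rw [hs₁.real _ (by simp [Code.trial, Code.descend, Code.nest, Code.key]),
            State.real_setReal_of_ne _ _ _ (by simp), State.real_setNat]
      refine Run.seq (T₂ := 6) (run_trial (L := L) (j := j) (left := left) (right := right) (its := its)
        (h.congr (hnat₁ _ (by simp)) (fun k _ => hnat₁ _ (by simp)) (hnat₁ _ (by simp))
          (hreal₁ _ (by simp)) (hreal₁ _ (by simp))) ?_ ?_ ?_ hj ?_ ?_)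
        (fun s₂ hs₂ h6 => Run.mono (Run.setNat ?_) (by simp)) |>.mono (by omega)
      · intro k hk i hi
        rw [hnat₁ _ (by simp)]
        exact hS k hk i hi
      · rw [hnat₁ _ (by simp), hW]
      · rw [hs₁.nat _ (by simp [Code.trial, Code.descend, Code.nest, Code.key])]; simpa using hi
      · intro k hk
        rw [hreal₁ _ (by simp), hleft k hk]
      · intro k hk
        rw [hreal₁ _ (by simp), hright k hk]
      · have h7 : s₂.nat (nv .cnt) 0 = c := by
          rw [hs₂.nat _ (by simp [Code.trial, Code.descend, Code.nest, Code.key]), h3]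
        refine ⟨by simp [h7], ?_, ?_⟩
        · rw [State.pos_setNat, h6.1, h4]; ring
        · rw [State.real_setNat, h6.2, h5, Finset.sum_range_succ]
          simp [hf, hj, h4]
    · obtain ⟨h3, h4, h5⟩ := h3
      have e1 : s₁.real (rv d .out) 0 = s'.real (rv d .out) 0 := by
        rw [hs₁.real _ (by simp [Code.trial, Code.descend, Code.nest, Code.key])]; simp
      have e2 : s₁.real (rv d .vol) j = s'.real (rv d .vol) j := by
        rw [hs₁.real _ (by simp [Code.trial, Code.descend, Code.nest, Code.key])]; simp
      have e4 : s₁.nat (nv .i) 0 = j := by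
        rw [hs₁.nat _ (by simp [Code.trial, Code.descend, Code.nest, Code.key])]; simpa using hi
      rw [hreal .vol (by simp), h.vol j hj] at e2
      refine ⟨?_, ?_⟩
      · rw [State.pos_setReal, h4, Finset.sum_range_succ]
      · simp only [RExp.eval_add, RExp.eval_get, NExp.eval_zero, RExp.eval_div, RExp.eval_mul,
          RExp.eval_ofNat, NExp.eval_get, State.real_setReal, and_self, if_true, e1, e2, e4, h3, h5,
          h2, Finset.sum_range_succ]
        simp only [hg, hj, dif_pos]
    · simp
      generalize d * (L * 50 + 120) + (L + 2) ^ d * (40 * d + 20) = X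
      nlinarith
  · simp [add_assoc]
  · rintro s' - ⟨-, h2⟩
    rw [h2, Finset.sum_range]
    simp [hg, hf]

end Klee

/-! ### Independent blocks, Chebyshev's inequality, uniform points of boxes -/

namespace Klee
open RealRAM MeasureTheory ProbabilityTheory

instance : IsProbabilityMeasure sourceLaw := by unfold sourceLaw; infer_instance

/-- The `q`-th block of `d` random numbers. -/
def block (d q : ℕ) (ω : Source) (k : Fin d) : unitInterval := ω (d * q + k)

theorem measurable_block (d q : ℕ) : Measurable (block d q) :=
  measurable_pi_iff.2 fun _ => measurable_pi_apply _

theorem iIndepFun_source : iIndepFun (fun (i : ℕ) (ω : Source) => ω i) sourceLaw :=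
  iIndepFun_infinitePi (X := fun _ x => x) fun _ => measurable_id

theorem map_block (d q : ℕ) :
    sourceLaw.map (block d q) = Measure.pi fun _ : Fin d => (volume : Measure unitInterval) := by
  have h := iIndepFun_source.precomp (g := fun k : Fin d => d * q + (k : ℕ))
    fun a b hab => Fin.ext (by simpa using hab)
  have h2 := (iIndepFun_iff_map_fun_eq_pi_map fun k => (measurable_pi_apply _).aemeasurable).1 h
  refine h2.trans ?_
  congr 1
  funext k
  exact Measure.infinitePi_map_eval (fun _ : ℕ => (volume : Measure unitInterval)) _

/-- Different blocks occupy disjoint sets of positions, as the quotient by `d` shows. -/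
theorem indepFun_block {d p q : ℕ} (hpq : p ≠ q) : IndepFun (block d p) (block d q) sourceLaw := by
  let S : ℕ → Finset ℕ := fun r => Finset.univ.image fun k : Fin d => d * r + (k : ℕ)
  have hdisj : Disjoint (S p) (S q) := by
    rw [Finset.disjoint_left]
    intro i hp hq
    simp only [S, Finset.mem_image, Finset.mem_univ, true_and] at hp hq
    obtain ⟨a, rfl⟩ := hp
    obtain ⟨b, hb⟩ := hq
    have hd : 0 < d := a.pos
    have h1 := congrArg (· / d) hb
    simp only [Nat.mul_add_div hd, Nat.div_eq_of_lt a.2, Nat.div_eq_of_lt b.2] at h1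
    omega
  have h := iIndepFun_source.indepFun_finset (S p) (S q) hdisj fun i => measurable_pi_apply i
  have hm : ∀ r, ∀ k : Fin d, d * r + (k : ℕ) ∈ S r := fun r k => Finset.mem_image.2 ⟨k, by simp⟩
  exact h.comp (φ := fun x k => x ⟨_, hm p k⟩) (ψ := fun x k => x ⟨_, hm q k⟩)
    (measurable_pi_iff.2 fun k => measurable_pi_apply _)
    (measurable_pi_iff.2 fun k => measurable_pi_apply _)

/-- The average of `N j` samples of `g j`, weighted with `a j`, the samples being computed from
disjoint blocks of random numbers. -/
noncomputable def weightedAverages {m : ℕ} (d : ℕ) (N : ℕ → ℕ) (a : Fin m → ℝ)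
    (g : Fin m → (Fin d → unitInterval) → ℝ) (ω : Source) : ℝ :=
  ∑ j, a j * (∑ c ∈ Finset.range (N j), g j (block d (∑ i ∈ Finset.range j, N i + c) ω)) / N j

/-- Chebyshev's inequality for `weightedAverages`. -/
theorem weightedAverages_deviation {d m : ℕ} {N : ℕ → ℕ} {a : Fin m → ℝ}
    {g : Fin m → (Fin d → unitInterval) → ℝ} {R V t : ℝ} (hg : ∀ j, Measurable (g j))
    (hg0 : ∀ j u, 0 ≤ g j u) (hg1 : ∀ j u, g j u ≤ 1) (ha : ∀ j, 0 ≤ a j)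
    (hN : ∀ j, a j ≤ R * N j)
    (hV : ∑ j, a j * ∫ u, g j u ∂(Measure.pi fun _ => volume) = V) (ht : 0 < t)
    (hR : R * V ≤ t ^ 2 / 10) :
    sourceLaw {ω | t ≤ |weightedAverages d N a g ω - V|} ≤ 1 / 10 := by
  let D : Finset (Σ _ : Fin m, ℕ) := Finset.univ.sigma fun j => Finset.range (N j)
  let q : (Σ _ : Fin m, ℕ) → ℕ := fun x => ∑ i ∈ Finset.range x.1, N i + x.2
  let Z : (Σ _ : Fin m, ℕ) → Source → ℝ := fun x ω => a x.1 / N x.1 * g x.1 (block d (q x) ω)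
  have hmono : Monotone fun r => ∑ i ∈ Finset.range r, N i :=
    monotone_nat_of_le_succ fun r => by rw [Finset.sum_range_succ]; omega
  -- Trials are numbered consecutively through all items, so no two of them share a block.
  have hq : ∀ x ∈ D, ∀ y ∈ D, x ≠ y → q x ≠ q y := by
    rintro ⟨j, c⟩ hx ⟨j', c'⟩ hy hxy hqq
    simp only [D, Finset.mem_sigma, Finset.mem_univ, true_and, Finset.mem_range] at hx hy
    simp only [q] at hqq
    rcases lt_trichotomy j j' with h | rfl | h
    · have := hmono (show (j : ℕ) + 1 ≤ j' from h)
      simp only [Finset.sum_range_succ] at this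
      omega
    · simp at hxy hqq; omega
    · have := hmono (show (j' : ℕ) + 1 ≤ j from h)
      simp only [Finset.sum_range_succ] at this
      omega
  have hsum : weightedAverages d N a g = ∑ x ∈ D, Z x := by
    funext ω
    simp only [weightedAverages, D, Finset.sum_apply, Finset.sum_sigma, Z, q]
    refine Finset.sum_congr rfl fun j _ => ?_
    rw [← Finset.mul_sum]
    ring
  have hgb : ∀ j r, MemLp (fun ω => g j (block d r ω)) 2 sourceLaw := fun j r =>
    MemLp.of_bound ((hg j).comp (measurable_block d r)).aestronglyMeasurable 1
      (.of_forall fun ω => by rw [Real.norm_of_nonneg (hg0 _ _)]; exact hg1 _ _)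
  have hZ : ∀ x, MemLp (Z x) 2 sourceLaw := fun x => (hgb x.1 (q x)).const_mul _
  have hint : ∀ j r, ∫ ω, g j (block d r ω) ∂sourceLaw =
      ∫ u, g j u ∂(Measure.pi fun _ => volume) := fun j r => by
    rw [← map_block d r]
    exact (integral_map (measurable_block d r).aemeasurable (hg j).aestronglyMeasurable).symm
  have hmean : ∫ ω, weightedAverages d N a g ω ∂sourceLaw = V := by
    rw [hsum]
    simp only [Finset.sum_apply]
    rw [integral_finsetSum _ fun x _ => (hZ x).integrable (by norm_num), ← hV, Finset.sum_sigma]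
    refine Finset.sum_congr rfl fun j _ => ?_
    simp only [Z, integral_const_mul, hint, Finset.sum_const, Finset.card_range, nsmul_eq_mul]
    -- An item without samples has weight zero by `hN`, so omitting it causes no bias.
    by_cases h0 : (N j : ℝ) = 0
    · have h1 := hN j
      rw [h0, mul_zero] at h1
      rw [le_antisymm h1 (ha j)]
      simp
    · field_simp
  have hvar : Var[weightedAverages d N a g; sourceLaw] ≤ R * V := by
    -- The variance of a sum is additive already under pairwise independence.
    rw [hsum, IndepFun.variance_sum fun x _ => hZ x]
    · rw [← hV, Finset.mul_sum, Finset.sum_sigma]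
      refine Finset.sum_le_sum fun j _ => ?_
      have hI : 0 ≤ ∫ u, g j u ∂(Measure.pi fun _ => (volume : Measure unitInterval)) :=
        integral_nonneg (hg0 j)
      have h1 : ∀ c ∈ Finset.range (N j), Var[Z ⟨j, c⟩; sourceLaw] ≤
          (a j / N j) ^ 2 * ∫ u, g j u ∂(Measure.pi fun _ => volume) := by
        intro c _
        simp only [Z]
        rw [variance_const_mul]
        refine mul_le_mul_of_nonneg_left ?_ (sq_nonneg _)
        refine (variance_le_expectation_sq (hgb j _).1).trans ?_
        rw [← hint j (q ⟨j, c⟩)]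
        refine integral_mono (hgb j _).integrable_sq ((hgb j _).integrable (by norm_num)) fun ω => ?_
        have h2 := hg0 j (block d (q ⟨j, c⟩) ω)
        have h3 := hg1 j (block d (q ⟨j, c⟩) ω)
        -- As `g` has values in `[0,1]`, `g ^ 2 ≤ g`: the second moment is at most the mean. This
        -- makes the variance linear in `V`.
        simp only [Pi.pow_apply]
        nlinarith
      refine (Finset.sum_le_sum h1).trans ?_
      rw [Finset.sum_const, Finset.card_range, nsmul_eq_mul, ← mul_assoc, ← mul_assoc]
      refine mul_le_mul_of_nonneg_right ?_ hI
      by_cases h0 : (N j : ℝ) = 0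
      · have h4 := hN j
        rw [h0, mul_zero] at h4
        rw [h0, le_antisymm h4 (ha j)]
        simp
      · have hpos : (0 : ℝ) < N j := lt_of_le_of_ne (Nat.cast_nonneg _) (Ne.symm h0)
        have h5 : (N j : ℝ) * (a j / N j) ^ 2 = a j * (a j / N j) := by field_simp
        rw [h5, mul_comm R]
        exact mul_le_mul_of_nonneg_left ((div_le_iff₀ hpos).2 (hN j)) (ha j)
    · intro x hx y hy hxy
      exact (indepFun_block (hq x hx y hy hxy)).comp ((hg x.1).const_mul _) ((hg y.1).const_mul _)
  have hmem : MemLp (weightedAverages d N a g) 2 sourceLaw := by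
    rw [hsum]
    exact memLp_finsetSum' _ fun x _ => hZ x
  have := meas_ge_le_variance_div_sq hmem ht
  rw [hmean] at this
  refine this.trans ?_
  rw [show (1 : ENNReal) / 10 = ENNReal.ofReal (1 / 10) by
    rw [ENNReal.ofReal_div_of_pos (by norm_num)]; simp]
  refine ENNReal.ofReal_le_ofReal ?_
  rw [div_le_iff₀ (by positivity)]
  linarith

/-- Scaling the uniform law by the length, instead of normalizing Lebesgue measure on the interval,
keeps degenerate intervals in the statement: for length zero both sides vanish. -/
theorem smul_map_affine (l : ℝ) {a : ℝ} (ha : 0 ≤ a) :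
    ENNReal.ofReal a • (volume : Measure unitInterval).map (fun u : unitInterval => l + (u : ℝ) * a) =
      volume.restrict (Set.Icc l (l + a)) := by
  rcases ha.eq_or_lt with rfl | ha
  · simp
  have h1 : (volume : Measure unitInterval).map (fun u : unitInterval => l + (u : ℝ) * a) =
      (volume.restrict (Set.Icc (0 : ℝ) 1)).map fun x => l + x * a := by
    rw [← unitInterval.measurePreserving_coe.map_eq, Measure.map_map (by fun_prop) (by fun_prop)]
    rfl
  have hemb : MeasurableEmbedding fun x : ℝ => l + x * a :=
    (measurableEmbedding_addLeft l).comp (measurableEmbedding_mulRight₀ ha.ne')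
  have hpre : (fun x : ℝ => l + x * a) ⁻¹' Set.Icc l (l + a) = Set.Icc 0 1 := by
    ext x
    simp only [Set.mem_preimage, Set.mem_Icc]
    constructor
    · rintro ⟨h2, h3⟩
      constructor <;> nlinarith
    · rintro ⟨h2, h3⟩
      constructor <;> nlinarith
  have hmap : ENNReal.ofReal a • (volume : Measure ℝ).map (fun x => l + x * a) = volume := by
    have h2 : (volume : Measure ℝ).map (fun x => l + x * a) =
        (volume.map fun x => x * a).map fun x => l + x := by
      rw [Measure.map_map (by fun_prop) (by fun_prop)]
      rfl
    have h3 := Real.smul_map_volume_mul_right ha.ne'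
    rw [abs_of_pos ha] at h3
    rw [h2, ← Measure.map_smul, h3, (measurePreserving_add_left volume l).map_eq]
  rw [h1, ← hpre, ← hemb.restrict_map, ← Measure.restrict_smul, hmap]

theorem smul_map_box {d : ℕ} {l a : Fin d → ℝ} (ha : ∀ k, 0 ≤ a k) :
    ENNReal.ofReal (∏ k, a k) • (Measure.pi fun _ : Fin d => (volume : Measure unitInterval)).map
      (fun u k => l k + (u k : ℝ) * a k) =
      (volume : Measure (Fin d → ℝ)).restrict
        (Set.univ.pi fun k => Set.Ico (l k) (l k + a k)) := by
  have hm : ∀ k, Measurable fun u : unitInterval => l k + (u : ℝ) * a k := fun k => by fun_prop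
  have hprob : ∀ k, IsProbabilityMeasure ((volume : Measure unitInterval).map
      fun u : unitInterval => l k + (u : ℝ) * a k) := fun k => Measure.isProbabilityMeasure_map (hm k).aemeasurable
  have h1 : (volume : Measure (Fin d → ℝ)).restrict
        (Set.univ.pi fun k => Set.Ico (l k) (l k + a k)) =
      Measure.pi fun k => volume.restrict (Set.Icc (l k) (l k + a k)) := by
    rw [volume_pi, Measure.restrict_congr_set Measure.univ_pi_Ico_ae_eq_Icc, ← Set.pi_univ_Icc,
      Measure.restrict_pi_pi]
  rw [h1, Measure.pi_map_pi (fun k => (hm k).aemeasurable)]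
  refine (Measure.pi_eq fun s hs => ?_).symm
  rw [Measure.smul_apply, Measure.pi_pi, smul_eq_mul, ENNReal.ofReal_prod_of_nonneg fun k _ => ha k,
    ← Finset.prod_mul_distrib]
  refine Finset.prod_congr rfl fun k _ => ?_
  rw [← smul_map_affine (l k) (ha k)]
  rfl

/-- This converts volume times mean score, which the program estimates, into an integral over the
box. The random point may lie on the closed boundary, which is a null set. -/
theorem prod_mul_integral_box {d : ℕ} {l a : Fin d → ℝ} (ha : ∀ k, 0 ≤ a k)
    {f : (Fin d → ℝ) → ℝ} (hf : Measurable f) :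
    (∏ k, a k) * ∫ u, f (fun k => l k + (u k : ℝ) * a k)
        ∂(Measure.pi fun _ : Fin d => (volume : Measure unitInterval)) =
      ∫ y in Set.univ.pi fun k => Set.Ico (l k) (l k + a k), f y := by
  have hφ : Measurable fun (u : Fin d → unitInterval) k => l k + (u k : ℝ) * a k :=
    measurable_pi_iff.2 fun k =>
      ((measurable_subtype_coe.comp (measurable_pi_apply k)).mul_const _).const_add _
  rw [← smul_map_box ha, integral_smul_measure,
    ENNReal.toReal_ofReal (Finset.prod_nonneg fun k _ => ha k), smul_eq_mul,
    integral_map hφ.aemeasurable hf.aestronglyMeasurable]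

end Klee

/-! ### Double counting of points and node boxes -/

namespace Klee
open RealRAM MeasureTheory ProbabilityTheory

theorem DyadicTree.bounds {L : ℕ} {v left right : ℕ → ℝ} (T : DyadicTree L v left right) {i : ℕ}
    (h1 : 1 ≤ i) (h2 : i < 2 ^ (L + 1)) : v 0 ≤ left i ∧ right i ≤ v (2 ^ L) := by
  obtain ⟨j, hj, h3, h4⟩ := DyadicTree.exists_height h1 h2
  obtain ⟨h5, h6⟩ := DyadicTree.level_bounds hj h3 h4
  rw [T.left_eq _ _ h5 h6, T.right_eq _ _ h5 h6]
  have h7 := Nat.mul_le_mul_right (2 ^ (L - j)) (Nat.le_succ i)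
  rw [pow_succ] at h6
  simp only [Nat.succ_eq_add_one] at h7
  exact ⟨T.mono_le (by omega) (by omega), T.mono_le (by omega) le_rfl⟩

/-- The half-open box attached to a tuple of nodes. -/
def nodeBox (d : ℕ) (left right : ℕ → ℕ → ℝ) (τ : ℕ → ℕ) : Set (Fin d → ℝ) :=
  Set.univ.pi fun k => Set.Ico (left k (τ k)) (right k (τ k))

/-- A finite set of tuples of nodes of dyadic trees. -/
structure IsNodeSet (L d : ℕ) (v left right : ℕ → ℕ → ℝ) (A : Finset (ℕ → ℕ)) : Prop where
  tree : ∀ k < d, DyadicTree L (v k) (left k) (right k)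
  node : ∀ τ ∈ A, ∀ k < d, 1 ≤ τ k ∧ τ k < 2 ^ (L + 1)
  zero : ∀ τ ∈ A, ∀ k, d ≤ k → τ k = 0

open Classical in
/-- The number of tuples in `A` all of whose nodes lie on the search paths for `y`. -/
noncomputable def pathCount (L d : ℕ) (right : ℕ → ℕ → ℝ) (A : Finset (ℕ → ℕ)) (y : Fin d → ℝ) :
    ℕ :=
  (A.filter fun τ => ∀ k : Fin d, τ k ∈ path L (right k) (y k)).card

theorem hits_eq_pathCount (L d : ℕ) (right : ℕ → ℕ → ℝ) (A : Finset (ℕ → ℕ)) (y : ℕ → ℝ) :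
    hits L d right A y = pathCount L d right A fun k => y k := by
  classical
  rw [hits, pathCount]
  congr 1
  exact Finset.filter_congr fun τ _ => ⟨fun h k => h k k.2, fun h k hk => h ⟨k, hk⟩⟩

variable {L d : ℕ} {v left right : ℕ → ℕ → ℝ} {A : Finset (ℕ → ℕ)}

theorem measurable_pathCount : Measurable (pathCount L d right A) := by
  classical
  have : pathCount L d right A = fun y =>
      ∑ τ ∈ A, if ∀ k : Fin d, τ k ∈ path L (right k) (y k) then 1 else 0 := by
    funext y
    rw [pathCount, Finset.card_filter]
  rw [this]
  refine Finset.measurable_sum _ fun τ _ => Measurable.ite ?_ measurable_const measurable_const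
  have : {y : Fin d → ℝ | ∀ k : Fin d, τ k ∈ path L (right k) (y k)} =
      ⋂ k : Fin d, (fun y : Fin d → ℝ => y k) ⁻¹' {x | τ k ∈ path L (right k) x} := by
    ext y; simp
  rw [this]
  exact .iInter fun k => measurable_pi_apply k (measurableSet_mem_path L _ _)

/-- Only the lengths of the search paths enter, so the bound holds for every point, inside the
trees' range or not. -/
theorem pathCount_le (hA : ∀ τ ∈ A, ∀ k, d ≤ k → τ k = 0) (y : Fin d → ℝ) :
    pathCount L d right A y ≤ (L + 1) ^ d := by
  classical
  let ℓ : ℕ → List ℕ := fun k => if h : k < d then path L (right k) (y ⟨k, h⟩) else []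
  have h1 : A.filter (fun τ => ∀ k : Fin d, τ k ∈ path L (right k) (y k)) ⊆
      (prodList ℓ d 0).toFinset := by
    intro τ hτ
    rw [Finset.mem_filter] at hτ
    rw [List.mem_toFinset, mem_prodList]
    exact ⟨fun k hk => by simpa [ℓ, hk] using hτ.2 ⟨k, hk⟩, fun k hk => hA τ hτ.1 k hk⟩
  refine (Finset.card_le_card h1).trans ((List.toFinset_card_le _).trans
    (length_prodList_le d (fun k hk => ?_) 0))
  simp [ℓ, hk]

theorem measurableSet_nodeBox (τ : ℕ → ℕ) : MeasurableSet (nodeBox d left right τ) :=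
  .univ_pi fun _ => measurableSet_Ico

theorem IsNodeSet.le (h : IsNodeSet L d v left right A) {τ : ℕ → ℕ} (hτ : τ ∈ A) {k : ℕ}
    (hk : k < d) : left k (τ k) ≤ right k (τ k) :=
  (h.tree k hk).left_le_right (h.node τ hτ k hk).1 (h.node τ hτ k hk).2

theorem IsNodeSet.volume_nodeBox (h : IsNodeSet L d v left right A) {τ : ℕ → ℕ} (hτ : τ ∈ A) :
    volume.real (nodeBox d left right τ) = boxVol d left right τ := by
  have := Real.volume_pi_Ico_toReal (a := fun k : Fin d => left k (τ k))
    (b := fun k : Fin d => right k (τ k)) fun k => h.le hτ k.2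
  rw [boxVol, Finset.prod_range, ← this]
  rfl

theorem volume_nodeBox_ne_top (τ : ℕ → ℕ) : volume (nodeBox d left right τ) ≠ ⊤ := by
  rw [nodeBox, Real.volume_pi_Ico]
  exact ENNReal.prod_ne_top fun _ _ => ENNReal.ofReal_ne_top

/-- Search paths describe containment only within the range of the trees; membership of `y` in one
node box guarantees that `y` is in this range. -/
theorem IsNodeSet.mem_nodeBox_iff (h : IsNodeSet L d v left right A) {σ τ : ℕ → ℕ} (hσ : σ ∈ A)
    (hτ : τ ∈ A) {y : Fin d → ℝ} (hy : y ∈ nodeBox d left right σ) :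
    (∀ k : Fin d, τ k ∈ path L (right k) (y k)) ↔ y ∈ nodeBox d left right τ := by
  simp only [nodeBox, Set.mem_pi, Set.mem_univ, true_imp_iff, Set.mem_Ico] at hy ⊢
  refine forall_congr' fun k => ?_
  have T := h.tree k k.2
  have hb := T.bounds (h.node σ hσ k k.2).1 (h.node σ hσ k k.2).2
  exact T.mem_path_iff (hb.1.trans (hy k).1) ((hy k).2.trans_le hb.2) (h.node τ hτ k k.2).1
    (h.node τ hτ k k.2).2

/-- The union of the boxes attached to the tuples in `A`. -/
def nodeUnion (d : ℕ) (left right : ℕ → ℕ → ℝ) (A : Finset (ℕ → ℕ)) : Set (Fin d → ℝ) :=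
  ⋃ τ ∈ A, nodeBox d left right τ

theorem measurableSet_nodeUnion : MeasurableSet (nodeUnion d left right A) :=
  Finset.measurableSet_biUnion _ fun τ _ => measurableSet_nodeBox τ

theorem volume_nodeUnion_ne_top : volume (nodeUnion d left right A) ≠ ⊤ :=
  ((measure_biUnion_finset_le A _).trans_lt (ENNReal.sum_lt_top.2 fun τ _ =>
    (volume_nodeBox_ne_top τ).lt_top)).ne

/-- The double counting behind both volume estimates: `f = 1 / pathCount` gives the volume of the
union, `f = 1` gives the bound for the total volume of the items. -/
theorem IsNodeSet.sum_indicator (h : IsNodeSet L d v left right A) (f : (Fin d → ℝ) → ℝ)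
    (y : Fin d → ℝ) : ∑ τ ∈ A, (nodeBox d left right τ).indicator f y =
      (nodeUnion d left right A).indicator (fun y => pathCount L d right A y * f y) y := by
  classical
  by_cases hy : y ∈ nodeUnion d left right A
  · rw [Set.indicator_of_mem hy]
    simp only [nodeUnion, Set.mem_iUnion] at hy
    obtain ⟨σ, hσ, hy⟩ := hy
    rw [pathCount, Finset.filter_congr fun τ hτ => h.mem_nodeBox_iff hσ hτ hy, Finset.card_filter,
      Nat.cast_sum, Finset.sum_mul]
    refine Finset.sum_congr rfl fun τ _ => ?_
    by_cases hyτ : y ∈ nodeBox d left right τ <;> simp [hyτ]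
  · rw [Set.indicator_of_notMem hy]
    refine Finset.sum_eq_zero fun τ hτ => Set.indicator_of_notMem (fun hyτ => hy ?_) _
    exact Set.mem_biUnion hτ hyτ

theorem IsNodeSet.pathCount_pos (h : IsNodeSet L d v left right A) {y : Fin d → ℝ}
    (hy : y ∈ nodeUnion d left right A) : 0 < pathCount L d right A y := by
  classical
  simp only [nodeUnion, Set.mem_iUnion] at hy
  obtain ⟨σ, hσ, hy⟩ := hy
  rw [pathCount, Finset.card_pos]
  exact ⟨σ, Finset.mem_filter.2 ⟨hσ, (h.mem_nodeBox_iff hσ hσ hy).2 hy⟩⟩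

/-- The weights `1 / pathCount` split the volume of the union among the boxes. -/
theorem IsNodeSet.sum_setIntegral (h : IsNodeSet L d v left right A) :
    ∑ τ ∈ A, ∫ y in nodeBox d left right τ, 1 / (pathCount L d right A y : ℝ) =
      volume.real (nodeUnion d left right A) := by
  have hm : Measurable fun y => 1 / (pathCount L d right A y : ℝ) :=
    measurable_const.div (measurable_from_nat.comp measurable_pathCount)
  simp only [← integral_indicator (measurableSet_nodeBox _)]
  rw [← integral_finsetSum]
  · simp only [h.sum_indicator]
    rw [integral_indicator measurableSet_nodeUnion,
      setIntegral_congr_fun measurableSet_nodeUnion (g := fun _ => (1 : ℝ)) fun y hy => ?_]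
    · simp
    · have := h.pathCount_pos hy
      simp only
      field_simp
  · intro τ _
    rw [integrable_indicator_iff (measurableSet_nodeBox τ)]
    refine Measure.integrableOn_of_bounded (M := 1) (volume_nodeBox_ne_top τ)
      hm.aestronglyMeasurable (.of_forall fun y => ?_)
    rw [Real.norm_of_nonneg (by positivity)]
    simpa using Nat.cast_inv_le_one (α := ℝ) _

/-- Integrate the multiplicity of a point, which is at most `(L + 1) ^ d`, over the union. -/
theorem IsNodeSet.sum_volume_le (h : IsNodeSet L d v left right A) :
    ∑ τ ∈ A, boxVol d left right τ ≤ (L + 1) ^ d * volume.real (nodeUnion d left right A) := by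
  have h1 : ∑ τ ∈ A, boxVol d left right τ =
      ∫ y, ∑ τ ∈ A, (nodeBox d left right τ).indicator (fun _ => (1 : ℝ)) y := by
    rw [integral_finsetSum]
    · refine Finset.sum_congr rfl fun τ hτ => ?_
      rw [integral_indicator (measurableSet_nodeBox τ), ← h.volume_nodeBox hτ]
      simp
    · intro τ _
      rw [integrable_indicator_iff (measurableSet_nodeBox τ)]
      exact integrableOn_const (volume_nodeBox_ne_top τ)
  rw [h1]
  simp only [h.sum_indicator]
  rw [integral_indicator measurableSet_nodeUnion]
  have h2 : ∫ y in nodeUnion d left right A, ((L : ℝ) + 1) ^ d =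
      (L + 1) ^ d * volume.real (nodeUnion d left right A) := by
    simp [mul_comm]
  rw [← h2]
  have hb : ∀ y, (pathCount L d right A y : ℝ) * 1 ≤ ((L : ℝ) + 1) ^ d := fun y => by
    rw [mul_one]
    exact_mod_cast pathCount_le h.zero y
  refine setIntegral_mono ?_ (integrableOn_const volume_nodeUnion_ne_top) hb
  refine Measure.integrableOn_of_bounded (M := ((L : ℝ) + 1) ^ d) volume_nodeUnion_ne_top
    ((measurable_from_nat.comp measurable_pathCount).mul_const 1).aestronglyMeasurable
    (.of_forall fun y => ?_)
  rw [Real.norm_of_nonneg (by positivity)]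
  exact hb y

/-- The union of the node boxes is the union of the given boxes, up to a null set. -/
theorem IsNodeSet.volume_nodeUnion (h : IsNodeSet L d v left right A) {n : ℕ} {r : ℕ → ℕ → ℕ}
    {lo hi : Fin n → Fin d → ℝ}
    (hr : ∀ (i : Fin n) (k : Fin d), r k (i + i + 1) ≤ 2 ^ L ∧ v k (r k (i + i + 1)) = lo i k ∧
      r k (i + i + 2) ≤ 2 ^ L ∧ v k (r k (i + i + 2)) = hi i k)
    (hA : ∀ τ, τ ∈ A ↔ ∃ i < n, (∀ k < d, τ k ∈ cover (2 ^ L + r k (i + i + 1))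
      (2 ^ L + r k (i + i + 2))) ∧ ∀ k, d ≤ k → τ k = 0) :
    volume.real (nodeUnion d left right A) = unionVolume lo hi := by
  have h1 : nodeUnion d left right A = ⋃ i, Set.univ.pi fun k => Set.Ico (lo i k) (hi i k) := by
    ext y
    simp only [nodeUnion, nodeBox, Set.mem_iUnion, Set.mem_pi, Set.mem_univ, true_imp_iff,
      Set.mem_Ico, exists_prop, hA]
    constructor
    · rintro ⟨τ, ⟨i, hi', h2, -⟩, h3⟩
      refine ⟨⟨i, hi'⟩, fun k => ?_⟩
      obtain ⟨e1, e2, e3, e4⟩ := hr ⟨i, hi'⟩ k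
      rw [← e2, ← e4]
      exact ((h.tree k k.2).exists_mem_cover_iff e1 e3 (y k)).1 ⟨_, h2 k k.2, h3 k⟩
    · rintro ⟨i, h2⟩
      have h3 : ∀ k : Fin d, ∃ c ∈ cover (2 ^ L + r k (i + i + 1)) (2 ^ L + r k (i + i + 2)),
          left k c ≤ y k ∧ y k < right k c := fun k => by
        obtain ⟨e1, e2, e3, e4⟩ := hr i k
        refine ((h.tree k k.2).exists_mem_cover_iff e1 e3 (y k)).2 ?_
        rw [e2, e4]
        exact h2 k
      choose c hc1 hc2 using h3
      refine ⟨fun k => if hk : k < d then c ⟨k, hk⟩ else 0, ⟨i, i.2, fun k hk => ?_, fun k hk => ?_⟩,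
        fun k => ?_⟩
      · simpa [hk] using hc1 ⟨k, hk⟩
      · simp [hk]
      · simpa using hc2 k
  have h2 : (⋃ i, Set.univ.pi fun k => Set.Ico (lo i k) (hi i k)) =ᵐ[volume]
      ⋃ i, Set.Icc (lo i) (hi i) :=
    Filter.EventuallyEq.countable_iUnion fun i => Measure.univ_pi_Ico_ae_eq_Icc
  rw [h1, unionVolume, measureReal_congr h2]

end Klee

/-! ### The deterministic preprocessing phase -/

namespace RealRAM

/-- Makes the state after preprocessing, and with it the items and the sample numbers, independent
of the outcome of the source. -/
theorem Exec.of_not_draws {ω ω' : Source} {p : Prog} {s s' : State} {t : ℕ} (h : Exec ω p s t s')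
    (hp : ¬ p.draws) : Exec ω' p s t s' := by
  induction h with
  | skip s => exact .skip s
  | setNat a i e s => exact .setNat a i e s
  | setReal a i e s => exact .setReal a i e s
  | sample a i s => exact absurd trivial hp
  | seq _ _ ihp ihq => exact .seq (ihp fun h => hp (.inl h)) (ihq fun h => hp (.inr h))
  | iteTrue hb _ ih => exact .iteTrue hb (ih fun h => hp (.inl h))
  | iteFalse hb _ ih => exact .iteFalse hb (ih fun h => hp (.inr h))
  | whileTrue hb _ _ ihp ihw => exact .whileTrue hb (ihp hp) (ihw hp)
  | whileFalse hb => exact .whileFalse hb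

end RealRAM

namespace Klee
open RealRAM

variable {d n : ℕ}

theorem IsPrepared.congr {L k : ℕ} {lo hi : ℕ → ℝ} {s s' : State}
    (h : IsPrepared L n d k lo hi s) (h1 : s'.nat (nv (.rank k)) = s.nat (nv (.rank k)))
    (h2 : s'.real (rv d (.left k)) = s.real (rv d (.left k)))
    (h3 : s'.real (rv d (.right k)) = s.real (rv d (.right k))) :
    IsPrepared L n d k lo hi s' := by
  rwa [IsPrepared, h1, h2, h3]

/-- The invariant records that the tournaments of the directions still to come are empty, as
`run_enter` requires. -/
theorem run_prepare_all {ω : Source} {s : State} {L : ℕ} (hn : s.nat (nv .size) 0 = n)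
    (hn2 : s.nat (nv .ends) 0 = n + n) (hM : s.nat (nv .leaves) 0 = 2 ^ L)
    (hM' : s.nat (nv .leaves') 0 = 2 ^ L + 1) (hnL : n + n < 2 ^ L)
    (hw : ∀ k i, s.nat (nv (.w k)) i = 0) :
    Run ω (.dims d (Code.prepare d)) s (d * (2 ^ L * (L * 360 + 360)) + 1) fun s' =>
      ∀ k < d, IsPrepared L n d k (s.real (k + 1)) (s.real (d + 1 + k)) s' := by
  refine (Run.dims (I := fun j s' => (∀ k, j ≤ k → ∀ i, s'.nat (nv (.w k)) i = 0) ∧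
    ∀ k < j, IsPrepared L n d k (s.real (k + 1)) (s.real (d + 1 + k)) s')
    ⟨fun k _ => hw k, by simp⟩ fun j s' hs hj h => ?_).post fun s' _ h => h.2
  have e1 : ∀ v, (∀ k, v ≠ .w k) → (∀ k, v ≠ .rank k) → v ≠ .i → v ≠ .e → v ≠ .ii →
      s'.nat (nv v) = s.nat (nv v) := fun v h1 h2 h3 h4 h5 => hs.nat _ (by
    simp [Code.prepare, Code.load, Code.enter, Code.extract, Code.inner, Code.update, Code.play, *])
  have e2 : ∀ a ≤ 2 * d, s'.real a = s.real a := fun a ha => hs.real _ (by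
    simp [Code.prepare, Code.load, Code.enter, Code.extract, Code.inner, Code.update, Code.play,
      ne_rv ha])
  refine (run_prepare hj (by rwa [e1] <;> simp) (by rwa [e1] <;> simp) (by rwa [e1] <;> simp)
    (by rwa [e1] <;> simp) hnL (h.1 j le_rfl)).post fun s₁ hs₁ h₁ => ⟨fun k hk i => ?_,
      fun k hk => ?_⟩
  · rw [hs₁.nat _ (by simp [Code.prepare, Code.load, Code.enter, Code.extract, Code.inner,
      Code.update, Code.play]; omega), h.1 k (by omega)]
  · rcases Nat.lt_succ_iff_lt_or_eq.1 hk with hk | rfl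
    · refine (h.2 k hk).congr (hs₁.nat _ ?_) (hs₁.real _ ?_) (hs₁.real _ ?_) <;>
      · simp [Code.prepare, Code.load, Code.enter, Code.extract, Code.inner, Code.update, Code.play]
        try omega
    · rwa [e2 _ (by omega), e2 _ (by omega)] at h₁

theorem run_tabulate_all {ω : Source} {s : State} {L : ℕ} (hW : s.nat (nv .width) 0 = 2 ^ (L + 1))
    (hS : ∀ k, s.nat (nv (.shift k)) 0 = 0) (hB : s.nat (nv .base) 0 = 1) :
    Run ω (.dims d Code.tabulate) s (d * (2 ^ (L + 1) * 30 + 20) + 1)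
      (HasShifts (2 ^ (L + 1)) d) := by
  refine (Run.dims (I := fun j s' => (∀ k, j ≤ k → s'.nat (nv (.shift k)) 0 = 0) ∧
    s'.nat (nv .base) 0 = (2 ^ (L + 1)) ^ j ∧ HasShifts (2 ^ (L + 1)) j s')
    ⟨fun k _ => hS k, by simpa using hB, by simp [HasShifts]⟩ fun j s' hs hj h => ?_).post
    fun s' _ h => h.2.2
  refine (run_tabulate (by rwa [hs.nat _ (by simp [Code.tabulate])]) (h.1 j le_rfl) h.2.1).post
    fun s₁ hs₁ h₁ => ⟨fun k hk => ?_, h₁.1, fun k hk => ?_⟩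
  · rw [hs₁.nat _ (by simp [Code.tabulate]; omega), h.1 k (by omega)]
  · rcases Nat.lt_succ_iff_lt_or_eq.1 hk with hk | rfl
    · rw [hs₁.nat _ (by simp [Code.tabulate]; omega)]
      exact h.2.2 k hk
    · exact h₁.2

/-- The boxes of the node tuples in `its` are the items, and everything is ready for sampling. -/
structure Ready (L n d : ℕ) (ε : ℝ) (lo hi : ℕ → ℕ → ℝ) (its : List (ℕ → ℕ)) (s : State) :
    Prop where
  prepared : ∀ k < d, IsPrepared L n d k (lo k) (hi k) s
  items : Items (2 ^ (L + 1)) d (fun k => s.real (rv d (.left k)))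
    (fun k => s.real (rv d (.right k))) its s
  length : its.length ≤ n * (2 * (L + 2)) ^ d
  mem : ∀ τ, τ ∈ its ↔ ∃ i < n, (∀ k < d, τ k ∈
    cover (2 ^ L + s.nat (nv (.rank k)) (i + i + 1)) (2 ^ L + s.nat (nv (.rank k)) (i + i + 2))) ∧
      ∀ k, d ≤ k → τ k = 0
  shifts : HasShifts (2 ^ (L + 1)) d s
  width : s.nat (nv .width) 0 = 2 ^ (L + 1)
  fac : s.real (rv d .fac) 0 = 10 * ((1 + ε) / ε) ^ 2 * (L + 1 : ℕ) ^ d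
  out : s.real (rv d .out) 0 = 0
  pos : s.pos = 0

/-- A bound for the running time of `Code.preprocess`. -/
def preprocessTime (L n d : ℕ) : ℕ :=
  (L * 30 + 50) + ((d * (2 ^ L * (L * 360 + 360)) + 1) + (3 + ((d * (2 ^ (L + 1) * 30 + 20) + 1) +
    ((n * (d * ((L + 2) * 60 + 60) + 15 + (2 * (L + 2) + 1) ^ d * (90 * d + 80)) + 10) +
      (d * 10 + 40)))))

theorem run_preprocess {ω : Source} {s : State} {ε : ℝ} (hn : s.nat (nv .size) 0 = n)
    (hnat : ∀ a, a ≠ .size → ∀ i, s.nat (nv a) i = 0) (hreal : ∀ a i, s.real (rv d a) i = 0)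
    (hε : s.real 0 0 = ε) (hpos : s.pos = 0) :
    Run ω (Code.preprocess d) s (preprocessTime (Nat.clog 2 (n + n + 2)) n d) fun s' =>
      ∃ its, Ready (Nat.clog 2 (n + n + 2)) n d ε (fun k => s.real (k + 1))
        (fun k => s.real (d + 1 + k)) its s' := by
  set L := Nat.clog 2 (n + n + 2) with hL
  have hnL : n + n < 2 ^ L := by
    have := Nat.le_pow_clog (b := 2) (by omega) (n + n + 2)
    rw [hL]
    omega
  refine (run_setup hn).seq fun s₁ hs₁ ⟨hM, hD, hE, hM', hW⟩ =>
    (run_prepare_all (n := n) (L := L) ?_ hE hM hM' hnL ?_).seq fun s₂ hs₂ h₂ =>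
      Run.seq_setNat ((run_tabulate_all (L := L) ?_ ?_ ?_).seq fun s₃ hs₃ h₃ =>
        (run_collect (L := L) (n := n) (left := fun k => s₂.real (rv d (.left k)))
          (right := fun k => s₂.real (rv d (.right k))) ?_ ?_ ?_ h₃ ?_ ?_ ?_).seq
          fun s₄ hs₄ ⟨its, hits, hlen, hmem⟩ =>
            (run_factor (ε := ε) (r := L + 1) ?_ ?_).post fun s₅ hs₅ h₅ => ?_)
  · rw [hs₁.nat _ (by simp [Code.setup]), hn]
  · intro k i
    rw [hs₁.nat _ (by simp [Code.setup]), hnat _ (by simp)]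
  · have e := hs₂.nat (nv .width) (by simp [Code.prepare, Code.load, Code.enter, Code.extract,
      Code.inner, Code.update, Code.play])
    simp [e, hW, hL]
  · intro k
    have e := hs₂.nat (nv (.shift k)) (by simp [Code.prepare, Code.load, Code.enter, Code.extract,
      Code.inner, Code.update, Code.play])
    have e' := hs₁.nat (nv (.shift k)) (by simp [Code.setup])
    simp [e, e', hnat]
  · simp
  all_goals
    -- Frame facts shared by the remaining goals: which arrays the earlier stages left unchanged,
    -- and which are therefore still zero.
    have eN : ∀ v, v ≠ .base → (∀ k, v ≠ .shift k) → v ≠ .i → s₃.nat (nv v) = s₂.nat (nv v) :=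
      fun v h1 h2 h3 => by
        rw [hs₃.nat _ (by simp [Code.tabulate, h1, h2, h3]), State.nat_setNat_of_ne _ _ _ (by simpa)]
    have eR : s₃.real = s₂.real := funext fun a => hs₃.real a (by simp [Code.tabulate])
    have eN' : ∀ v, (∀ k, v ≠ .w k) → (∀ k, v ≠ .rank k) → v ≠ .i → v ≠ .e → v ≠ .ii →
      s₂.nat (nv v) = s₁.nat (nv v) := fun v h1 h2 h3 h4 h5 => hs₂.nat _ (by
        simp [Code.prepare, Code.load, Code.enter, Code.extract, Code.inner, Code.update, Code.play,
          *])
    have eR' : ∀ a ≤ 2 * d, s₂.real a = s.real a := fun a ha => by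
      rw [hs₂.real _ (by simp [Code.prepare, Code.load, Code.enter, Code.extract, Code.inner,
        Code.update, Code.play, ne_rv ha]), hs₁.real _ (by simp [Code.setup])]
    have eR0 : ∀ v, (∀ k, v ≠ .x k) → (∀ k, v ≠ .left k) → (∀ k, v ≠ .right k) → v ≠ .cur →
        ∀ i, s₂.real (rv d v) i = 0 := fun v h1 h2 h3 h4 i => by
      rw [hs₂.real _ (by simp [Code.prepare, Code.load, Code.enter, Code.extract, Code.inner,
        Code.update, Code.play, h1, h2, h3, h4]), hs₁.real _ (by simp [Code.setup]), hreal]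
    have eN0 : ∀ v, v ≠ .size → v ≠ .base → (∀ k, v ≠ .shift k) → (∀ k, v ≠ .w k) →
        (∀ k, v ≠ .rank k) → v ≠ .i → v ≠ .e → v ≠ .ii → v ≠ .leaves → v ≠ .depth → v ≠ .ends →
        v ≠ .leaves' → v ≠ .width → ∀ i, s₃.nat (nv v) i = 0 := by
      intro v h0 h1 h2 h3 h4 h5 h6 h7 h8 h9 h10 h11 h12 i
      rw [eN v h1 h2 h5, eN' v h3 h4 h5 h6 h7, hs₁.nat _ (by simp [Code.setup, *]), hnat v h0]
  · rw [eN, eN', hM] <;> simp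
  · rw [eN, eN', hs₁.nat _ (by simp [Code.setup]), hn] <;> simp
  · refine ⟨by simp, List.nodup_nil, ?_, by simp, fun c => ?_, by simp, ?_⟩
    · rw [eN0] <;> simp
    · rw [eN0] <;> simp
    · rw [eR, eR0] <;> simp
  · intro k hk i hi
    obtain ⟨v, -, hv⟩ := h₂ k hk
    rw [eN] <;> simp [(hv i hi).2.2.1]
  · intro k _
    rw [eR]
  · intro k _
    rw [eR]
  · rw [hs₄.real _ (by simp [Code.collect, Code.cover, Code.nest, Code.key, Code.append,
      ne_rv]), eR, eR' _ (by omega), hε]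
  · rw [hs₄.nat _ (by simp [Code.collect, Code.cover, Code.nest, Code.key, Code.append]), eN, eN',
      hD] <;> simp
  · have eN5 : s₅.nat = s₄.nat := funext fun a => hs₅.nat a (by simp [Code.factor])
    have eN4 : ∀ k, s₄.nat (nv (.rank k)) = s₂.nat (nv (.rank k)) := fun k => by
      rw [hs₄.nat _ (by simp [Code.collect, Code.cover, Code.nest, Code.key, Code.append]), eN] <;>
        simp
    have eR5 : ∀ v, v ≠ .fac → s₅.real (rv d v) = s₄.real (rv d v) := fun v hv =>
      hs₅.real _ (by simp [Code.factor, hv])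
    have eR4 : ∀ v, v ≠ .vol → v ≠ .sum → s₄.real (rv d v) = s₂.real (rv d v) := fun v h1 h2 => by
      rw [hs₄.real _ (by simp [Code.collect, Code.cover, Code.nest, Code.key, Code.append, h1, h2]),
        eR]
    have hl : (fun k => s₅.real (rv d (.left k))) = fun k => s₂.real (rv d (.left k)) :=
      funext fun k => by rw [eR5, eR4] <;> simp
    have hr : (fun k => s₅.real (rv d (.right k))) = fun k => s₂.real (rv d (.right k)) :=
      funext fun k => by rw [eR5, eR4] <;> simp
    refine ⟨its, fun k hk => ?_, ?_, hlen, fun τ => ?_, fun k hk => ?_, ?_, h₅, ?_, ?_⟩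
    · have h := h₂ k hk
      rw [hs₁.real _ (by simp [Code.setup]), hs₁.real _ (by simp [Code.setup])] at h
      exact h.congr (by rw [eN5, eN4]) (congrFun hl k) (congrFun hr k)
    · rw [hl, hr]
      exact hits.congr (by rw [eN5]) (fun k _ => by rw [eN5]) (by rw [eN5]) (eR5 _ (by simp))
        (eR5 _ (by simp))
    · rw [hmem]
      simp only [eN5, eN4, eN (.rank _) (by simp) (by simp) (by simp)]
    · rw [eN5, hs₄.nat _ (by simp [Code.collect, Code.cover, Code.nest, Code.key, Code.append])]
      exact h₃ k hk
    · rw [eN5, hs₄.nat _ (by simp [Code.collect, Code.cover, Code.nest, Code.key, Code.append]), eN,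
        eN', hW] <;> simp
    · rw [eR5, eR4, eR0] <;> simp
    · rw [hs₅.pos (by simp [Code.factor]), hs₄.pos (by simp [Code.collect, Code.cover, Code.nest,
        Code.key, Code.append]), hs₃.pos (by simp [Code.tabulate]), State.pos_setNat,
        hs₂.pos (by simp [Code.prepare, Code.load, Code.enter, Code.extract, Code.inner,
          Code.update, Code.play]), hs₁.pos (by simp [Code.setup]), hpos]

end Klee

/-! ### Sample numbers and accuracy -/

namespace Klee
open RealRAM MeasureTheory

/-- The number of samples is the least natural number `c` with `K * a ≤ c * S`. -/
theorem lt_sampleCount_iff {K S a : ℝ} (hS : 0 ≤ S) (h : S = 0 → a = 0) (c : ℕ) :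
    (c : ℝ) * S < K * a ↔ c < ⌈K * a / S⌉₊ := by
  rcases hS.eq_or_lt with rfl | hS
  · simp [h rfl]
  · rw [Nat.lt_ceil, lt_div_iff₀ hS]

theorem le_mul_sampleCount {K S a : ℝ} (hK : 0 < K) (hS : 0 ≤ S) (h : S = 0 → a = 0) :
    a ≤ S / K * ⌈K * a / S⌉₊ := by
  rcases hS.eq_or_lt with rfl | hS
  · simp [h rfl]
  · calc a = S / K * (K * a / S) := by field_simp
      _ ≤ _ := by gcongr; exact Nat.le_ceil _

/-- Rounding up costs at most one sample per item; before rounding the numbers add up to `K`, or to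
`0` if `S = 0`. -/
theorem sum_sampleCount_le {m : ℕ} {K S : ℝ} {a : ℕ → ℝ} (hK : 0 ≤ K) (ha : ∀ j < m, 0 ≤ a j)
    (hS : ∑ j ∈ Finset.range m, a j = S) :
    ((∑ j ∈ Finset.range m, ⌈K * a j / S⌉₊ : ℕ) : ℝ) ≤ K + m := by
  have hS0 : 0 ≤ S := hS ▸ Finset.sum_nonneg fun j hj => ha j (Finset.mem_range.1 hj)
  rw [Nat.cast_sum]
  calc ∑ j ∈ Finset.range m, (⌈K * a j / S⌉₊ : ℝ)
      ≤ ∑ j ∈ Finset.range m, (K * a j / S + 1) := Finset.sum_le_sum fun j hj =>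
        (Nat.ceil_lt_add_one (div_nonneg (mul_nonneg hK (ha j (Finset.mem_range.1 hj))) hS0)).le
    _ = K * S / S + m := by
        rw [Finset.sum_add_distrib, ← Finset.sum_div, ← Finset.mul_sum, hS]
        simp
    _ ≤ K + m := by
        gcongr
        rcases hS0.eq_or_lt with rfl | h
        · simpa using hK
        · rw [mul_div_cancel_right₀ _ h.ne']

/-- The tolerance `ε / (1 + ε)` is dictated by the lower side, as `V / (1 + ε) = V - ε / (1 + ε) *
V`; the upper side has room to spare. -/
theorem isApprox_of_abs_sub_lt {ε V x : ℝ} (hε : 0 < ε) (h : |x - V| < ε / (1 + ε) * V) :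
    IsApprox ε V x := by
  have h1 : 0 < 1 + ε := by linarith
  have h2 : 0 < ε / (1 + ε) := by positivity
  have h3 : 0 < V := pos_of_mul_pos_right ((abs_nonneg _).trans_lt h) h2.le
  have h4 : ε / (1 + ε) * V ≤ ε * V := by
    gcongr
    exact div_le_self hε.le (by linarith)
  obtain ⟨h5, h6⟩ := abs_lt.1 h
  refine ⟨?_, by linarith⟩
  have h7 : V / (1 + ε) = V - ε / (1 + ε) * V := by field_simp; ring
  linarith

section Ready

variable {L n d : ℕ} {ε : ℝ} {its : List (ℕ → ℕ)} {s : State} {lo hi : ℕ → ℕ → ℝ}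

open Classical in
theorem Ready.exists_isNodeSet (h : Ready L n d ε lo hi its s) : ∃ v : ℕ → ℕ → ℝ,
    IsNodeSet L d v (fun k => s.real (rv d (.left k))) (fun k => s.real (rv d (.right k)))
      its.toFinset ∧ ∀ i < n, ∀ k < d,
        s.nat (nv (.rank k)) (i + i + 1) ≤ 2 ^ L ∧
        v k (s.nat (nv (.rank k)) (i + i + 1)) = lo k i ∧
        s.nat (nv (.rank k)) (i + i + 2) ≤ 2 ^ L ∧
        v k (s.nat (nv (.rank k)) (i + i + 2)) = hi k i := by
  have h1 : ∀ k, ∃ v, k < d → DyadicTree L v (s.real (rv d (.left k))) (s.real (rv d (.right k))) ∧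
      ∀ i < n, s.nat (nv (.rank k)) (i + i + 1) ≤ 2 ^ L ∧
      v (s.nat (nv (.rank k)) (i + i + 1)) = lo k i ∧
      s.nat (nv (.rank k)) (i + i + 2) ≤ 2 ^ L ∧
      v (s.nat (nv (.rank k)) (i + i + 2)) = hi k i := fun k => by
    by_cases hk : k < d
    · obtain ⟨v, hv⟩ := h.prepared k hk
      exact ⟨v, fun _ => hv⟩
    · exact ⟨0, fun h => absurd h hk⟩
  choose v hv using h1
  refine ⟨v, ⟨fun k hk => (hv k hk).1, fun τ hτ k hk => ?_, fun τ hτ => ?_⟩,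
    fun i hi k hk => (hv k hk).2 i hi⟩
  · rw [List.mem_toFinset, h.mem] at hτ
    obtain ⟨i, hi, h2, -⟩ := hτ
    exact DyadicTree.bounds_of_mem_cover ((hv k hk).2 i hi).2.2.1 (h2 k hk)
  · rw [List.mem_toFinset, h.mem] at hτ
    obtain ⟨i, hi, -, h2⟩ := hτ
    exact h2

end Ready

/-- The score of a random point of the box of `τ`. -/
noncomputable def score (L d : ℕ) (left right : ℕ → ℕ → ℝ) (A : Finset (ℕ → ℕ)) (τ : ℕ → ℕ)
    (u : Fin d → unitInterval) : ℝ :=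
  1 / (pathCount L d right A fun k => left k (τ k) + (u k : ℝ) * (right k (τ k) - left k (τ k)) : ℝ)

variable {L d : ℕ} {left right : ℕ → ℕ → ℝ} {A : Finset (ℕ → ℕ)}

theorem measurable_score (τ : ℕ → ℕ) : Measurable (score L d left right A τ) := by
  refine measurable_const.div (measurable_from_nat.comp (measurable_pathCount.comp ?_))
  exact measurable_pi_iff.2 fun k =>
    ((measurable_subtype_coe.comp (measurable_pi_apply k)).mul_const _).const_add _

theorem score_nonneg (τ : ℕ → ℕ) (u : Fin d → unitInterval) : 0 ≤ score L d left right A τ u := by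
  unfold score; positivity

/-- Also true when no item is hit, which can happen for a point on the boundary: then `1 / 0 = 0`.
-/
theorem score_le_one (τ : ℕ → ℕ) (u : Fin d → unitInterval) : score L d left right A τ u ≤ 1 := by
  simpa [score] using Nat.cast_inv_le_one (α := ℝ) _

theorem IsNodeSet.boxVol_nonneg {v : ℕ → ℕ → ℝ} (h : IsNodeSet L d v left right A) {τ : ℕ → ℕ}
    (hτ : τ ∈ A) : 0 ≤ boxVol d left right τ := by
  rw [← h.volume_nodeBox hτ]
  exact measureReal_nonneg

theorem IsNodeSet.sum_boxVol_mul_integral_score {v : ℕ → ℕ → ℝ}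
    (h : IsNodeSet L d v left right A) :
    ∑ τ ∈ A, boxVol d left right τ * ∫ u, score L d left right A τ u
      ∂(Measure.pi fun _ => volume) = volume.real (nodeUnion d left right A) := by
  rw [← h.sum_setIntegral]
  refine Finset.sum_congr rfl fun τ hτ => ?_
  have := prod_mul_integral_box (l := fun k : Fin d => left k (τ k))
    (a := fun k : Fin d => right k (τ k) - left k (τ k))
    (fun k => sub_nonneg.2 (h.le hτ k.2))
    (f := fun y => 1 / (pathCount L d right A y : ℝ))
    (measurable_const.div (measurable_from_nat.comp measurable_pathCount))
  rw [boxVol, Finset.prod_range]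
  simp only [add_sub_cancel] at this
  exact this

open Classical in
/-- The output of the program, as a function of the outcome of the random source. -/
noncomputable def estimator (L d : ℕ) (left right : ℕ → ℕ → ℝ) (its : List (ℕ → ℕ)) (N : ℕ → ℕ) :
    Source → ℝ :=
  weightedAverages d N (fun j : Fin its.length => boxVol d left right its[j])
    fun j => score L d left right its.toFinset its[j]

open Classical in
-- Chebyshev's inequality with `R = S / K`: the choice of the sample numbers gives `a j ≤ (S / K) *
-- N j`, and `S ≤ (L + 1) ^ d * V` makes `(S / K) * V` at most a tenth of the squared tolerance.
theorem IsNodeSet.estimator_isApprox {v : ℕ → ℕ → ℝ} {its : List (ℕ → ℕ)} {K ε : ℝ} {N : ℕ → ℕ}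
    (h : IsNodeSet L d v left right its.toFinset) (hits : its.Nodup) (hε : 0 < ε)
    (hK : K = 10 * ((1 + ε) / ε) ^ 2 * (L + 1 : ℕ) ^ d)
    (hN : ∀ (j : ℕ) (hj : j < its.length), N j =
      ⌈K * boxVol d left right its[j] / (its.map (boxVol d left right)).sum⌉₊) :
    sourceLaw {ω | ¬ IsApprox ε (volume.real (nodeUnion d left right its.toFinset))
      (estimator L d left right its N ω)} ≤ 1 / 10 := by
  set V := volume.real (nodeUnion d left right its.toFinset) with hVdef
  set S := (its.map (boxVol d left right)).sum with hSdef
  have hS : S = ∑ τ ∈ its.toFinset, boxVol d left right τ := (List.sum_toFinset _ hits).symm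
  have ha : ∀ τ ∈ its.toFinset, 0 ≤ boxVol d left right τ := fun τ => h.boxVol_nonneg
  have hS0 : 0 ≤ S := hS ▸ Finset.sum_nonneg ha
  have hSa : ∀ j : Fin its.length, S = 0 → boxVol d left right its[j] = 0 := fun j h0 =>
    (Finset.sum_eq_zero_iff_of_nonneg ha).1 (hS ▸ h0) _ (by simp)
  have hSV : S ≤ (L + 1) ^ d * V := hS ▸ h.sum_volume_le
  have hV0 : 0 ≤ V := measureReal_nonneg
  clear_value V
  -- If `V = 0`, the tolerance is zero and Chebyshev's inequality is void; but then all items have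
  -- volume zero and the output is exactly `0`.
  rcases hV0.eq_or_lt with hV | hV
  · have h0 : S = 0 := le_antisymm (by rwa [← hV, mul_zero] at hSV) hS0
    have : {ω | ¬ IsApprox ε V (estimator L d left right its N ω)} = ∅ := by
      ext ω
      simp only [estimator, weightedAverages, Set.mem_ofPred_eq, Set.mem_empty_iff_false, iff_false,
        not_not, hSa _ h0]
      simp [IsApprox, ← hV]
    rw [this]
    simp
  have hKpos : 0 < K := by rw [hK]; positivity
  have hδ : 0 < ε / (1 + ε) * V := by positivity
  refine (measure_mono fun ω hω => ?_).trans (weightedAverages_deviation (R := S / K) (V := V)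
    (t := ε / (1 + ε) * V) (d := d)
    (g := fun j : Fin its.length => score L d left right its.toFinset its[j]) (fun j => measurable_score its[j]) (fun j => score_nonneg its[j])
    (fun j => score_le_one its[j]) (fun j => ha its[j] (by simp)) (N := N) (fun j => ?_) ?_ hδ ?_)
  · exact not_lt.1 fun h1 => hω (isApprox_of_abs_sub_lt hε h1)
  · rw [hN j j.2]
    exact le_mul_sampleCount hKpos hS0 (hSa j)
  · rw [hVdef, ← h.sum_boxVol_mul_integral_score, List.sum_toFinset _ hits,
      ← Fin.sum_univ_fun_getElem]
    rfl
  · have h1 : S / K * V ≤ (L + 1) ^ d * V / K * V := by gcongr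
    refine h1.trans (le_of_eq ?_)
    rw [hK]
    push_cast
    field_simp

/-- A bound for the running time of the part that samples, if `m` is the number of items and `N` is
the total number of samples. -/
def estimateTime (L d m N : ℕ) : ℕ :=
  N * (d * (L * 50 + 120) + (L + 2) ^ d * (40 * d + 20) + 50) + 70 * m + 14

open Classical in
theorem run_estimate_output {ω : Source} {n : ℕ} {ε : ℝ} {its : List (ℕ → ℕ)} {s : State}
    {lo hi : ℕ → ℕ → ℝ} {N : ℕ → ℕ} (h : Ready L n d ε lo hi its s)
    (hN : ∀ (j : ℕ) (hj : j < its.length) (c : ℕ),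
      (c : ℝ) * (its.map (boxVol d (fun k => s.real (rv d (.left k)))
        fun k => s.real (rv d (.right k)))).sum <
      s.real (rv d .fac) 0 * boxVol d (fun k => s.real (rv d (.left k)))
        (fun k => s.real (rv d (.right k))) its[j] ↔ c < N j) :
    Run ω (.seq (Code.estimate d) (.setReal 0 0 (rx d .out))) s
      (estimateTime L d its.length (∑ j ∈ Finset.range its.length, N j)) fun s' =>
      output s' = estimator L d (fun k => s.real (rv d (.left k)))
        (fun k => s.real (rv d (.right k))) its N ω := by
  refine ((run_estimate h.items h.shifts h.width (fun _ _ => rfl) (fun _ _ => rfl) h.pos h.out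
    hN).seq fun s₁ _ h₁ => Run.setReal ?_).mono ?_
  · simp only [output, State.real_setReal, RExp.eval_get, NExp.eval_zero, and_self, if_true, h₁]
    simp only [estimator, weightedAverages, score, hits_eq_pathCount, block, boxPoint]
  · rw [Finset.sum_add_distrib, ← Finset.sum_mul, estimateTime]
    simp
    omega

/-! ### The running time -/

theorem two_pow_clog_le {n : ℕ} (hn : 2 ≤ n) : 2 ^ Nat.clog 2 (n + n + 2) ≤ 6 * n := by
  have h := Nat.pow_pred_clog_lt_self (b := 2) (by norm_num) (x := n + n + 2) (by omega)
  have h1 : 0 < Nat.clog 2 (n + n + 2) := Nat.clog_pos (by norm_num) (by omega)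
  obtain ⟨L, hL⟩ := Nat.exists_eq_succ_of_ne_zero h1.ne'
  rw [hL] at h ⊢
  simp only [Nat.pred_succ, Nat.succ_eq_add_one, pow_succ] at h ⊢
  omega

/-- From `2 ^ L ≤ 6 n ≤ n ^ 4` and `log 2 ≤ log n` it follows that `(L + 2) * log 2 ≤ 6 * log n`,
and `6 / log 2 < 10`. -/
theorem clog_add_two_le {n : ℕ} (hn : 2 ≤ n) :
    (Nat.clog 2 (n + n + 2) : ℝ) + 2 ≤ 10 * Real.log n := by
  have hn' : (2 : ℝ) ≤ n := by exact_mod_cast hn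
  have h2 := Real.log_two_gt_d9
  have h3 : Real.log 2 ≤ Real.log n := Real.log_le_log (by norm_num) hn'
  have h4 : (2 : ℝ) ^ Nat.clog 2 (n + n + 2) ≤ n ^ 4 := by
    have : 2 ^ Nat.clog 2 (n + n + 2) ≤ n ^ 4 := (two_pow_clog_le hn).trans (by
      have : 2 ^ 3 ≤ n ^ 3 := Nat.pow_le_pow_left hn 3
      rw [pow_succ n 3]
      exact Nat.mul_le_mul_right _ (by omega))
    exact_mod_cast this
  have h5 := Real.log_le_log (by positivity) h4
  rw [Real.log_pow, Real.log_pow] at h5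
  push_cast at h5
  nlinarith

/-- With `y = 10 * log n ≥ L + 2` and `P = n + 1 / ε ^ 2`, the number of samples is at most `21 * 3
^ d * P * y ^ d`, and each costs at most `230 * (d + 1) * y ^ d * y`. The extra factor `y` pays for
the descents in the trees, which dominate when `d` is `0` or `1` up to constants. The factor `3 ^ d`
comes from `2 (L + 2) + 1 ≤ 3 y`. -/
theorem time_le {n m N d : ℕ} {ε : ℝ} (hn : 2 ≤ n) (hε : 0 < ε)
    (hm : m ≤ n * (2 * (Nat.clog 2 (n + n + 2) + 2)) ^ d)
    (hN : (N : ℝ) ≤ 10 * ((1 + ε) / ε) ^ 2 * (Nat.clog 2 (n + n + 2) + 1 : ℕ) ^ d + m) :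
    ((preprocessTime (Nat.clog 2 (n + n + 2)) n d +
      estimateTime (Nat.clog 2 (n + n + 2)) d m N : ℕ) : ℝ) ≤
      (10000 * (d + 1) * 3 ^ d * 10 ^ (2 * d + 1)) *
        ((n + 1 / ε ^ 2) * Real.log n ^ (2 * d + 1)) := by
  have hL := clog_add_two_le hn
  have h2L : (2 : ℝ) ^ Nat.clog 2 (n + n + 2) ≤ 6 * n := by exact_mod_cast two_pow_clog_le hn
  set L := Nat.clog 2 (n + n + 2)
  set y := 10 * Real.log n with hy
  have hn1 : (2 : ℝ) ≤ n := by exact_mod_cast hn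
  have hL0 : (0 : ℝ) ≤ L := Nat.cast_nonneg _
  have hy1 : 1 ≤ y := by linarith
  set P : ℝ := n + 1 / ε ^ 2 with hP
  have hε2 : 0 < 1 / ε ^ 2 := by positivity
  have hnP : (n : ℝ) ≤ P := by linarith
  set Y : ℝ := y ^ (2 * d + 1) with hY
  have hyY : y ≤ Y := le_self_pow₀ hy1 (by omega)
  have hdY : y ^ d ≤ Y := pow_le_pow_right₀ hy1 (by omega)
  have hd1 : 1 ≤ y ^ d := one_le_pow₀ hy1
  have hdd : y ^ d * y ≤ Y := by rw [← pow_succ]; exact pow_le_pow_right₀ hy1 (by omega)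
  have h3 : (1 : ℝ) ≤ 3 ^ d := one_le_pow₀ (by norm_num)
  have hPY : 1 ≤ P * Y := by nlinarith
  have hnY : n * Y ≤ P * Y := by gcongr
  have e1 : (m : ℝ) ≤ 3 ^ d * (P * y ^ d) := by
    have : (m : ℝ) ≤ n * (2 * (L + 2)) ^ d := by exact_mod_cast hm
    calc (m : ℝ) ≤ n * (2 * (L + 2)) ^ d := this
      _ ≤ P * (3 * y) ^ d := by gcongr; norm_num
      _ = _ := by rw [mul_pow]; ring
  have e2 : (N : ℝ) ≤ 21 * 3 ^ d * (P * y ^ d) := by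
    have h4 : ((1 + ε) / ε) ^ 2 ≤ 2 * P := by
      have : (1 + ε) / ε = 1 + 1 / ε := by field_simp; ring
      rw [this]
      have h5 : 1 / ε ^ 2 = (1 / ε) ^ 2 := by ring
      rw [hP, h5]
      -- `(1 + 1 / ε) ^ 2 ≤ 2 * (1 + 1 / ε ^ 2)`, and `1 ≤ n`.
      nlinarith [sq_nonneg (1 - 1 / ε)]
    have h6 : ((L + 1 : ℕ) : ℝ) ^ d ≤ y ^ d := by
      push_cast
      gcongr
      linarith
    calc (N : ℝ) ≤ 10 * ((1 + ε) / ε) ^ 2 * ((L + 1 : ℕ) : ℝ) ^ d + m := hN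
      _ ≤ 10 * (2 * P) * y ^ d + 3 ^ d * (P * y ^ d) := by gcongr
      _ ≤ _ := by nlinarith [mul_nonneg (sub_nonneg.2 h3) (by positivity : 0 ≤ P * y ^ d)]
  have e3 : (d * (L * 50 + 120) + (L + 2) ^ d * (40 * d + 20) + 50 : ℝ) ≤
      230 * (d + 1) * (y ^ d * y) := by
    have h4 : ((L : ℝ) + 2) ^ d ≤ y ^ d := by gcongr
    have h5 : y ≤ y ^ d * y := by nlinarith
    have h6 : y ^ d ≤ y ^ d * y := by nlinarith
    calc (d * (L * 50 + 120) + (L + 2) ^ d * (40 * d + 20) + 50 : ℝ)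
        ≤ d * (120 * (y ^ d * y)) + (y ^ d * y) * (40 * d + 20) + 50 * (y ^ d * y) := by
          gcongr <;> linarith
      _ ≤ _ := by
        have h7 : 0 ≤ y ^ d * y := by positivity
        have h8 : 0 ≤ d * (y ^ d * y) := by positivity
        linarith
  have hD : (0 : ℝ) ≤ d := Nat.cast_nonneg _
  have hYY : y ^ d * (y ^ d * y) = Y := by rw [hY]; ring
  have f1 : (estimateTime L d m N : ℝ) ≤ 5000 * (d + 1) * 3 ^ d * (P * Y) := by
    have h4 : (1 : ℝ) ≤ (d + 1) * 3 ^ d := one_le_mul_of_one_le_of_one_le (by linarith) h3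
    have h5 : (m : ℝ) ≤ (d + 1) * 3 ^ d * (P * Y) := by
      refine e1.trans ?_
      gcongr
      exact le_mul_of_one_le_left (by positivity) (by linarith)
    have h6 : 1 ≤ (d + 1) * 3 ^ d * (P * Y) := one_le_mul_of_one_le_of_one_le h4 hPY
    rw [estimateTime]
    push_cast
    calc _ ≤ 21 * 3 ^ d * (P * y ^ d) * (230 * (d + 1) * (y ^ d * y)) +
          70 * ((d + 1) * 3 ^ d * (P * Y)) + 14 * ((d + 1) * 3 ^ d * (P * Y)) := by
          gcongr
          linarith
      _ = 4914 * (d + 1) * 3 ^ d * (P * Y) := by rw [← hYY]; ring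
      _ ≤ _ := by gcongr; norm_num
  have f2 : (preprocessTime L n d : ℝ) ≤ 5000 * (d + 1) * 3 ^ d * (P * Y) := by
    have hP1 : 1 ≤ P := by linarith
    have hZ1 : y ≤ P * Y := hyY.trans (le_mul_of_one_le_left (by linarith) hP1)
    have hZ2 : n ≤ P * Y := hnP.trans (le_mul_of_one_le_right (by linarith) (by linarith))
    have hZ3 : n * y ≤ P * Y := by gcongr
    have hZ4 : n * y ^ d ≤ P * Y := by gcongr
    have g1 : (2 : ℝ) ^ L * (L * 360 + 360) ≤ 2160 * (P * Y) := by
      calc (2 : ℝ) ^ L * (L * 360 + 360) ≤ 6 * n * (360 * y) := by gcongr; linarith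
        _ ≤ _ := by linarith
    have g2 : (n : ℝ) * (d * ((L + 2) * 60 + 60) + 15 + (2 * (L + 2) + 1) ^ d * (90 * d + 80)) ≤
        (120 * d + 15 + 3 ^ d * (90 * d + 80)) * (P * Y) := by
      calc (n : ℝ) * (d * ((L + 2) * 60 + 60) + 15 + (2 * (L + 2) + 1) ^ d * (90 * d + 80))
          ≤ n * (d * (120 * y) + 15 + (3 * y) ^ d * (90 * d + 80)) := by gcongr <;> linarith
        _ = 120 * d * (n * y) + 15 * n + 3 ^ d * (90 * d + 80) * (n * y ^ d) := by
          rw [mul_pow]; ring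
        _ ≤ 120 * d * (P * Y) + 15 * (P * Y) + 3 ^ d * (90 * d + 80) * (P * Y) := by gcongr
        _ = _ := by ring
    have g3 : (2 : ℝ) ^ (L + 1) * 30 + 20 ≤ 380 * (P * Y) := by rw [pow_succ]; linarith
    have g4 : (d + 1 : ℝ) * (P * Y) ≤ (d + 1) * 3 ^ d * (P * Y) := by
      gcongr
      exact le_mul_of_one_le_right (by linarith) h3
    have g5 : 0 ≤ d * (P * Y) := by positivity
    have g6 : 0 ≤ 3 ^ d * (P * Y) := by positivity
    have g7 : 0 ≤ d * 3 ^ d * (P * Y) := by positivity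
    rw [preprocessTime]
    push_cast
    have g8 : d * (2 ^ L * (L * 360 + 360)) ≤ d * (2160 * (P * Y)) := by gcongr
    have g9 : d * (2 ^ (L + 1) * 30 + 20) ≤ d * (380 * (P * Y)) := by gcongr
    have g10 : (d : ℝ) * 1 ≤ d * (P * Y) := by gcongr
    linarith
  have hYe : Y = 10 ^ (2 * d + 1) * Real.log n ^ (2 * d + 1) := by rw [hY, hy, mul_pow]
  push_cast
  calc _ ≤ 5000 * (d + 1) * 3 ^ d * (P * Y) + 5000 * (d + 1) * 3 ^ d * (P * Y) := add_le_add f2 f1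
    _ = _ := by rw [hYe]; ring

end Klee

/-! ### Reading the input and assembling the proof -/

namespace Klee
open RealRAM MeasureTheory

variable {n d : ℕ}

theorem real_input_lo {ε : ℝ} {lo hi : Fin n → Fin d → ℝ} (i : Fin n) (k : Fin d) :
    (input ε lo hi).real (k + 1) i = lo i k := by
  have := k.2
  simp only [input]
  rw [if_neg (by omega), dif_pos ⟨i.2, by omega, by omega⟩]
  rfl

theorem real_input_hi {ε : ℝ} {lo hi : Fin n → Fin d → ℝ} (i : Fin n) (k : Fin d) :
    (input ε lo hi).real (d + 1 + k) i = hi i k := by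
  have := k.2
  simp only [input]
  rw [if_neg (by omega), dif_neg (by omega), dif_pos ⟨i.2, by omega, by omega⟩]
  congr
  simp

theorem exists_ready {ε : ℝ} (lo hi : Fin n → Fin d → ℝ) :
    ∃ (t : ℕ) (s : State) (its : List (ℕ → ℕ)), (∀ ω, Exec ω (Code.preprocess d)
      (input ε lo hi) t s) ∧ t ≤ preprocessTime (Nat.clog 2 (n + n + 2)) n d ∧
      Ready (Nat.clog 2 (n + n + 2)) n d ε (fun k => (input ε lo hi).real (k + 1))
        (fun k => (input ε lo hi).real (d + 1 + k)) its s := by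
  obtain ⟨t, s, h1, h2, its, h3⟩ := run_preprocess (ω := fun _ => 0) (d := d) (n := n) (ε := ε)
    (s := input ε lo hi) (by simp [input, nv])
    (fun a ha i => by
      have : nv a ≠ 0 := fun h => ha (nv_inj.1 (h.trans rfl))
      simp [input, this])
    (fun a i => by
      have := lt_rv d a
      simp only [input]
      rw [if_neg (by omega), dif_neg (by omega), dif_neg (by omega)])
    (by simp [input]) rfl
  refine ⟨t, s, its, fun ω => h1.of_not_draws ?_, h2, h3⟩
  simp [Code.preprocess, Code.setup, Code.prepare, Code.load, Code.enter, Code.extract, Code.inner,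
    Code.update, Code.play, Code.tabulate, Code.collect, Code.cover, Code.nest, Code.key,
    Code.append, Code.factor]

end Klee

theorem theorem2 (d : ℕ) :
    ∃ (p : RealRAM.Prog) (C : ℝ), ∀ (n : ℕ) (ε : ℝ) (lo hi : Fin n → Fin d → ℝ),
      2 ≤ n → 0 < ε → (∀ i k, lo i k ≤ hi i k) →
        (∀ ω : RealRAM.Source, ∃ (t : ℕ) (s : RealRAM.State),
          RealRAM.Exec ω p (Klee.input ε lo hi) t s ∧
            (t : ℝ) ≤ C * (((n : ℝ) + 1 / ε ^ 2) * Real.log n ^ (2 * d + 1))) ∧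
        RealRAM.sourceLaw {ω : RealRAM.Source | ∃ (t : ℕ) (s : RealRAM.State),
          RealRAM.Exec ω p (Klee.input ε lo hi) t s ∧
            ¬ Klee.IsApprox ε (Klee.unionVolume lo hi) (Klee.output s)} ≤ 1 / 10 := by
  classical
  refine ⟨Klee.Code.main d, 10000 * (d + 1) * 3 ^ d * 10 ^ (2 * d + 1),
    fun n ε lo hi hn hε _ => ?_⟩
  obtain ⟨t₁, s₁, its, he₁, ht₁, h⟩ := Klee.exists_ready (ε := ε) lo hi
  obtain ⟨v, hA, hv⟩ := h.exists_isNodeSet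
  set L := Nat.clog 2 (n + n + 2) with hL
  set left : ℕ → ℕ → ℝ := fun k => s₁.real (Klee.rv d (.left k))
  set right : ℕ → ℕ → ℝ := fun k => s₁.real (Klee.rv d (.right k))
  let K : ℝ := 10 * ((1 + ε) / ε) ^ 2 * (L + 1 : ℕ) ^ d
  let S : ℝ := (its.map (Klee.boxVol d left right)).sum
  -- The item volumes extended by zero, so that the sample numbers form a sequence on all of `ℕ`.
  let a : ℕ → ℝ := fun j => if hj : j < its.length then Klee.boxVol d left right its[j] else 0
  let N : ℕ → ℕ := fun j => ⌈K * a j / S⌉₊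
  have ha : ∀ (j : ℕ) (hj : j < its.length), a j = Klee.boxVol d left right its[j] :=
    fun j hj => dif_pos hj
  have ha0 : ∀ j < its.length, 0 ≤ a j := fun j hj => by
    rw [ha j hj]; exact hA.boxVol_nonneg (by simp)
  have haS : ∑ j ∈ Finset.range its.length, a j = S := by
    rw [Finset.sum_range]
    simp only [a, S, Fin.is_lt, dif_pos]
    rw [← Fin.sum_univ_fun_getElem]
  have hS0 : 0 ≤ S := haS ▸ Finset.sum_nonneg fun j hj => ha0 j (Finset.mem_range.1 hj)
  have hSa : ∀ j < its.length, S = 0 → a j = 0 := fun j hj h0 =>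
    (Finset.sum_eq_zero_iff_of_nonneg fun j hj => ha0 j (Finset.mem_range.1 hj)).1
      (haS.trans h0) j (Finset.mem_range.2 hj)
  have hV : MeasureTheory.volume.real (Klee.nodeUnion d left right its.toFinset) =
      Klee.unionVolume lo hi :=
    hA.volume_nodeUnion (n := n) (r := fun k => s₁.nat (Klee.nv (.rank k)))
      (fun i k => by simpa only [Klee.real_input_lo, Klee.real_input_hi] using hv i i.2 k k.2)
      (fun τ => by rw [List.mem_toFinset, h.mem])
  have hrun : ∀ ω, RealRAM.Run ω (Klee.Code.main d) (Klee.input ε lo hi)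
      (Klee.preprocessTime L n d +
        Klee.estimateTime L d its.length (∑ j ∈ Finset.range its.length, N j))
      fun s' => Klee.output s' = Klee.estimator L d left right its N ω := fun ω => by
    obtain ⟨t₂, s₂, he₂, ht₂, h₂⟩ := Klee.run_estimate_output (ω := ω) (N := N) h fun j hj c => by
      rw [h.fac, ← ha j hj]
      exact Klee.lt_sampleCount_iff hS0 (hSa j hj) c
    exact ⟨_, s₂, .seq (he₁ ω) he₂, add_le_add ht₁ ht₂, h₂⟩
  refine ⟨fun ω => ?_, ?_⟩
  · obtain ⟨t, s, he, ht, -⟩ := hrun ω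
    refine ⟨t, s, he, le_trans (Nat.cast_le.2 ht) (Klee.time_le hn hε h.length ?_)⟩
    exact Klee.sum_sampleCount_le (by positivity) ha0 haS
  · refine (MeasureTheory.measure_mono ?_).trans
      (hA.estimator_isApprox (N := N) h.items.nodup hε rfl fun j hj => by rw [← ha j hj])
    -- Runs are unique, so a failing run is the run described by `hrun`, and its output is the
    -- estimator.
    rintro ω ⟨t, s, he, hs⟩
    obtain ⟨t', s', he', -, h'⟩ := hrun ω
    obtain ⟨-, rfl⟩ := he.unique he'
    rwa [h', ← hV] at hs
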